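/- Write points of $\mathbb R^4$ as $(x_1,x_2,y_1,y_2)$, put $z_j=x_j+iy_j$, $\frac{\partial}{\partial\bar z_2}=\frac12\left(\frac{\partial}{\partial x_2}+i\frac{\partial}{\partial y_2}\right)$, and let $\Omega=\{y_1>0,\ y_2>0\}$. For a function $f$ on $\Omega$ let $f^{o1}$ be its extension to $\mathbb R^4$ that is odd in $y_1$ and $0$ for $y_2<0$, and let $f^{o12}$ be its extension that is odd in $y_1$ and odd in $y_2$. Let $g:\overline\Omega\to\mathbb C$ be a Schwartz function on $\overline\Omega$, that is, the restriction to $\overline\Omega$ of a Schwartz function on $\mathbb R^4$, and let $$\hat g^{o1}(\xi_1,\xi_2,\eta_1,\eta_2)=\int_{\mathbb R^4} g^{o1}\,e^{-i(x_1\xi_1+x_2\xi_2+y_1\eta_1+y_2\eta_2)}\,dx_1\,dx_2\,dy_1\,dy_2 ,\qquad \operatorname{Im}\eta_2\le 0 .$$ For $2<p<\infty$, $2<q<4$ and $2<r<\infty$, call a function $u$ on $\Omega$ a $(p,q,r)$-solution if (i) $u^{o1}\in L^p(\mathbb R^4)$ and $\Delta u=g$ in $\Omega$ in the sense of distributions;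 (ii) the distributional derivative $\frac{\partial u}{\partial\bar z_2}$ on $\Omega$ is a function with $\left(\frac{\partial u}{\partial\bar z_2}\right)^{o1}\in L^p(\mathbb R^4)$; (iii) ($u=0$ on $y_1=0$) $\ \|u^{o1}(\cdot,\cdot,y_1,\cdot)\|_{L^q(\mathbb R^3)}\to0$ as $y_1\to0$; (iv) ($\frac{\partial u}{\partial\bar z_2}=0$ on $y_2=0$) $\ \left\|\left(\frac{\partial u}{\partial\bar z_2}\right)^{o12}(\cdot,\cdot,\cdot,y_2)\right\|_{L^r(\mathbb R^3)}\to0$ as $y_2\to0$; here functions are identified when they agree almost everywhere, and the limits in (iii) and (iv) are essential limits (over almost all $y_1$, respectively $y_2$). Proposition. There is a function $u$ on $\Omega$ such that $u^{o1}$ is the inverse Fourier transform, in the sense of tempered distributions on $\mathbb R^4$, of the function $$-\frac{\hat g^{o1}(\xi_1,\xi_2,\eta_1,\eta_2)}{\xi_1^2+\xi_2^2+\eta_1^2+\eta_2^2}+\frac{i\eta_2-\xi_2}{\zeta-\xi_2}\,\frac{\hat g^{o1}(\xi_1,\xi_2,\eta_1,-i\zeta)}{\xi_1^2+\xi_2^2+\eta_1^2+\eta_2^2},\qquad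 \zeta=\sqrt{\xi_1^2+\xi_2^2+\eta_1^2}.$$ This $u$ is a $(p,q,r)$-solution for all $p\in(2,\infty)$, $q\in(2,4)$ and $r\in(2,\infty)$. It is unique: for any $p\in(2,\infty)$, $q\in(2,4)$ and $r\in(2,\infty)$, every $(p,q,r)$-solution $w$ satisfies $w^{o1}=u^{o1}$ almost everywhere. -/

import Mathlib

open MeasureTheory Filter Topology
open scoped ContDiff ENNReal SchwartzMap

noncomputable section

/-- Real four-space with coordinates `x 0 = x₁`, `x 1 = x₂`, `x 2 = y₁`, `x 3 = y₂`, so that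
`z₁ = x₁ + i y₁` and `z₂ = x₂ + i y₂`. On the Fourier side the coordinates are
`ξ₁, ξ₂, η₁, η₂` in this order. -/
abbrev R4 : Type := EuclideanSpace ℝ (Fin 4)

/-- Real three-space, where the slices of functions on `R4` live. -/
abbrev R3 : Type := EuclideanSpace ℝ (Fin 3)

/-- The product of two half-planes `{y₁ > 0} × {y₂ > 0}`. -/
def cornerDomain : Set R4 := {x | 0 < x 2 ∧ 0 < x 3}

/-- Schwartz functions on the closure of the domain: the restrictions to it of Schwartz functions
on the whole space. Values of `g` off the closure are irrelevant. -/
def IsSchwartzOnClosure (g : R4 → ℂ) : Prop :=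
  ∃ G : 𝓢(R4, ℂ), Set.EqOn g G (closure cornerDomain)

/-- Reflection `y₁ ↦ -y₁`. -/
def reflY1 (x : R4) : R4 := !₂[x 0, x 1, -(x 2), x 3]

/-- Reflection `y₂ ↦ -y₂`. -/
def reflY2 (x : R4) : R4 := !₂[x 0, x 1, x 2, -(x 3)]

/-- The extension `f ↦ f^{o1}` of a function on the domain: odd in `y₁`, and `0` for `y₂ < 0`
(the value `0` on the null set `y₁ y₂ = 0` is a convention). -/
def extO1 (f : R4 → ℂ) (x : R4) : ℂ :=
  if x 3 ≤ 0 then 0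
  else if 0 < x 2 then f x
  else if x 2 < 0 then -f (reflY1 x)
  else 0

/-- The extension `f ↦ f^{o12}` of a function on the domain: odd in `y₁` and odd in `y₂`. -/
def extO12 (f : R4 → ℂ) (x : R4) : ℂ :=
  extO1 f x - extO1 f (reflY2 x)

/-- The Fourier transform `∫ f(x) e^{-i (x₁ξ₁ + x₂ξ₂ + y₁η₁ + y₂η₂)} dx`, where the last
frequency `η₂` may be complex (used for `f` supported in `y₂ ≥ 0` and `Im η₂ ≤ 0`). -/
def fourierC (f : R4 → ℂ) (ξ₁ ξ₂ η₁ : ℝ) (η₂ : ℂ) : ℂ :=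
  ∫ x : R4, f x * Complex.exp (-Complex.I *
    ((x 0 : ℂ) * ξ₁ + (x 1 : ℂ) * ξ₂ + (x 2 : ℂ) * η₁ + (x 3 : ℂ) * η₂))

/-- `ζ = (ξ₁² + ξ₂² + η₁²)^{1/2}`. -/
def zetaRoot (k : R4) : ℝ := Real.sqrt ((k 0) ^ 2 + (k 1) ^ 2 + (k 2) ^ 2)

/-- The explicit Fourier-side formula for the solution with datum `g`. -/
def solnHat (g : R4 → ℂ) (k : R4) : ℂ :=
  -(fourierC (extO1 g) (k 0) (k 1) (k 2) (k 3 : ℂ) /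
      (((k 0) ^ 2 + (k 1) ^ 2 + (k 2) ^ 2 + (k 3) ^ 2 : ℝ) : ℂ))
  + (Complex.I * (k 3 : ℂ) - (k 1 : ℂ)) / ((zetaRoot k : ℂ) - (k 1 : ℂ)) *
      (fourierC (extO1 g) (k 0) (k 1) (k 2) (-Complex.I * (zetaRoot k : ℂ)) /
        (((k 0) ^ 2 + (k 1) ^ 2 + (k 2) ^ 2 + (k 3) ^ 2 : ℝ) : ℂ))

/-- The classical inverse Fourier transform `(2π)⁻⁴ ∫ φ(x) e^{i x·k} dx` on Schwartz functions. -/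
def invFourier (φ : 𝓢(R4, ℂ)) (k : R4) : ℂ :=
  ((2 * Real.pi : ℝ) : ℂ)⁻¹ ^ 4 *
    ∫ x : R4, φ x * Complex.exp (Complex.I * ((inner ℝ x k : ℝ) : ℂ))

/-- The function `u` is the inverse Fourier transform of the function `U` in the sense of tempered
distributions: both define tempered distributions by integration and `⟨u, φ⟩ = ⟨U, φ̌⟩`, where `φ̌`
is the inverse Fourier transform of the Schwartz function `φ`. -/
def IsInverseFourier (U u : R4 → ℂ) : Prop :=
  ∀ φ : 𝓢(R4, ℂ),
    Integrable (fun x => u x * φ x) ∧ Integrable (fun k => U k * invFourier φ k) ∧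
      ∫ x, u x * φ x = ∫ k, U k * invFourier φ k

/-- Test functions on the (open) domain. -/
def IsTestFunction (φ : R4 → ℂ) : Prop :=
  ContDiff ℝ ∞ φ ∧ HasCompactSupport φ ∧ tsupport φ ⊆ cornerDomain

/-- `∂φ/∂z̄₂ = ½ (∂φ/∂x₂ + i ∂φ/∂y₂)`. -/
def dbar2 (φ : R4 → ℂ) (x : R4) : ℂ :=
  (1 / 2) * (fderiv ℝ φ x (EuclideanSpace.single 1 1) +
    Complex.I * fderiv ℝ φ x (EuclideanSpace.single 3 1))

/-- `Δu = g` on the domain in the sense of distributions. -/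
def IsWeakPoisson (u g : R4 → ℂ) : Prop :=
  ∀ φ : R4 → ℂ, IsTestFunction φ →
    ∫ x in cornerDomain, u x * Laplacian.laplacian φ x = ∫ x in cornerDomain, g x * φ x

/-- `∂u/∂z̄₂ = v` on the domain in the sense of distributions. -/
def IsWeakDbar2 (u v : R4 → ℂ) : Prop :=
  ∀ φ : R4 → ℂ, IsTestFunction φ →
    ∫ x in cornerDomain, u x * dbar2 φ x = -∫ x in cornerDomain, v x * φ x

/-- `‖f(·,·,y₁,·)‖_{L^q(ℝ³)} → 0` as `y₁ → 0`. As `f` is only determined almost everywhere, the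
limit is the essential one, over almost all `y₁`. -/
def VanishesAtY1 (f : R4 → ℂ) (q : ℝ≥0∞) : Prop :=
  Tendsto (fun t : ℝ => eLpNorm (fun s : R3 => f !₂[s 0, s 1, t, s 2]) q volume)
    (𝓝 0 ⊓ ae volume) (𝓝 0)

/-- `‖f(·,·,·,y₂)‖_{L^q(ℝ³)} → 0` as `y₂ → 0`, with the same reading. -/
def VanishesAtY2 (f : R4 → ℂ) (q : ℝ≥0∞) : Prop :=
  Tendsto (fun t : ℝ => eLpNorm (fun s : R3 => f !₂[s 0, s 1, s 2, t]) q volume)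
    (𝓝 0 ⊓ ae volume) (𝓝 0)

/-- `u` is an `L^p` solution of `Δu = g` on the domain, with `∂u/∂z̄₂` in `L^p`, which satisfies
`u = 0` on `y₁ = 0` in the `L^q` sense and `∂u/∂z̄₂ = 0` on `y₂ = 0` in the `L^r` sense.
Only the values of `u` on the domain matter. -/
def IsMixedSolution (g : R4 → ℂ) (p q r : ℝ≥0∞) (u : R4 → ℂ) : Prop :=
  MemLp (extO1 u) p volume ∧ IsWeakPoisson u g ∧ VanishesAtY1 (extO1 u) q ∧
    ∃ v : R4 → ℂ, IsWeakDbar2 u v ∧ MemLp (extO1 v) p volume ∧ VanishesAtY2 (extO12 v) r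

end

/-! Write `k = (ξ₁, ξ₂, η₁)`, `κ = ξ₂` and `z = |k| = ζ`.

Existence. Transforming the odd extension in `(x₁, x₂, y₁)` encodes the condition on `y₁ = 0` as
oddness in `η₁`. For each `k` there remains the half-line problem `W'' - z² W = src` for `y₂ > 0`
with `W' + κ W = 0` at `0`, the image of `∂u/∂z̄₂ = 0`. Its decaying solution `solW` is the integral
of `src` against `greenK`, a free kernel plus a reflected one with coefficient `(z + κ)/(z - κ)`.
The transform of `greenK` in `y₂` (`integral_greenK_mul_exp`) is the stated multiplier, whence the
formula (`solnHat_eq`, `isInverseFourier_fld`). The distributional equations are transposed to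
identities on the half line (`integral_greenK_mul_poisson`, `integral_greenK_mul_dbar`).

The difficulty is the factor `1/(z - κ)`, which is at most `2z/(ξ₁² + η₁²)` and blows up where `ξ₁ =
η₁ = 0` and `ξ₂ ≥ 0`. The source is a sine transform in `y₁` and contributes a factor `|η₁|`, so the
amplitude is controlled by `|η₁|/(ξ₁² + η₁²)` times decaying factors (`exists_solW_bound`). This
weight is in `L^σ` for `1 ≤ σ < 2`, and the weak Hausdorff-Young inequality `lintegral_osc_rpow_le`
converts it into `L^p` bounds for `p > 2`. For `∂u/∂z̄₂` the factor `z - κ` cancels: its kernel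
`dbarK` is bounded by the free kernel and vanishes at `y₂ = 0`. Both boundary limits follow from
Plancherel on slices, which gives `L²` convergence, and a uniform bound, which upgrades it to every
finite exponent above `2` (`tendsto_eLpNorm_of_sq`).

Uniqueness. The difference `f` of two solutions is odd in `y₁`, and the vanishing of its slices
makes it harmonic across `y₁ = 0` (`weak_lap_of_odd`). Then `∂f/∂z̄₂` is harmonic for `y₂ > 0`. Its
odd extension in `y₂` is harmonic on all of `ℝ⁴` by the same reflection principle, and being in
`L^p` it is zero by Liouville's theorem. Since `4 ∂/∂z₂ ∂/∂z̄₂` is the Laplacian in `(x₂, y₂)`, `f`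
is now harmonic in `(x₁, y₁)` alone. Liouville's theorem in these two variables
(`integral_mul_test_eq_zero_of_weak_harmonic` covers both cases) gives `f = 0`. -/

open scoped FourierTransform

/-! ### Coordinate insertion and Fubini on Euclidean spaces -/

/-- Insertion of a coordinate, as a measurable equivalence of Euclidean spaces. -/
noncomputable def insEquiv {n : ℕ} (i : Fin (n + 1)) :
    EuclideanSpace ℝ (Fin n) × ℝ ≃ᵐ EuclideanSpace ℝ (Fin (n + 1)) :=
  (MeasurableEquiv.prodComm.trans
    (MeasurableEquiv.prodCongr (MeasurableEquiv.refl ℝ)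
      (MeasurableEquiv.toLp 2 (Fin n → ℝ)).symm)).trans
  ((MeasurableEquiv.piFinSuccAbove (fun _ => ℝ) i).symm.trans
    (MeasurableEquiv.toLp 2 (Fin (n + 1) → ℝ)))

lemma insEquiv_apply {n : ℕ} (i : Fin (n + 1)) (s : EuclideanSpace ℝ (Fin n)) (t : ℝ) :
    insEquiv i (s, t) = WithLp.toLp 2 (i.insertNth t s.ofLp) := rfl

@[simp] lemma insEquiv_same {n : ℕ} (i : Fin (n + 1)) (s : EuclideanSpace ℝ (Fin n)) (t : ℝ) :
    insEquiv i (s, t) i = t := by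
  simp [insEquiv_apply]

@[simp] lemma insEquiv_succAbove {n : ℕ} (i : Fin (n + 1)) (j : Fin n)
    (s : EuclideanSpace ℝ (Fin n)) (t : ℝ) :
    insEquiv i (s, t) (i.succAbove j) = s j := by
  simp [insEquiv_apply]

lemma measurePreserving_insEquiv {n : ℕ} (i : Fin (n + 1)) :
    MeasurePreserving (insEquiv i)
      ((volume : Measure (EuclideanSpace ℝ (Fin n))).prod volume) volume := by
  have h1 : MeasurePreserving
      (MeasurableEquiv.prodComm : EuclideanSpace ℝ (Fin n) × ℝ ≃ᵐ ℝ × EuclideanSpace ℝ (Fin n))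
      ((volume : Measure (EuclideanSpace ℝ (Fin n))).prod volume) (volume.prod volume) :=
    Measure.measurePreserving_swap
  have h2 : MeasurePreserving (MeasurableEquiv.prodCongr (MeasurableEquiv.refl ℝ)
      (MeasurableEquiv.toLp 2 (Fin n → ℝ)).symm)
      ((volume : Measure ℝ).prod (volume : Measure (EuclideanSpace ℝ (Fin n))))
      (volume.prod volume) :=
    (MeasurePreserving.id volume).prod (EuclideanSpace.volume_preserving_symm_measurableEquiv_toLp _)
  have h3 := (volume_preserving_piFinSuccAbove (fun _ : Fin (n + 1) => ℝ) i).symm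
  have h4 := (EuclideanSpace.volume_preserving_symm_measurableEquiv_toLp (Fin (n + 1))).symm
  exact h4.comp (h3.comp (h2.comp h1))

lemma insEquiv_two (s : R3) (t : ℝ) : insEquiv (2 : Fin 4) (s, t) = !₂[s 0, s 1, t, s 2] := by
  ext j
  fin_cases j
  · exact insEquiv_succAbove (2 : Fin 4) 0 s t
  · exact insEquiv_succAbove (2 : Fin 4) 1 s t
  · exact insEquiv_same (2 : Fin 4) s t
  · exact insEquiv_succAbove (2 : Fin 4) 2 s t

lemma insEquiv_three (s : R3) (t : ℝ) : insEquiv (3 : Fin 4) (s, t) = !₂[s 0, s 1, s 2, t] := by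
  ext j
  fin_cases j
  · exact insEquiv_succAbove (3 : Fin 4) 0 s t
  · exact insEquiv_succAbove (3 : Fin 4) 1 s t
  · exact insEquiv_succAbove (3 : Fin 4) 2 s t
  · exact insEquiv_same (3 : Fin 4) s t

lemma insEquiv_two_R3 (s : EuclideanSpace ℝ (Fin 2)) (t : ℝ) :
    insEquiv (2 : Fin 3) (s, t) = !₂[s 0, s 1, t] := by
  ext j
  fin_cases j
  · exact insEquiv_succAbove (2 : Fin 3) 0 s t
  · exact insEquiv_succAbove (2 : Fin 3) 1 s t
  · exact insEquiv_same (2 : Fin 3) s t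

section Fubini

variable {n : ℕ} (i : Fin (n + 1))

lemma integrable_insEquiv_iff {F : Type*} [NormedAddCommGroup F]
    {f : EuclideanSpace ℝ (Fin (n + 1)) → F} :
    Integrable (fun p : EuclideanSpace ℝ (Fin n) × ℝ => f (insEquiv i p))
      (volume.prod volume) ↔ Integrable f :=
  (measurePreserving_insEquiv i).integrable_comp_emb (insEquiv i).measurableEmbedding

lemma integral_insEquiv {F : Type*} [NormedAddCommGroup F] [NormedSpace ℝ F]
    (f : EuclideanSpace ℝ (Fin (n + 1)) → F) :
    ∫ p : EuclideanSpace ℝ (Fin n) × ℝ, f (insEquiv i p) ∂(volume.prod volume) = ∫ x, f x :=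
  (measurePreserving_insEquiv i).integral_comp (insEquiv i).measurableEmbedding f

lemma lintegral_insEquiv (f : EuclideanSpace ℝ (Fin (n + 1)) → ℝ≥0∞) :
    ∫⁻ p : EuclideanSpace ℝ (Fin n) × ℝ, f (insEquiv i p) ∂(volume.prod volume) = ∫⁻ x, f x :=
  (measurePreserving_insEquiv i).lintegral_comp_emb (insEquiv i).measurableEmbedding f

lemma integral_eq_integral_integral_insEquiv {F : Type*} [NormedAddCommGroup F] [NormedSpace ℝ F]
    {f : EuclideanSpace ℝ (Fin (n + 1)) → F} (hf : Integrable f) :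
    ∫ x, f x = ∫ s, ∫ t, f (insEquiv i (s, t)) := by
  rw [← integral_insEquiv i]
  exact integral_prod _ ((integrable_insEquiv_iff i).2 hf)

lemma integral_eq_integral_integral_insEquiv_swap {F : Type*} [NormedAddCommGroup F]
    [NormedSpace ℝ F] {f : EuclideanSpace ℝ (Fin (n + 1)) → F} (hf : Integrable f) :
    ∫ x, f x = ∫ t, ∫ s, f (insEquiv i (s, t)) := by
  rw [← integral_insEquiv i]
  exact integral_prod_symm _ ((integrable_insEquiv_iff i).2 hf)

lemma lintegral_eq_lintegral_lintegral_insEquiv {f : EuclideanSpace ℝ (Fin (n + 1)) → ℝ≥0∞}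
    (hf : AEMeasurable f) : ∫⁻ x, f x = ∫⁻ t, ∫⁻ s, f (insEquiv i (s, t)) := by
  rw [← lintegral_insEquiv i]
  exact lintegral_prod_symm _
    (hf.comp_quasiMeasurePreserving (measurePreserving_insEquiv i).quasiMeasurePreserving)

lemma aestronglyMeasurable_insEquiv {f : EuclideanSpace ℝ (Fin (n + 1)) → ℂ}
    (hf : AEStronglyMeasurable f) :
    ∀ᵐ t : ℝ, AEStronglyMeasurable (fun s => f (insEquiv i (s, t))) := by
  have h1 := hf.comp_measurePreserving (measurePreserving_insEquiv i)
  have h2 := h1.comp_measurePreserving (Measure.measurePreserving_swap (μ := (volume : Measure ℝ))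
    (ν := (volume : Measure (EuclideanSpace ℝ (Fin n)))))
  exact h2.prodMk_left

end Fubini

/-! ### Oscillatory integrals: Plancherel and a weak Hausdorff-Young inequality -/

section Plancherel

variable {V : Type*} [NormedAddCommGroup V] [InnerProductSpace ℝ V] [MeasurableSpace V]
  [BorelSpace V] [FiniteDimensional ℝ V]

/-- The oscillatory integral `∫ h(k) e^{i x·k} dk`. -/
noncomputable def osc (h : V → ℂ) (x : V) : ℂ :=
  ∫ k, h k * Complex.exp (Complex.I * ((inner ℝ x k : ℝ) : ℂ))

lemma norm_exp_I_mul_ofReal (r : ℝ) : ‖Complex.exp (Complex.I * (r : ℂ))‖ = 1 := by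
  rw [mul_comm, Complex.norm_exp_ofReal_mul_I]

lemma osc_eq_fourier (h : V → ℂ) (x : V) : osc h x = 𝓕 h ((-(2 * Real.pi)⁻¹ : ℝ) • x) := by
  rw [Real.fourier_eq', osc]
  congr 1
  ext k
  rw [smul_eq_mul, mul_comm (h k)]
  congr 2
  rw [inner_smul_right, real_inner_comm]
  have : (Real.pi : ℂ) ≠ 0 := by exact_mod_cast Real.pi_ne_zero
  push_cast
  field_simp

lemma norm_osc_le (h : V → ℂ) (x : V) : ‖osc h x‖ ≤ ∫ k, ‖h k‖ := by
  refine (norm_integral_le_integral_norm _).trans (le_of_eq ?_)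
  congr 1
  ext k
  rw [norm_mul, norm_exp_I_mul_ofReal, mul_one]

lemma continuous_osc {h : V → ℂ} (hh : Integrable h) : Continuous (osc h) := by
  have : osc h = fun x => 𝓕 h ((-(2 * Real.pi)⁻¹ : ℝ) • x) := funext (osc_eq_fourier h)
  rw [this]
  have h2 : Continuous (𝓕 h) :=
    VectorFourier.fourierIntegral_continuous Real.continuous_fourierChar
      (by exact continuous_inner) hh
  exact h2.comp (continuous_const_smul _)

lemma osc_add {h₁ h₂ : V → ℂ} (hi₁ : Integrable h₁) (hi₂ : Integrable h₂) (x : V) :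
    osc (fun k => h₁ k + h₂ k) x = osc h₁ x + osc h₂ x := by
  have hm : ∀ {h : V → ℂ}, Integrable h →
      Integrable (fun k => h k * Complex.exp (Complex.I * ((inner ℝ x k : ℝ) : ℂ))) := by
    intro h hi
    refine hi.mul_bdd (c := 1) (by fun_prop) (Eventually.of_forall fun k => ?_)
    rw [norm_exp_I_mul_ofReal]
  unfold osc
  rw [← integral_add (hm hi₁) (hm hi₂)]
  congr 1
  ext k
  ring

lemma integral_fourier_mul_eq {f g : V → ℂ} (hf : Integrable f) (hg : Integrable g) :
    ∫ x, 𝓕 f x * g x = ∫ x, f x * 𝓕 g x := by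
  have := VectorFourier.integral_fourierIntegral_smul_eq_flip (μ := (volume : Measure V))
    (ν := (volume : Measure V)) (L := innerₗ V) (e := Real.fourierChar) (f := f) (g := g)
    Real.continuous_fourierChar (by exact continuous_inner) hf hg
  rw [flip_innerₗ] at this
  exact this

/-- Both functions have the same integrals against smooth compactly supported functions: the `L²`
transform through its description as a tempered distribution, the integral transform through Fubini.
This carries the Plancherel theorem over to the pointwise integral. -/
lemma fourier_toLp_ae_eq {h : V → ℂ} (h1 : Integrable h) (h2 : MemLp h 2) :
    (𝓕 (h2.toLp h) : Lp ℂ 2 (volume : Measure V)) =ᵐ[volume] 𝓕 h := by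
  have hcont : Continuous (𝓕 h) :=
    VectorFourier.fourierIntegral_continuous Real.continuous_fourierChar
      (by exact continuous_inner) h1
  refine ae_eq_of_integral_contDiff_smul_eq ((Lp.memLp _).locallyIntegrable (by norm_num))
    hcont.locallyIntegrable ?_
  intro φ hφ hφc
  have hφ' : ContDiff ℝ ∞ (fun x => (φ x : ℂ)) := Complex.ofRealCLM.contDiff.comp hφ
  have hφc' : HasCompactSupport (fun x => (φ x : ℂ)) := hφc.comp_left Complex.ofReal_zero
  set Φ : 𝓢(V, ℂ) := hφc'.toSchwartzMap hφ' with hΦ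
  have hΦc : ∀ x, Φ x = (φ x : ℂ) := fun x => rfl
  have e1 := DFunLike.congr_fun (MeasureTheory.Lp.fourier_toTemperedDistribution_eq (h2.toLp h)) Φ
  rw [TemperedDistribution.fourier_apply, Lp.toTemperedDistribution_apply,
    Lp.toTemperedDistribution_apply] at e1
  have e2 : ∫ x, φ x • (𝓕 (h2.toLp h) : Lp ℂ 2 (volume : Measure V)) x
      = ∫ x, Φ x • (𝓕 (h2.toLp h) : Lp ℂ 2 (volume : Measure V)) x := by
    congr 1
  rw [e2, ← e1]
  have e3 : ∫ x, (𝓕 Φ) x • (h2.toLp h : V → ℂ) x = ∫ x, 𝓕 (Φ : V → ℂ) x * h x := by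
    refine integral_congr_ae ?_
    filter_upwards [h2.coeFn_toLp] with x hx
    rw [hx, SchwartzMap.fourier_coe, smul_eq_mul]
  rw [e3, integral_fourier_mul_eq Φ.integrable h1]
  rfl

lemma lintegral_fourier_sq {h : V → ℂ} (h1 : Integrable h) (h2 : MemLp h 2) :
    ∫⁻ x, ‖𝓕 h x‖ₑ ^ (2 : ℝ) = ∫⁻ k, ‖h k‖ₑ ^ (2 : ℝ) := by
  have e1 : eLpNorm (𝓕 h) 2 volume = eLpNorm h 2 volume := by
    rw [← eLpNorm_congr_ae (fourier_toLp_ae_eq h1 h2), ← Lp.enorm_def, ← ofReal_norm,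
      Lp.norm_fourier_eq, ofReal_norm, Lp.enorm_def, eLpNorm_congr_ae h2.coeFn_toLp]
  rw [eLpNorm_eq_lintegral_rpow_enorm_toReal (by norm_num) (by norm_num),
    eLpNorm_eq_lintegral_rpow_enorm_toReal (by norm_num) (by norm_num)] at e1
  have := ENNReal.rpow_left_injective (x := 1 / (2 : ℝ≥0∞).toReal) (by norm_num) e1
  simpa using this

variable (V) in
/-- The constant `(2π)^d` of the Plancherel identity for `osc`. -/
noncomputable def plancherelConst : ℝ≥0∞ :=
  ENNReal.ofReal |((-(2 * Real.pi)⁻¹ : ℝ) ^ Module.finrank ℝ V)⁻¹|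

lemma plancherelConst_ne_top (V : Type*) [NormedAddCommGroup V] [InnerProductSpace ℝ V] :
    plancherelConst V ≠ ⊤ := ENNReal.ofReal_ne_top

lemma lintegral_osc_sq {h : V → ℂ} (h1 : Integrable h) (h2 : MemLp h 2) :
    ∫⁻ x, ‖osc h x‖ₑ ^ (2 : ℝ) = plancherelConst V * ∫⁻ k, ‖h k‖ₑ ^ (2 : ℝ) := by
  have hr : (-(2 * Real.pi)⁻¹ : ℝ) ≠ 0 := by
    have := Real.pi_pos
    simp [Real.pi_ne_zero]
  have hmap := Measure.map_addHaar_smul (volume : Measure V) hr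
  have e : ∫⁻ x, ‖osc h x‖ₑ ^ (2 : ℝ)
      = ∫⁻ x, ‖𝓕 h x‖ₑ ^ (2 : ℝ) ∂(Measure.map (fun x : V => (-(2 * Real.pi)⁻¹ : ℝ) • x) volume) := by
    have hme : MeasurableEmbedding (fun x : V => (-(2 * Real.pi)⁻¹ : ℝ) • x) :=
      (Homeomorph.smulOfNeZero _ hr).measurableEmbedding
    rw [hme.lintegral_map]
    simp only [osc_eq_fourier]
  rw [e]
  change ∫⁻ x, ‖𝓕 h x‖ₑ ^ (2 : ℝ) ∂(Measure.map ((-(2 * Real.pi)⁻¹ : ℝ) • ·) volume) = _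
  rw [hmap, lintegral_smul_measure, lintegral_fourier_sq h1 h2]
  rfl

/-- A weak form of the Hausdorff-Young inequality: `osc h` is bounded in `L^p` uniformly over all
`h` dominated by a given integrable function in `L^{p'}`. -/
lemma lintegral_osc_rpow_le {p : ℝ} (hp : 2 < p) {M : V → ℝ} (hM0 : ∀ k, 0 ≤ M k)
    (hMm : Measurable M) (hM1 : Integrable M) (hMp : Integrable (fun k => M k ^ (p / (p - 1)))) :
    ∃ C : ℝ≥0∞, C ≠ ⊤ ∧ ∀ h : V → ℂ, Measurable h → (∀ k, ‖h k‖ ≤ M k) →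
      ∫⁻ x, ‖osc h x‖ₑ ^ p ≤ C := by
  have hp1 : 0 < p - 1 := by linarith
  have hp2 : 0 < p - 2 := by linarith
  set q := p / (p - 1) with hq
  set B := ∫ k, M k ^ q with hB
  have hB0 : 0 ≤ B := integral_nonneg fun k => Real.rpow_nonneg (hM0 k) _
  -- The truncation height `τ r = (A / r) ^ (p - 1)` satisfies `(τ r) ^ (1 - q) = r / A`. The part
  -- of `h` where `M > τ r` thus has `L¹` norm at most `r B / A ≤ r / 2`. The `+ 1` keeps `A`
  -- positive when `B = 0`.
  set A := 2 * (B + 1) with hA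
  have hA0 : 0 < A := by positivity
  set τ : ℝ → ℝ := fun r => (A / r) ^ (p - 1) with hτ
  set D : ℝ≥0∞ := ∫⁻ k, ENNReal.ofReal (M k ^ q) with hD
  have hDtop : D ≠ ⊤ := by
    rw [hD, ← ofReal_integral_eq_lintegral_ofReal hMp
      (Eventually.of_forall fun k => Real.rpow_nonneg (hM0 k) _)]
    exact ENNReal.ofReal_ne_top
  refine ⟨ENNReal.ofReal p * (4 * plancherelConst V * (ENNReal.ofReal (A ^ (p - 2) / (p - 2)) * D)),
    by
      refine ENNReal.mul_ne_top ENNReal.ofReal_ne_top (ENNReal.mul_ne_top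
        (ENNReal.mul_ne_top (by norm_num) (plancherelConst_ne_top V))
        (ENNReal.mul_ne_top ENNReal.ofReal_ne_top hDtop)), ?_⟩
  intro h hm hle
  have hint : Integrable h := hM1.mono' hm.aestronglyMeasurable (Eventually.of_forall hle)
  -- the distribution function of `osc h`
  have key : ∀ r : ℝ, 0 < r → volume {x | r < ‖osc h x‖} ≤
      ENNReal.ofReal (4 / r ^ 2) * (plancherelConst V *
        ∫⁻ k, {k | M k ≤ τ r}.indicator (fun k => ENNReal.ofReal (M k ^ (2 : ℝ))) k) := by
    intro r hr
    have hτ0 : 0 < τ r := Real.rpow_pos_of_pos (div_pos hA0 hr) _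
    set S := {k | M k ≤ τ r} with hS
    have hSm : MeasurableSet S := measurableSet_le hMm measurable_const
    -- The low part `h₁` is square integrable and is handled by Plancherel; the high part `h₂` is
    -- handled by its `L¹` norm.
    set h₁ := S.indicator h
    set h₂ := Sᶜ.indicator h
    have hsum : h = fun k => h₁ k + h₂ k := by
      ext k; exact (congrFun (Set.indicator_self_add_compl S h) k).symm
    have hi₁ : Integrable h₁ := hint.indicator hSm
    have hi₂ : Integrable h₂ := hint.indicator hSm.compl
    have hb₂ : ∀ x, ‖osc h₂ x‖ ≤ r / 2 := by
      intro x
      refine (norm_osc_le _ _).trans ?_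
      have hpt : ∀ k, ‖h₂ k‖ ≤ (τ r) ^ (1 - q) * M k ^ q := by
        intro k
        by_cases hk : k ∈ S
        · have : h₂ k = 0 := Set.indicator_of_notMem (by simpa using hk) _
          rw [this, norm_zero]
          exact mul_nonneg (Real.rpow_nonneg hτ0.le _) (Real.rpow_nonneg (hM0 k) _)
        · have e : h₂ k = h k := Set.indicator_of_mem (by simpa using hk) _
          rw [e]
          have hk' : τ r < M k := not_le.1 hk
          have hMk : 0 < M k := hτ0.trans hk'
          have hq1 : 1 - q ≤ 0 := by
            rw [hq, sub_nonpos, le_div_iff₀ hp1]; linarith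
          calc ‖h k‖ ≤ M k := hle k
            _ = M k ^ (1 - q) * M k ^ q := by
              rw [← Real.rpow_add hMk]; simp
            _ ≤ _ := by
              exact mul_le_mul_of_nonneg_right (Real.rpow_le_rpow_of_nonpos hτ0 hk'.le hq1)
                (Real.rpow_nonneg (hM0 k) _)
      calc ∫ k, ‖h₂ k‖ ≤ ∫ k, (τ r) ^ (1 - q) * M k ^ q :=
            integral_mono hi₂.norm (hMp.const_mul _) hpt
        _ = (τ r) ^ (1 - q) * B := integral_const_mul _ _
        _ = (A / r)⁻¹ * B := by
          rw [hτ]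
          simp only
          rw [← Real.rpow_mul (div_pos hA0 hr).le]
          have : (p - 1) * (1 - q) = -1 := by rw [hq]; field_simp; ring
          rw [this, Real.rpow_neg_one]
        _ ≤ r / 2 := by
          rw [inv_div, div_mul_eq_mul_div, div_le_div_iff₀ hA0 two_pos, hA]
          nlinarith
    have hmem : MemLp h₁ 2 := by
      have hbd : ∀ k, ‖h₁ k‖ ≤ τ r := by
        intro k
        by_cases hk : k ∈ S
        · rw [show h₁ k = h k from Set.indicator_of_mem hk _]
          exact (hle k).trans hk
        · rw [show h₁ k = 0 from Set.indicator_of_notMem hk _, norm_zero]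
          exact hτ0.le
      refine (memLp_two_iff_integrable_sq_norm hi₁.aestronglyMeasurable).2 ?_
      refine (hi₁.norm.const_mul (τ r)).mono' (hi₁.aestronglyMeasurable.norm.pow 2)
        (Eventually.of_forall fun k => ?_)
      rw [Real.norm_of_nonneg (by positivity), sq]
      exact mul_le_mul_of_nonneg_right (hbd k) (norm_nonneg _)
    -- As the high part accounts for at most `r / 2`, the low part must exceed `r / 2`, and
    -- Chebyshev's inequality in `L²` applies to it.
    have hsub : {x | r < ‖osc h x‖} ⊆
        {x | ENNReal.ofReal ((r / 2) ^ 2) ≤ ‖osc h₁ x‖ₑ ^ (2 : ℝ)} := by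
      intro x hx
      have hx' : r < ‖osc h x‖ := hx
      have e : osc h x = osc h₁ x + osc h₂ x := by
        conv_lhs => rw [hsum]
        exact osc_add hi₁ hi₂ x
      have h3 : r / 2 ≤ ‖osc h₁ x‖ := by
        have := norm_add_le (osc h₁ x) (osc h₂ x)
        rw [← e] at this
        have := hb₂ x
        linarith
      change ENNReal.ofReal _ ≤ _
      rw [← ofReal_norm, ENNReal.ofReal_rpow_of_nonneg (norm_nonneg _) (by norm_num)]
      refine ENNReal.ofReal_le_ofReal ?_
      rw [show (2 : ℝ) = ((2 : ℕ) : ℝ) by norm_num, Real.rpow_natCast]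
      push_cast
      gcongr
    have hmeas : Measurable fun x => ‖osc h₁ x‖ₑ ^ (2 : ℝ) :=
      ((continuous_osc hi₁).measurable.enorm).pow_const _
    have hc0 : ENNReal.ofReal ((r / 2) ^ 2) ≠ 0 := by
      rw [Ne, ENNReal.ofReal_eq_zero, not_le]; positivity
    calc volume {x | r < ‖osc h x‖}
        ≤ volume {x | ENNReal.ofReal ((r / 2) ^ 2) ≤ ‖osc h₁ x‖ₑ ^ (2 : ℝ)} := measure_mono hsub
      _ ≤ (∫⁻ x, ‖osc h₁ x‖ₑ ^ (2 : ℝ)) / ENNReal.ofReal ((r / 2) ^ 2) :=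
          meas_ge_le_lintegral_div hmeas.aemeasurable hc0 ENNReal.ofReal_ne_top
      _ = ENNReal.ofReal (4 / r ^ 2) * ∫⁻ x, ‖osc h₁ x‖ₑ ^ (2 : ℝ) := by
          rw [div_eq_mul_inv, mul_comm, ← ENNReal.ofReal_inv_of_pos (by positivity)]
          congr 2
          field_simp
          norm_num
      _ ≤ _ := by
          rw [lintegral_osc_sq hi₁ hmem]
          gcongr with k
          by_cases hk : k ∈ S
          · rw [show h₁ k = h k from Set.indicator_of_mem hk _, Set.indicator_of_mem hk,
              ← ofReal_norm, ENNReal.ofReal_rpow_of_nonneg (norm_nonneg _) (by norm_num)]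
            exact ENNReal.ofReal_le_ofReal
              (Real.rpow_le_rpow (norm_nonneg _) (hle k) (by norm_num))
          · rw [show h₁ k = 0 from Set.indicator_of_notMem hk _]
            simp
  have hnn : (0 : V → ℝ) ≤ᵐ[volume] fun x => ‖osc h x‖ :=
    Eventually.of_forall fun x => norm_nonneg _
  have e1 : ∫⁻ x, ‖osc h x‖ₑ ^ p = ∫⁻ x, ENNReal.ofReal (‖osc h x‖ ^ p) := by
    congr 1
    ext x
    rw [← ofReal_norm, ENNReal.ofReal_rpow_of_nonneg (norm_nonneg _) (by linarith)]
  rw [e1, lintegral_rpow_eq_lintegral_meas_lt_mul volume hnn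
    (continuous_osc hint).norm.measurable.aemeasurable (by linarith)]
  gcongr
  have step : ∀ r ∈ Set.Ioi (0 : ℝ), volume {x | r < ‖osc h x‖} * ENNReal.ofReal (r ^ (p - 1)) ≤
      4 * plancherelConst V * ∫⁻ k, {k | M k ≤ τ r}.indicator
        (fun k => ENNReal.ofReal (M k ^ (2 : ℝ))) k * ENNReal.ofReal (r ^ (p - 3)) := by
    intro r hr
    have hr : 0 < r := hr
    refine (mul_le_mul_left (key r hr) _).trans (le_of_eq ?_)
    rw [lintegral_mul_const _ (by
      exact Measurable.indicator (by fun_prop) (measurableSet_le hMm measurable_const))]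
    have : ENNReal.ofReal (4 / r ^ 2) * ENNReal.ofReal (r ^ (p - 1))
        = 4 * ENNReal.ofReal (r ^ (p - 3)) := by
      rw [← ENNReal.ofReal_mul (by positivity), show (4 : ℝ≥0∞) = ENNReal.ofReal 4 by simp,
        ← ENNReal.ofReal_mul (by norm_num)]
      congr 1
      rw [show p - 1 = (p - 3) + (2 : ℕ) by push_cast; ring, Real.rpow_add hr, Real.rpow_natCast]
      field_simp
    calc _ = (ENNReal.ofReal (4 / r ^ 2) * ENNReal.ofReal (r ^ (p - 1))) * (plancherelConst V *
        ∫⁻ k, {k | M k ≤ τ r}.indicator (fun k => ENNReal.ofReal (M k ^ (2 : ℝ))) k) := by ring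
      _ = _ := by rw [this]; ring
  refine (setLIntegral_mono' measurableSet_Ioi step).trans ?_
  have hτm : Measurable τ := by
    have : Measurable fun r : ℝ => A / r := measurable_const.div measurable_id
    exact this.pow_const _
  have hjm : Measurable (Function.uncurry fun (r : ℝ) (k : V) => {k | M k ≤ τ r}.indicator
        (fun k => ENNReal.ofReal (M k ^ (2 : ℝ))) k * ENNReal.ofReal (r ^ (p - 3))) := by
    have hset : MeasurableSet {z : ℝ × V | M z.2 ≤ τ z.1} :=
      measurableSet_le (hMm.comp measurable_snd) (hτm.comp measurable_fst)
    have : (Function.uncurry fun (r : ℝ) (k : V) => {k | M k ≤ τ r}.indicator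
        (fun k => ENNReal.ofReal (M k ^ (2 : ℝ))) k * ENNReal.ofReal (r ^ (p - 3)))
        = fun z : ℝ × V => {z : ℝ × V | M z.2 ≤ τ z.1}.indicator
        (fun z => ENNReal.ofReal (M z.2 ^ (2 : ℝ))) z * ENNReal.ofReal (z.1 ^ (p - 3)) := by
      ext z
      simp only [Function.uncurry, Set.indicator, Set.mem_ofPred_eq]
    rw [this]
    exact (Measurable.indicator (by fun_prop) hset).mul (by fun_prop)
  have hjm1 : Measurable fun r : ℝ => ∫⁻ k : V, {k | M k ≤ τ r}.indicator
      (fun k => ENNReal.ofReal (M k ^ (2 : ℝ))) k * ENNReal.ofReal (r ^ (p - 3)) :=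
    hjm.lintegral_prod_right'
  rw [lintegral_const_mul _ hjm1, lintegral_lintegral_swap hjm.aemeasurable,
    ← lintegral_const_mul' _ _ ENNReal.ofReal_ne_top]
  gcongr with k
  by_cases hk0 : M k = 0
  · have : ∀ r : ℝ, {k | M k ≤ τ r}.indicator (fun k => ENNReal.ofReal (M k ^ (2 : ℝ))) k
        * ENNReal.ofReal (r ^ (p - 3)) = 0 := by
      intro r
      simp only [Set.indicator, hk0]
      split_ifs <;> simp
    rw [lintegral_congr fun r => this r, lintegral_zero]
    exact zero_le
  have hk : 0 < M k := lt_of_le_of_ne (hM0 k) (Ne.symm hk0)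
  -- For fixed `k` the constraint `M k ≤ τ r` reads `r ≤ R`. The integral of `r ^ (p - 3)` up to `R`
  -- converges at `0` because `p > 2`, and `M ^ 2 * M ^ (-(p - 2) / (p - 1)) = M ^ q` returns the
  -- assumed integrable power.
  set R := A * M k ^ (-(p - 1)⁻¹) with hR
  have hR0 : 0 < R := mul_pos hA0 (Real.rpow_pos_of_pos hk _)
  have hpt : ∀ r ∈ Set.Ioi (0 : ℝ), {k | M k ≤ τ r}.indicator
      (fun k => ENNReal.ofReal (M k ^ (2 : ℝ))) k * ENNReal.ofReal (r ^ (p - 3)) ≤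
      (Set.Ioc 0 R).indicator
        (fun r => ENNReal.ofReal (M k ^ (2 : ℝ)) * ENNReal.ofReal (r ^ (p - 3))) r := by
    intro r hr
    have hr : 0 < r := hr
    by_cases hMr : M k ≤ τ r
    · have : r ≤ R := by
        have h1 : M k ^ ((p - 1)⁻¹) ≤ A / r := by
          have := Real.rpow_le_rpow hk.le hMr (inv_nonneg.2 hp1.le)
          rwa [hτ, ← Real.rpow_mul (div_pos hA0 hr).le, mul_inv_cancel₀ hp1.ne', Real.rpow_one]
            at this
        rw [hR, Real.rpow_neg hk.le, ← div_eq_mul_inv, le_div_iff₀ (Real.rpow_pos_of_pos hk _)]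
        rw [le_div_iff₀ hr] at h1
        linarith
      rw [Set.indicator_of_mem (show k ∈ {k | M k ≤ τ r} from hMr),
        Set.indicator_of_mem (show r ∈ Set.Ioc 0 R from ⟨hr, this⟩)]
    · rw [Set.indicator_of_notMem (show k ∉ {k | M k ≤ τ r} from hMr), zero_mul]
      exact zero_le
  refine (setLIntegral_mono' measurableSet_Ioi hpt).trans ?_
  refine (setLIntegral_le_lintegral _ _).trans ?_
  rw [lintegral_indicator measurableSet_Ioc, lintegral_const_mul' _ _ ENNReal.ofReal_ne_top]
  have hii : IntervalIntegrable (fun r : ℝ => r ^ (p - 3)) volume 0 R :=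
    intervalIntegral.intervalIntegrable_rpow' (by linarith)
  rw [← ofReal_integral_eq_lintegral_ofReal
    ((intervalIntegrable_iff_integrableOn_Ioc_of_le hR0.le).1 hii)
    ((ae_restrict_iff' measurableSet_Ioc).2 (Eventually.of_forall fun r hr =>
      Real.rpow_nonneg hr.1.le _)), ← intervalIntegral.integral_of_le hR0.le,
    integral_rpow (Or.inl (by linarith)), ← ENNReal.ofReal_mul (Real.rpow_nonneg hk.le _),
    ← ENNReal.ofReal_mul (by positivity)]
  refine ENNReal.ofReal_le_ofReal (le_of_eq ?_)
  rw [show p - 3 + 1 = p - 2 by ring, Real.zero_rpow hp2.ne', sub_zero, hR,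
    Real.mul_rpow hA0.le (Real.rpow_nonneg hk.le _), ← Real.rpow_mul hk.le]
  have : M k ^ (2 : ℝ) * M k ^ (-(p - 1)⁻¹ * (p - 2)) = M k ^ q := by
    rw [← Real.rpow_add hk, hq]
    congr 1
    field_simp
    ring
  rw [← this]
  ring

end Plancherel

/-! ### Partial derivatives, test functions and the Laplacian -/

/-- The partial derivative `∂φ/∂x_j`. -/
noncomputable def pd (j : Fin 4) (φ : R4 → ℂ) (x : R4) : ℂ :=
  fderiv ℝ φ x (EuclideanSpace.single j 1)

/-- Test functions on a set `O`. -/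
def IsTestOn (O : Set R4) (φ : R4 → ℂ) : Prop :=
  ContDiff ℝ ∞ φ ∧ HasCompactSupport φ ∧ tsupport φ ⊆ O

/-- The Laplacian as a sum of second partial derivatives. -/
noncomputable def lap (φ : R4 → ℂ) (x : R4) : ℂ := ∑ j, pd j (pd j φ) x

section Calculus

variable {φ ψ : R4 → ℂ} {O : Set R4}

lemma contDiff_pd (hφ : ContDiff ℝ ∞ φ) (j : Fin 4) : ContDiff ℝ ∞ (pd j φ) :=
  (hφ.fderiv_right (m := ∞) (by simp)).clm_apply contDiff_const

lemma tsupport_pd_subset (φ : R4 → ℂ) (j : Fin 4) : tsupport (pd j φ) ⊆ tsupport φ :=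
  tsupport_fderiv_apply_subset ℝ _

lemma HasCompactSupport.pderiv (hφ : HasCompactSupport φ) (j : Fin 4) :
    HasCompactSupport (pd j φ) :=
  hφ.fderiv_apply ℝ _

lemma IsTestOn.pderiv (h : IsTestOn O φ) (j : Fin 4) : IsTestOn O (pd j φ) :=
  ⟨contDiff_pd h.1 j, h.2.1.pderiv j, (tsupport_pd_subset φ j).trans h.2.2⟩

lemma IsTestOn.mono {U : Set R4} (h : IsTestOn O φ) (hU : O ⊆ U) : IsTestOn U φ :=
  ⟨h.1, h.2.1, h.2.2.trans hU⟩

lemma IsTestOn.add (h : IsTestOn O φ) (h' : IsTestOn O ψ) : IsTestOn O (fun x => φ x + ψ x) :=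
  ⟨h.1.add h'.1, h.2.1.add h'.2.1,
    (tsupport_add φ ψ).trans (Set.union_subset h.2.2 h'.2.2)⟩

lemma IsTestOn.contDiff_mul (h : IsTestOn O φ) (hψ : ContDiff ℝ ∞ ψ) :
    IsTestOn O (fun x => ψ x * φ x) :=
  ⟨hψ.mul h.1, h.2.1.mul_left, (tsupport_mul_subset_right).trans h.2.2⟩

lemma IsTestOn.const_mul (h : IsTestOn O φ) (c : ℂ) : IsTestOn O (fun x => c * φ x) :=
  h.contDiff_mul contDiff_const

lemma IsTestOn.sub (h : IsTestOn O φ) (h' : IsTestOn O ψ) : IsTestOn O (fun x => φ x - ψ x) := by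
  have := h.add (h'.const_mul (-1))
  simpa [sub_eq_add_neg] using this

lemma ContDiff.differentiable_infty (hφ : ContDiff ℝ ∞ φ) : Differentiable ℝ φ :=
  hφ.differentiable (by simp)

lemma pd_add (hφ : Differentiable ℝ φ) (hψ : Differentiable ℝ ψ) (j : Fin 4) (x : R4) :
    pd j (fun x => φ x + ψ x) x = pd j φ x + pd j ψ x := by
  simp only [pd]
  rw [fderiv_fun_add (hφ x) (hψ x)]
  rfl

lemma pd_sub (hφ : Differentiable ℝ φ) (hψ : Differentiable ℝ ψ) (j : Fin 4) (x : R4) :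
    pd j (fun x => φ x - ψ x) x = pd j φ x - pd j ψ x := by
  simp only [pd]
  rw [fderiv_fun_sub (hφ x) (hψ x)]
  rfl

lemma pd_mul (hφ : Differentiable ℝ φ) (hψ : Differentiable ℝ ψ) (j : Fin 4) (x : R4) :
    pd j (fun x => φ x * ψ x) x = pd j φ x * ψ x + φ x * pd j ψ x := by
  simp only [pd]
  rw [fderiv_fun_mul (hφ x) (hψ x)]
  simp
  ring

lemma pd_const_mul (hφ : Differentiable ℝ φ) (c : ℂ) (j : Fin 4) (x : R4) :
    pd j (fun x => c * φ x) x = c * pd j φ x := by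
  simp only [pd]
  rw [fderiv_const_mul (hφ x)]
  rfl

lemma pd_eq_iteratedFDeriv (hφ : ContDiff ℝ ∞ φ) (i j : Fin 4) (x : R4) :
    pd i (pd j φ) x =
      iteratedFDeriv ℝ 2 φ x ![EuclideanSpace.single i 1, EuclideanSpace.single j 1] := by
  rw [iteratedFDeriv_two_apply]
  have h : Differentiable ℝ (fderiv ℝ φ) :=
    (hφ.fderiv_right (m := ∞) (by simp)).differentiable (by simp)
  simp only [pd, Matrix.cons_val_zero, Matrix.cons_val_one]
  change fderiv ℝ (fun x => fderiv ℝ φ x (EuclideanSpace.single j 1)) x _ = _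
  rw [fderiv_clm_apply (h x) (by fun_prop)]
  simp

lemma pd_comm (hφ : ContDiff ℝ ∞ φ) (i j : Fin 4) (x : R4) :
    pd i (pd j φ) x = pd j (pd i φ) x := by
  rw [pd_eq_iteratedFDeriv hφ, pd_eq_iteratedFDeriv hφ, iteratedFDeriv_two_apply,
    iteratedFDeriv_two_apply]
  have hs : IsSymmSndFDerivAt ℝ φ x :=
    (hφ.contDiffAt).isSymmSndFDerivAt (by
      rw [minSmoothness_of_isRCLikeNormedField]; exact WithTop.coe_le_coe.2 le_top)
  exact hs _ _

lemma laplacian_eq_lap (hφ : ContDiff ℝ ∞ φ) : Laplacian.laplacian φ = lap φ := by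
  ext x
  rw [InnerProductSpace.laplacian_eq_iteratedFDeriv_orthonormalBasis φ
    (EuclideanSpace.basisFun (Fin 4) ℝ)]
  simp [lap, pd_eq_iteratedFDeriv hφ]

lemma dbar2_eq (φ : R4 → ℂ) (x : R4) :
    dbar2 φ x = (1 / 2) * (pd 1 φ x + Complex.I * pd 3 φ x) := rfl

lemma IsTestOn.laplace (h : IsTestOn O φ) : IsTestOn O (lap φ) := by
  have e : lap φ = fun x => ((pd 0 (pd 0 φ) x + pd 1 (pd 1 φ) x)
      + pd 2 (pd 2 φ) x) + pd 3 (pd 3 φ) x := by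
    ext x
    simp [lap, Fin.sum_univ_four]
  rw [e]
  exact ((((h.pderiv 0).pderiv 0).add ((h.pderiv 1).pderiv 1)).add ((h.pderiv 2).pderiv 2)).add ((h.pderiv 3).pderiv 3)

lemma IsTestOn.dbar (h : IsTestOn O φ) : IsTestOn O (dbar2 φ) :=
  ((h.pderiv 1).add ((h.pderiv 3).const_mul Complex.I)).const_mul (1 / 2)

lemma pd_dbar2 (hφ : ContDiff ℝ ∞ φ) (j : Fin 4) (x : R4) :
    pd j (dbar2 φ) x = dbar2 (pd j φ) x := by
  have d : ∀ i, Differentiable ℝ (pd i φ) := fun i => (contDiff_pd hφ i).differentiable_infty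
  have e : dbar2 φ = fun x => (1 / 2 : ℂ) * (pd 1 φ x + Complex.I * pd 3 φ x) := rfl
  rw [e, pd_const_mul ((d 1).fun_add ((d 3).const_mul _)), pd_add (d 1) ((d 3).const_mul _),
    pd_const_mul (d 3), dbar2_eq, pd_comm hφ j 1, pd_comm hφ j 3]

lemma lap_dbar2 (hφ : ContDiff ℝ ∞ φ) (x : R4) : lap (dbar2 φ) x = dbar2 (lap φ) x := by
  have e : ∀ j, pd j (dbar2 φ) = dbar2 (pd j φ) := fun j => funext (pd_dbar2 hφ j)
  have hd : ∀ i j, Differentiable ℝ (pd i (pd j φ)) := fun i j =>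
    (contDiff_pd (contDiff_pd hφ j) i).differentiable_infty
  have e2 : lap φ = fun x => ((pd 0 (pd 0 φ) x + pd 1 (pd 1 φ) x)
      + pd 2 (pd 2 φ) x) + pd 3 (pd 3 φ) x := by
    ext x
    simp [lap, Fin.sum_univ_four]
  have e3 : ∀ i, pd i (lap φ) x = ((pd i (pd 0 (pd 0 φ)) x + pd i (pd 1 (pd 1 φ)) x)
      + pd i (pd 2 (pd 2 φ)) x) + pd i (pd 3 (pd 3 φ)) x := by
    intro i
    rw [e2, pd_add (((hd 0 0).fun_add (hd 1 1)).fun_add (hd 2 2)) (hd 3 3),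
      pd_add ((hd 0 0).fun_add (hd 1 1)) (hd 2 2), pd_add (hd 0 0) (hd 1 1)]
  have e4 : lap (dbar2 φ) x = ∑ j, dbar2 (pd j (pd j φ)) x := by
    unfold lap
    refine Finset.sum_congr rfl fun j _ => ?_
    rw [e, pd_dbar2 (contDiff_pd hφ j)]
  rw [e4, Fin.sum_univ_four]
  simp only [dbar2_eq, e3]
  ring

end Calculus

/-! ### Coordinate reflections -/

section Reflection

/-- The reflection of the `i`-th coordinate. -/
noncomputable def coordRefl (i : Fin 4) : R4 ≃ₗᵢ[ℝ] R4 :=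
  LinearIsometryEquiv.piLpCongrRight 2
    (fun j => if j = i then LinearIsometryEquiv.neg ℝ else LinearIsometryEquiv.refl ℝ ℝ)

lemma coordRefl_apply (i : Fin 4) (x : R4) (j : Fin 4) :
    coordRefl i x j = if j = i then -x j else x j := by
  simp only [coordRefl, LinearIsometryEquiv.piLpCongrRight_apply]
  split_ifs <;> simp

lemma coordRefl_two (x : R4) : coordRefl 2 x = reflY1 x := by
  ext j
  rw [coordRefl_apply]
  fin_cases j <;> simp [reflY1]

lemma coordRefl_three (x : R4) : coordRefl 3 x = reflY2 x := by
  ext j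
  rw [coordRefl_apply]
  fin_cases j <;> simp [reflY2]

lemma coordRefl_coordRefl (i : Fin 4) (x : R4) : coordRefl i (coordRefl i x) = x := by
  ext j
  rw [coordRefl_apply, coordRefl_apply]
  split_ifs <;> simp

lemma coordRefl_single (i j : Fin 4) : coordRefl i (EuclideanSpace.single j (1 : ℝ)) =
    (if j = i then -1 else 1 : ℝ) • EuclideanSpace.single j (1 : ℝ) := by
  ext k
  rw [coordRefl_apply]
  by_cases hki : k = i <;> by_cases hji : j = i <;> by_cases hkj : k = j <;> simp_all

lemma pd_comp_refl {φ : R4 → ℂ} (hφ : Differentiable ℝ φ) (i j : Fin 4) (x : R4) :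
    pd j (fun x => φ (coordRefl i x)) x = (if j = i then -1 else 1 : ℝ) * pd j φ (coordRefl i x) := by
  simp only [pd]
  have h : HasFDerivAt (fun x => φ (coordRefl i x))
      ((fderiv ℝ φ (coordRefl i x)).comp ((coordRefl i).toContinuousLinearEquiv : R4 →L[ℝ] R4)) x :=
    (hφ (coordRefl i x)).hasFDerivAt.comp x (coordRefl i).toContinuousLinearEquiv.hasFDerivAt
  rw [h.fderiv]
  change fderiv ℝ φ (coordRefl i x) (coordRefl i (EuclideanSpace.single j (1 : ℝ))) = _
  rw [coordRefl_single, map_smul, Complex.real_smul]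

lemma lap_comp_refl {φ : R4 → ℂ} (hφ : ContDiff ℝ ∞ φ) (i : Fin 4) (x : R4) :
    lap (fun x => φ (coordRefl i x)) x = lap φ (coordRefl i x) := by
  unfold lap
  refine Finset.sum_congr rfl fun j _ => ?_
  have e : pd j (fun x => φ (coordRefl i x)) =
      fun x => ((if j = i then -1 else 1 : ℝ) : ℂ) * pd j φ (coordRefl i x) :=
    funext (pd_comp_refl hφ.differentiable_infty i j)
  have hd := (contDiff_pd hφ j).differentiable_infty
  have hd' : Differentiable ℝ (fun x => pd j φ (coordRefl i x)) :=
    hd.comp (coordRefl i).toContinuousLinearEquiv.differentiable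
  rw [e, pd_const_mul hd',
    pd_comp_refl hd]
  split_ifs <;> simp

lemma IsTestOn.comp_refl {φ : R4 → ℂ} {O : Set R4} (h : IsTestOn O φ) (i : Fin 4)
    (hO : ∀ x ∈ O, coordRefl i x ∈ O) : IsTestOn O (fun x => φ (coordRefl i x)) := by
  refine ⟨h.1.comp (coordRefl i).toContinuousLinearEquiv.contDiff,
    h.2.1.comp_homeomorph (coordRefl i).toHomeomorph, ?_⟩
  intro x hx
  have : coordRefl i x ∈ tsupport φ := by
    have := tsupport_comp_subset_preimage φ (coordRefl i).continuous
    exact this hx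
  have := hO _ (h.2.2 this)
  rwa [coordRefl_coordRefl] at this

lemma measurePreserving_coordRefl (i : Fin 4) : MeasurePreserving (coordRefl i) volume volume :=
  (coordRefl i).measurePreserving

lemma measurableEmbedding_coordRefl (i : Fin 4) : MeasurableEmbedding (coordRefl i) :=
  (coordRefl i).toHomeomorph.measurableEmbedding

lemma integral_comp_coordRefl (i : Fin 4) (f : R4 → ℂ) : ∫ x, f (coordRefl i x) = ∫ x, f x :=
  (measurePreserving_coordRefl i).integral_comp (measurableEmbedding_coordRefl i) f

end Reflection

/-! ### Smooth cutoffs near a coordinate hyperplane -/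

section Cutoff

/-- A smooth cutoff which vanishes for `t ≤ 1/n` and equals `1` for `t ≥ 2/n`. -/
noncomputable def cutoff (n : ℕ) (t : ℝ) : ℝ := Real.smoothTransition (n * t - 1)

lemma contDiff_cutoff (n : ℕ) : ContDiff ℝ ∞ (cutoff n) :=
  Real.smoothTransition.contDiff.comp (by fun_prop)

lemma deriv_eq_zero_of_support {f : ℝ → ℝ} (hf : ∀ t, t < 0 ∨ 1 < t → f =ᶠ[𝓝 t] fun _ => f t)
    {t : ℝ} (ht : t ∉ Set.Icc (0 : ℝ) 1) : deriv f t = 0 := by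
  have : t < 0 ∨ 1 < t := by
    by_contra h
    push Not at h
    exact ht h
  rw [(hf t this).deriv_eq, deriv_const]

/-- `Real.smoothTransition` is locally constant off `[0, 1]`, so both derivatives are supported in a
compact interval. After rescaling, the derivatives of `cutoff n` live where `1 ≤ n t ≤ 2` and have
sizes `n` and `n²`. -/
lemma exists_bound_deriv_smoothTransition :
    ∃ C : ℝ, 0 ≤ C ∧ ∀ t, |deriv Real.smoothTransition t| ≤ (Set.Icc (0 : ℝ) 1).indicator (fun _ => C) t ∧
      |deriv (deriv Real.smoothTransition) t| ≤ (Set.Icc (0 : ℝ) 1).indicator (fun _ => C) t := by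
  have h1 : ∀ t : ℝ, t < 0 ∨ 1 < t →
      Real.smoothTransition =ᶠ[𝓝 t] fun _ => Real.smoothTransition t := by
    rintro t (h | h)
    · filter_upwards [eventually_lt_nhds h] with s hs
      rw [Real.smoothTransition.zero_of_nonpos hs.le, Real.smoothTransition.zero_of_nonpos h.le]
    · filter_upwards [eventually_gt_nhds h] with s hs
      rw [Real.smoothTransition.one_of_one_le hs.le, Real.smoothTransition.one_of_one_le h.le]
  have z1 : ∀ t, t ∉ Set.Icc (0 : ℝ) 1 → deriv Real.smoothTransition t = 0 :=
    fun t ht => deriv_eq_zero_of_support h1 ht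
  have h2 : ∀ t : ℝ, t < 0 ∨ 1 < t → deriv Real.smoothTransition =ᶠ[𝓝 t]
      fun _ => deriv Real.smoothTransition t := by
    rintro t (h | h)
    · filter_upwards [eventually_lt_nhds h] with s hs
      rw [z1 s fun hh => absurd hh.1 (not_le.2 hs), z1 t fun hh => absurd hh.1 (not_le.2 h)]
    · filter_upwards [eventually_gt_nhds h] with s hs
      rw [z1 s fun hh => absurd hh.2 (not_le.2 hs), z1 t fun hh => absurd hh.2 (not_le.2 h)]
  have z2 : ∀ t, t ∉ Set.Icc (0 : ℝ) 1 → deriv (deriv Real.smoothTransition) t = 0 :=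
    fun t ht => deriv_eq_zero_of_support h2 ht
  have c : ContDiff ℝ ∞ Real.smoothTransition := Real.smoothTransition.contDiff
  have c1 : ContDiff ℝ ∞ (deriv Real.smoothTransition) := (contDiff_infty_iff_deriv.1 c).2
  have c2 : ContDiff ℝ ∞ (deriv (deriv Real.smoothTransition)) := (contDiff_infty_iff_deriv.1 c1).2
  obtain ⟨C1, hC1⟩ := (isCompact_Icc (a := (0 : ℝ)) (b := 1)).exists_bound_of_continuousOn
    c1.continuous.continuousOn
  obtain ⟨C2, hC2⟩ := (isCompact_Icc (a := (0 : ℝ)) (b := 1)).exists_bound_of_continuousOn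
    c2.continuous.continuousOn
  refine ⟨max (max C1 C2) 0, le_max_right _ _, fun t => ?_⟩
  by_cases ht : t ∈ Set.Icc (0 : ℝ) 1
  · simp only [Set.indicator_of_mem ht]
    exact ⟨(hC1 t ht).trans ((le_max_left _ _).trans (le_max_left _ _)),
      (hC2 t ht).trans ((le_max_right _ _).trans (le_max_left _ _))⟩
  · simp [Set.indicator_of_notMem ht, z1 t ht, z2 t ht]

lemma deriv_cutoff (n : ℕ) (t : ℝ) :
    deriv (cutoff n) t = n * deriv Real.smoothTransition (n * t - 1) := by
  have h : HasDerivAt Real.smoothTransition (deriv Real.smoothTransition (n * t - 1)) (n * t - 1) :=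
    ((Real.smoothTransition.contDiff (n := 1)).differentiable (by norm_num) _).hasDerivAt
  have h2 : HasDerivAt (fun t : ℝ => n * t - 1) (n : ℝ) t := by
    simpa using ((hasDerivAt_id t).const_mul (n : ℝ)).sub_const 1
  have := h.comp t h2
  rw [mul_comm]
  exact this.deriv

lemma deriv_deriv_cutoff (n : ℕ) (t : ℝ) :
    deriv (deriv (cutoff n)) t = n ^ 2 * deriv (deriv Real.smoothTransition) (n * t - 1) := by
  have c : ContDiff ℝ ∞ Real.smoothTransition := Real.smoothTransition.contDiff
  have c1 : ContDiff ℝ ∞ (deriv Real.smoothTransition) := (contDiff_infty_iff_deriv.1 c).2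
  have h : HasDerivAt (deriv Real.smoothTransition)
      (deriv (deriv Real.smoothTransition) (n * t - 1)) (n * t - 1) :=
    (c1.differentiable (by simp) _).hasDerivAt
  have h2 : HasDerivAt (fun t : ℝ => n * t - 1) (n : ℝ) t := by
    simpa using ((hasDerivAt_id t).const_mul (n : ℝ)).sub_const 1
  have h3 := (h.comp t h2).const_mul (n : ℝ)
  have e : deriv (cutoff n) = fun t => n * deriv Real.smoothTransition (n * t - 1) :=
    funext (deriv_cutoff n)
  rw [e]
  refine h3.deriv.trans ?_
  ring

lemma cutoff_nonneg (n : ℕ) (t : ℝ) : 0 ≤ cutoff n t := Real.smoothTransition.nonneg _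

lemma cutoff_le_one (n : ℕ) (t : ℝ) : cutoff n t ≤ 1 := Real.smoothTransition.le_one _

lemma cutoff_eq_zero {n : ℕ} {t : ℝ} (h : n * t ≤ 1) : cutoff n t = 0 :=
  Real.smoothTransition.zero_of_nonpos (by linarith)

lemma tendsto_cutoff (t : ℝ) :
    Tendsto (fun n => cutoff n t) atTop (𝓝 ((Set.Ioi (0 : ℝ)).indicator (fun _ => 1) t)) := by
  by_cases ht : 0 < t
  · rw [Set.indicator_of_mem (show t ∈ Set.Ioi (0 : ℝ) from ht)]
    obtain ⟨N, hN⟩ := exists_nat_gt (2 / t)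
    refine tendsto_const_nhds.congr' ?_
    filter_upwards [eventually_ge_atTop N] with n hn
    refine (Real.smoothTransition.one_of_one_le ?_).symm
    have : (N : ℝ) ≤ n := by exact_mod_cast hn
    rw [div_lt_iff₀ ht] at hN
    nlinarith
  · rw [Set.indicator_of_notMem (show t ∉ Set.Ioi (0 : ℝ) from ht)]
    refine tendsto_const_nhds.congr' (Eventually.of_forall fun n => ?_)
    refine (cutoff_eq_zero ?_).symm
    have : (n : ℝ) * t ≤ 0 := mul_nonpos_of_nonneg_of_nonpos (Nat.cast_nonneg _) (not_lt.1 ht)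
    linarith

/-- The cutoff in the `i`-th coordinate. -/
noncomputable def coordCutoff (i : Fin 4) (n : ℕ) (x : R4) : ℂ := (cutoff n (x i) : ℂ)

lemma contDiff_coord_comp {θ : ℝ → ℝ} (hθ : ContDiff ℝ ∞ θ) (i : Fin 4) :
    ContDiff ℝ ∞ (fun x : R4 => (θ (x i) : ℂ)) :=
  Complex.ofRealCLM.contDiff.comp (hθ.comp (EuclideanSpace.proj (𝕜 := ℝ) i).contDiff)

lemma contDiff_coordCutoff (i : Fin 4) (n : ℕ) : ContDiff ℝ ∞ (coordCutoff i n) :=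
  contDiff_coord_comp (contDiff_cutoff n) i

lemma pd_coord_comp {θ : ℝ → ℝ} (hθ : ContDiff ℝ ∞ θ) (i j : Fin 4) (x : R4) :
    pd j (fun x : R4 => (θ (x i) : ℂ)) x = if j = i then ((deriv θ (x i) : ℝ) : ℂ) else 0 := by
  have h1 : HasFDerivAt (fun x : R4 => x i) (EuclideanSpace.proj (𝕜 := ℝ) i) x :=
    (EuclideanSpace.proj (𝕜 := ℝ) i).hasFDerivAt
  have h2 : HasDerivAt (fun t => (θ t : ℂ)) ((deriv θ (x i) : ℝ) : ℂ) (x i) :=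
    (hθ.differentiable (by simp) (x i)).hasDerivAt.ofReal_comp
  have h3 := h2.hasFDerivAt.comp x h1
  simp only [pd]
  erw [h3.fderiv]
  simp [eq_comm]

lemma pd_coordCutoff (i j : Fin 4) (n : ℕ) (x : R4) :
    pd j (coordCutoff i n) x = if j = i then ((deriv (cutoff n) (x i) : ℝ) : ℂ) else 0 :=
  pd_coord_comp (contDiff_cutoff n) i j x

lemma lap_coordCutoff (i : Fin 4) (n : ℕ) (x : R4) :
    lap (coordCutoff i n) x = ((deriv (deriv (cutoff n)) (x i) : ℝ) : ℂ) := by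
  have c1 : ContDiff ℝ ∞ (deriv (cutoff n)) := (contDiff_infty_iff_deriv.1 (contDiff_cutoff n)).2
  have e : ∀ j, pd j (pd j (coordCutoff i n)) x =
      if j = i then ((deriv (deriv (cutoff n)) (x i) : ℝ) : ℂ) else 0 := by
    intro j
    have e1 : pd j (coordCutoff i n) =
      fun x => if j = i then ((deriv (cutoff n) (x i) : ℝ) : ℂ) else 0 := funext (pd_coordCutoff i j n)
    rw [e1]
    by_cases hj : j = i
    · simp only [hj, if_true]
      rw [pd_coord_comp c1]
      simp
    · simp only [hj, if_false]
      simp [pd]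
  simp [lap, e]

/-- The bracket collects the terms in which `a` is differentiated. When `a` is a cutoff, these are
the error terms supported in the transition layer. -/
lemma lap_mul {a ψ : R4 → ℂ} (ha : ContDiff ℝ ∞ a) (hψ : ContDiff ℝ ∞ ψ) (x : R4) :
    lap (fun x => a x * ψ x) x =
      a x * lap ψ x + (2 * ∑ j, pd j a x * pd j ψ x + lap a x * ψ x) := by
  have da := ha.differentiable_infty
  have dψ := hψ.differentiable_infty
  have da' := fun j => (contDiff_pd ha j).differentiable_infty
  have dψ' := fun j => (contDiff_pd hψ j).differentiable_infty
  have e : ∀ j, pd j (pd j (fun x => a x * ψ x)) x =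
      a x * pd j (pd j ψ) x + (2 * (pd j a x * pd j ψ x) + pd j (pd j a) x * ψ x) := by
    intro j
    have e1 : pd j (fun x => a x * ψ x) = fun x => pd j a x * ψ x + a x * pd j ψ x :=
      funext (pd_mul da dψ j)
    rw [e1, pd_add ((da' j).fun_mul dψ) (da.fun_mul (dψ' j)), pd_mul (da' j) dψ, pd_mul da (dψ' j)]
    ring
  simp only [lap, e, Finset.sum_add_distrib, Finset.mul_sum, Finset.sum_mul]

lemma integrable_mul_test {f φ : R4 → ℂ} (hf : LocallyIntegrable f) (hφ : Continuous φ)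
    (hc : HasCompactSupport φ) : Integrable (fun x => f x * φ x) := by
  have := hf.integrable_smul_right_of_hasCompactSupport hφ hc
  simpa [smul_eq_mul] using this

/-- The cutoff vanishes for `n x_i ≤ 1`, which keeps the closed support off the hyperplane. A test
function crossing the hyperplane thereby becomes admissible for an equation known on one side only.
-/
lemma IsTestOn.cutoff_mul {i : Fin 4} {O : Set R4} {ψ : R4 → ℂ} (h : IsTestOn O ψ) {n : ℕ}
    (hn : 0 < n) : IsTestOn (O ∩ {x | 0 < x i}) (fun x => coordCutoff i n x * ψ x) := by
  have h1 := h.contDiff_mul (contDiff_coordCutoff i n)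
  refine ⟨h1.1, h1.2.1, Set.subset_inter h1.2.2 ?_⟩
  have hn' : (0 : ℝ) < n := by exact_mod_cast hn
  have hcl : IsClosed {x : R4 | 1 ≤ n * x i} :=
    isClosed_le continuous_const (by fun_prop)
  have : tsupport (fun x => coordCutoff i n x * ψ x) ⊆ {x : R4 | 1 ≤ n * x i} := by
    refine closure_minimal (fun x hx => ?_) hcl
    by_contra hlt
    refine hx ?_
    simp [coordCutoff, cutoff_eq_zero (not_le.1 hlt).le]
  intro x hx
  have h2 : (1 : ℝ) ≤ n * x i := this hx
  change 0 < x i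
  by_contra hneg
  have : (n : ℝ) * x i ≤ 0 := mul_nonpos_of_nonneg_of_nonpos hn'.le (not_lt.1 hneg)
  linarith

lemma tendsto_integral_cutoff_mul (i : Fin 4) {h : R4 → ℂ} (hh : Integrable h) :
    Tendsto (fun n => ∫ x, coordCutoff i n x * h x) atTop (𝓝 (∫ x in {x | 0 < x i}, h x)) := by
  have hm : MeasurableSet {x : R4 | 0 < x i} := measurableSet_lt measurable_const (by fun_prop)
  rw [← integral_indicator hm]
  refine tendsto_integral_of_dominated_convergence (fun x => ‖h x‖)
    (fun n => ((contDiff_coordCutoff i n).continuous.aestronglyMeasurable).mul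
      hh.aestronglyMeasurable) hh.norm (fun n => Eventually.of_forall fun x => ?_)
    (Eventually.of_forall fun x => ?_)
  · rw [norm_mul, coordCutoff, Complex.norm_real, Real.norm_of_nonneg (cutoff_nonneg _ _)]
    exact mul_le_of_le_one_left (norm_nonneg _) (cutoff_le_one _ _)
  · have h1 := ((Complex.continuous_ofReal.tendsto _).comp (tendsto_cutoff (x i))).mul_const (h x)
    have e : {x | 0 < x i}.indicator h x
        = (((Set.Ioi (0 : ℝ)).indicator (fun _ => (1 : ℝ)) (x i) : ℝ) : ℂ) * h x := by
      by_cases hx : 0 < x i <;> simp [Set.indicator, hx]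
    rw [e]
    exact h1

end Cutoff

/-! ### The reflection principle for weak equations -/

section WeakReflection

variable {f : R4 → ℂ} {O : Set R4} {i : Fin 4}

lemma norm_le_norm_insEquiv {n : ℕ} (i : Fin (n + 1)) (s : EuclideanSpace ℝ (Fin n)) (t : ℝ) :
    ‖s‖ ≤ ‖insEquiv i (s, t)‖ := by
  rw [EuclideanSpace.norm_eq, EuclideanSpace.norm_eq]
  refine Real.sqrt_le_sqrt ?_
  rw [Fin.sum_univ_succAbove _ i]
  simp only [insEquiv_succAbove]
  have : 0 ≤ ‖insEquiv i (s, t) i‖ ^ 2 := by positivity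
  linarith

/-- The contribution of a layer of width `1/n` near `x_i = 0`, weighted by `n`, is negligible for a
function whose slices tend to zero. -/
lemma tendsto_layer {q : ℝ≥0∞} (hq : 1 ≤ q) (hf : AEStronglyMeasurable f)
    (hvan : Tendsto (fun t : ℝ => eLpNorm (fun s : R3 => f (insEquiv i (s, t))) q volume)
      (𝓝 0 ⊓ ae volume) (𝓝 0)) (R : ℝ) :
    Tendsto (fun n : ℕ => (n : ℝ≥0∞) *
      ∫⁻ x, {x : R4 | ‖x‖ ≤ R ∧ 1 ≤ n * x i ∧ n * x i ≤ 2}.indicator (fun x => ‖f x‖ₑ) x)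
      atTop (𝓝 0) := by
  rw [ENNReal.tendsto_nhds_zero]
  intro ε hε
  set B : Set R3 := Metric.closedBall 0 R
  -- `κ` is the Hölder constant for passing from `L^q` to `L¹` on the ball `B`.
  set κ : ℝ≥0∞ := (volume.restrict B) Set.univ ^ (1 / (1 : ℝ≥0∞).toReal - 1 / q.toReal) with hκ
  have hexp : 0 ≤ 1 / (1 : ℝ≥0∞).toReal - 1 / q.toReal := by
    by_cases hqt : q = ⊤
    · simp [hqt]
    have : 1 ≤ q.toReal := by
      have := ENNReal.toReal_mono hqt hq
      simpa using this
    have := div_le_one_of_le₀ this (by linarith)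
    simp only [ENNReal.toReal_one, div_one]
    linarith
  have hκt : κ ≠ ⊤ := by
    refine ENNReal.rpow_ne_top_of_nonneg hexp ?_
    rw [Measure.restrict_apply_univ]
    exact measure_closedBall_lt_top.ne
  -- Each slice in the layer contributes at most `δ κ`. The layer has width `1 / n`, which the
  -- weight `n` cancels.
  set δ : ℝ≥0∞ := ε / (κ + 1) with hδ
  have hδ0 : 0 < δ := ENNReal.div_pos hε.ne' (by simp [hκt])
  have hev := (ENNReal.tendsto_nhds_zero.1 hvan) δ hδ0
  -- The essential limit splits into a neighbourhood `t₁` of `0` and a set `t₂` of full measure.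
  obtain ⟨t₁, ht₁, t₂, ht₂, hsub⟩ := mem_inf_iff_superset.1 hev
  obtain ⟨r, hr, hball⟩ := Metric.mem_nhds_iff.1 ht₁
  obtain ⟨N, hN⟩ := exists_nat_gt (2 / r)
  filter_upwards [eventually_ge_atTop (max N 1)] with n hn
  have hn1 : (0 : ℝ) < n := by
    have : 1 ≤ n := (le_max_right _ _).trans hn
    exact_mod_cast this
  have hnN : (N : ℝ) ≤ n := by exact_mod_cast (le_max_left _ _).trans hn
  have hset : MeasurableSet {x : R4 | ‖x‖ ≤ R ∧ 1 ≤ n * x i ∧ n * x i ≤ 2} := by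
    have m1 : MeasurableSet {x : R4 | ‖x‖ ≤ R} := measurableSet_le (by fun_prop) measurable_const
    have m2 : MeasurableSet {x : R4 | 1 ≤ n * x i} :=
      measurableSet_le measurable_const (by fun_prop)
    have m3 : MeasurableSet {x : R4 | n * x i ≤ 2} :=
      measurableSet_le (by fun_prop) measurable_const
    exact m1.inter (m2.inter m3)
  rw [lintegral_eq_lintegral_lintegral_insEquiv i (hf.enorm.indicator hset)]
  have hin : ∀ᵐ t : ℝ, ∫⁻ s, {x : R4 | ‖x‖ ≤ R ∧ 1 ≤ n * x i ∧ n * x i ≤ 2}.indicator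
      (fun x => ‖f x‖ₑ) (insEquiv i (s, t)) ≤
      (Set.Icc (1 / (n : ℝ)) (2 / n)).indicator (fun _ => δ * κ) t := by
    filter_upwards [ht₂, aestronglyMeasurable_insEquiv i hf] with t ht hmt
    by_cases htn : t ∈ Set.Icc (1 / (n : ℝ)) (2 / n)
    · rw [Set.indicator_of_mem htn]
      have htr : t ∈ t₁ := by
        refine hball ?_
        rw [mem_ball_zero_iff, Real.norm_eq_abs, abs_of_nonneg (le_trans (by positivity) htn.1)]
        refine htn.2.trans_lt ?_
        rw [div_lt_iff₀ hr] at hN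
        rw [div_lt_iff₀ hn1]
        nlinarith
      have hle : eLpNorm (fun s : R3 => f (insEquiv i (s, t))) q volume ≤ δ := hsub ⟨htr, ht⟩
      calc _ ≤ ∫⁻ s in B, ‖f (insEquiv i (s, t))‖ₑ := by
            rw [← lintegral_indicator Metric.isClosed_closedBall.measurableSet]
            refine lintegral_mono fun s => ?_
            by_cases hs : insEquiv i (s, t) ∈ {x : R4 | ‖x‖ ≤ R ∧ 1 ≤ n * x i ∧ n * x i ≤ 2}
            swap
            · rw [Set.indicator_of_notMem hs]
              exact zero_le
            rw [Set.indicator_of_mem hs]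
            have : s ∈ B := mem_closedBall_zero_iff.2 ((norm_le_norm_insEquiv i s t).trans hs.1)
            rw [Set.indicator_of_mem this]
        _ = eLpNorm (fun s : R3 => f (insEquiv i (s, t))) 1 (volume.restrict B) :=
            eLpNorm_one_eq_lintegral_enorm.symm
        _ ≤ eLpNorm (fun s : R3 => f (insEquiv i (s, t))) q (volume.restrict B) * κ :=
            eLpNorm_le_eLpNorm_mul_rpow_measure_univ hq hmt.restrict
        _ ≤ δ * κ := by
            gcongr
            exact (eLpNorm_restrict_le _ _ _ _).trans hle
    · rw [Set.indicator_of_notMem htn]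
      refine (lintegral_eq_zero_of_ae_eq_zero (Eventually.of_forall fun s => ?_)).le
      refine Set.indicator_of_notMem (fun hs => htn ?_) _
      have h2 := hs.2
      simp only [insEquiv_same] at h2
      constructor
      · rw [div_le_iff₀ hn1]; linarith [h2.1]
      · rw [le_div_iff₀ hn1]; linarith [h2.2]
  calc _ ≤ (n : ℝ≥0∞) * ∫⁻ t, (Set.Icc (1 / (n : ℝ)) (2 / n)).indicator (fun _ => δ * κ) t := by
        exact mul_le_mul_right (lintegral_mono_ae hin) _
    _ = δ * κ := by
        rw [lintegral_indicator measurableSet_Icc, setLIntegral_const, Real.volume_Icc]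
        have : (2 / (n : ℝ) - 1 / n) = (n : ℝ)⁻¹ := by field_simp; norm_num
        rw [this, ENNReal.ofReal_inv_of_pos hn1, ENNReal.ofReal_natCast, mul_left_comm,
          ENNReal.mul_inv_cancel (by exact_mod_cast hn1.ne') (ENNReal.natCast_ne_top n), mul_one]
    _ ≤ δ * (κ + 1) := by gcongr; exact le_self_add
    _ ≤ ε := by
        rw [hδ, ENNReal.div_mul_cancel (by simp) (by simp [hκt])]

end WeakReflection

section OddPairing

variable {f : R4 → ℂ} {O : Set R4} {i : Fin 4}

lemma measurableSet_coord_pos (i : Fin 4) : MeasurableSet {x : R4 | 0 < x i} :=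
  measurableSet_lt measurable_const (by fun_prop)

/-- The half `x_i < 0` is folded onto `x_i > 0` by the measure-preserving reflection, so only the
odd part of `φ` is seen. On the hyperplane itself oddness forces `f = 0`. -/
lemma integral_mul_eq_of_odd (hodd : ∀ x, f (coordRefl i x) = -f x) {φ : R4 → ℂ}
    (hint : Integrable (fun x => f x * φ x)) :
    ∫ x, f x * φ x = ∫ x in {x | 0 < x i}, f x * (φ x - φ (coordRefl i x)) := by
  have hm := measurableSet_coord_pos i
  set P := {x : R4 | 0 < x i} with hP
  have hint2 : Integrable (fun x => f (coordRefl i x) * φ (coordRefl i x)) :=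
    (measurePreserving_coordRefl i).integrable_comp_of_integrable hint
  have e1 : ∀ x, f x * φ x = P.indicator (fun x => f x * φ x) x +
      P.indicator (fun x => f (coordRefl i x) * φ (coordRefl i x)) (coordRefl i x) := by
    intro x
    have hr : coordRefl i x i = -x i := by simp [coordRefl_apply]
    rcases lt_trichotomy (x i) 0 with h | h | h
    · have h1 : x ∉ P := not_lt.2 h.le
      have h2 : coordRefl i x ∈ P := by
        change 0 < coordRefl i x i
        rw [hr]; linarith
      rw [Set.indicator_of_notMem h1, Set.indicator_of_mem h2, coordRefl_coordRefl, zero_add]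
    · have h1 : x ∉ P := not_lt.2 h.le
      have h2 : coordRefl i x ∉ P := fun hlt : 0 < coordRefl i x i => by
        rw [hr] at hlt; linarith
      have h3 : coordRefl i x = x := by
        ext j
        rw [coordRefl_apply]
        split_ifs with hj
        · rw [hj, h, neg_zero]
        · rfl
      have h4 : f x = 0 := by
        have := hodd x
        rw [h3] at this
        exact self_eq_neg.1 this
      rw [Set.indicator_of_notMem h1, Set.indicator_of_notMem h2, h4, zero_mul, add_zero]
    · have h1 : x ∈ P := h
      have h2 : coordRefl i x ∉ P := fun hlt : 0 < coordRefl i x i => by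
        rw [hr] at hlt; linarith
      rw [Set.indicator_of_mem h1, Set.indicator_of_notMem h2, add_zero]
  have i1 : Integrable (P.indicator fun x => f x * φ x) := hint.indicator hm
  have i2 : Integrable (P.indicator fun x => f (coordRefl i x) * φ (coordRefl i x)) :=
    hint2.indicator hm
  calc ∫ x, f x * φ x
      = ∫ x, (P.indicator (fun x => f x * φ x) x +
      P.indicator (fun x => f (coordRefl i x) * φ (coordRefl i x)) (coordRefl i x)) :=
        integral_congr_ae (Eventually.of_forall e1)
    _ = (∫ x in P, f x * φ x) + ∫ x in P, f (coordRefl i x) * φ (coordRefl i x) := by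
        have i3 : Integrable (fun x => P.indicator
            (fun x => f (coordRefl i x) * φ (coordRefl i x)) (coordRefl i x)) :=
          (measurePreserving_coordRefl i).integrable_comp_of_integrable i2
        rw [integral_add i1 i3]
        congr 1
        · exact integral_indicator hm
        · exact (integral_comp_coordRefl i _).trans (integral_indicator hm)
    _ = _ := by
        rw [← integral_add hint.integrableOn hint2.integrableOn]
        congr 1
        ext x
        rw [hodd]
        ring

lemma isTestOn_antisymm {φ : R4 → ℂ} (h : IsTestOn O φ) (hO : ∀ x ∈ O, coordRefl i x ∈ O) :
    IsTestOn O (fun x => φ x - φ (coordRefl i x)) :=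
  h.sub (h.comp_refl i hO)

/-- `φ` is Lipschitz, and a point and its reflection are `2 |x_i|` apart. This linear vanishing
absorbs one of the two factors `n` in the second derivative of the cutoff. -/
lemma exists_bound_antisymm {φ : R4 → ℂ} (h : IsTestOn O φ) (i : Fin 4) :
    ∃ C : ℝ, 0 ≤ C ∧ ∀ x, ‖φ x - φ (coordRefl i x)‖ ≤ C * |x i| := by
  obtain ⟨K, hK⟩ := (h.1.of_le (by simp) : ContDiff ℝ 1 φ).lipschitzWith_of_hasCompactSupport
    h.2.1 (by norm_num)
  refine ⟨K * 2, by positivity, fun x => ?_⟩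
  have h1 := hK.dist_le_mul x (coordRefl i x)
  rw [dist_eq_norm, dist_eq_norm] at h1
  have h2 : x - coordRefl i x = (2 * x i) • EuclideanSpace.single i (1 : ℝ) := by
    ext j
    simp only [PiLp.sub_apply, coordRefl_apply, PiLp.smul_apply, PiLp.single_apply,
      smul_eq_mul]
    split_ifs with hj
    · rw [hj]; ring
    · ring
  rw [h2, norm_smul, Real.norm_eq_abs, abs_mul] at h1
  simp only [PiLp.norm_single, norm_one, mul_one, abs_two] at h1
  linarith

/-- A function which is odd in `x_i`, weakly harmonic in `x_i > 0`, and whose slices vanish at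
`x_i = 0`, is weakly harmonic across `x_i = 0`. -/
theorem weak_lap_of_odd {q : ℝ≥0∞} (hq : 1 ≤ q) (hf : LocallyIntegrable f)
    (hO : ∀ x ∈ O, coordRefl i x ∈ O) (hodd : ∀ x, f (coordRefl i x) = -f x)
    (hvan : Tendsto (fun t : ℝ => eLpNorm (fun s : R3 => f (insEquiv i (s, t))) q volume)
      (𝓝 0 ⊓ ae volume) (𝓝 0))
    (hweak : ∀ φ, IsTestOn (O ∩ {x | 0 < x i}) φ → ∫ x, f x * lap φ x = 0) :
    ∀ φ, IsTestOn O φ → ∫ x, f x * lap φ x = 0 := by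
  intro φ hφ
  set ψ : R4 → ℂ := fun x => φ x - φ (coordRefl i x) with hψ
  have hψt : IsTestOn O ψ := isTestOn_antisymm hφ hO
  have hint : ∀ {θ}, IsTestOn O θ → Integrable (fun x => f x * θ x) := fun h =>
    integrable_mul_test hf h.1.continuous h.2.1
  have hlap : ∀ x, lap φ x - lap φ (coordRefl i x) = lap ψ x := by
    intro x
    have hs := hφ.comp_refl i hO
    have e := lap_mul (a := fun _ => (-1 : ℂ)) contDiff_const hs.1 x
    have d1 := hφ.1.differentiable_infty
    have d2 := hs.1.differentiable_infty
    rw [← lap_comp_refl hφ.1 i x]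
    unfold lap
    rw [← Finset.sum_sub_distrib]
    refine Finset.sum_congr rfl fun j _ => ?_
    have e : pd j ψ = fun x => pd j φ x - pd j (fun x => φ (coordRefl i x)) x :=
      funext (pd_sub d1 d2 j)
    rw [e, pd_sub ((contDiff_pd hφ.1 j).differentiable_infty)
      ((contDiff_pd hs.1 j).differentiable_infty)]
  rw [integral_mul_eq_of_odd hodd (hint hφ.laplace)]
  simp only [hlap]
  have hlim := tendsto_integral_cutoff_mul i (hint hψt.laplace)
  refine tendsto_nhds_unique hlim ?_
  -- the error terms
  obtain ⟨C₀, hC₀, hθ⟩ := exists_bound_deriv_smoothTransition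
  obtain ⟨C₁, hC₁, hψb⟩ := exists_bound_antisymm hφ i
  obtain ⟨C₂, hC₂⟩ := (hψt.pderiv i).2.1.exists_bound_of_continuous (hψt.pderiv i).1.continuous
  have hC₂0 : 0 ≤ C₂ := (norm_nonneg _).trans (hC₂ 0)
  obtain ⟨R, hR⟩ := hψt.2.1.isCompact.isBounded.exists_norm_le
  set err : ℕ → R4 → ℂ := fun n x => 2 * ∑ j, pd j (coordCutoff i n) x * pd j ψ x +
    lap (coordCutoff i n) x * ψ x with herr
  have herr_eq : ∀ n x, err n x = 2 * (((deriv (cutoff n) (x i) : ℝ) : ℂ) * pd i ψ x) +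
      ((deriv (deriv (cutoff n)) (x i) : ℝ) : ℂ) * ψ x := by
    intro n x
    simp only [herr, pd_coordCutoff, lap_coordCutoff]
    congr 2
    simp
  -- Both error terms are `O(n)` on the layer. In the first, a derivative of size `n` meets the
  -- bounded `pd i ψ`; in the second, one of size `n²` meets `‖ψ‖ ≤ C₁ |x_i| ≤ 2 C₁ / n`. This
  -- matches the weight in `tendsto_layer`.
  have herrb : ∀ n : ℕ, ∀ x, ‖err n x‖ₑ ≤ ENNReal.ofReal (2 * C₀ * C₂ + 2 * C₀ * C₁) *
      ((n : ℝ≥0∞) * {x : R4 | ‖x‖ ≤ R ∧ 1 ≤ n * x i ∧ n * x i ≤ 2}.indicator (fun _ => 1) x) := by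
    intro n x
    rw [herr_eq, deriv_cutoff, deriv_deriv_cutoff]
    by_cases hx : x ∈ {x : R4 | ‖x‖ ≤ R ∧ 1 ≤ n * x i ∧ n * x i ≤ 2}
    · rw [Set.indicator_of_mem hx, mul_one, ← ofReal_norm, ← ENNReal.ofReal_natCast,
        ← ENNReal.ofReal_mul (by positivity)]
      refine ENNReal.ofReal_le_ofReal ?_
      have b1 : |deriv Real.smoothTransition (n * x i - 1)| ≤ C₀ :=
        (hθ _).1.trans (Set.indicator_le_self' (fun _ _ => hC₀) _)
      have b2 : |deriv (deriv Real.smoothTransition) (n * x i - 1)| ≤ C₀ :=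
        (hθ _).2.trans (Set.indicator_le_self' (fun _ _ => hC₀) _)
      have b3 : ‖ψ x‖ ≤ C₁ * |x i| := hψb x
      have b4 : ‖pd i ψ x‖ ≤ C₂ := hC₂ x
      have hnx : (n : ℝ) * |x i| ≤ 2 := by
        rw [← Nat.abs_cast n, ← abs_mul, abs_le]
        have := hx.2
        constructor <;> linarith [this.1, this.2]
      refine (norm_add_le _ _).trans ?_
      simp only [norm_mul, Complex.norm_real, Complex.norm_ofNat, Real.norm_eq_abs,
        Nat.abs_cast, abs_pow]
      have t1 : 2 * (n * |deriv Real.smoothTransition (n * x i - 1)| * ‖pd i ψ x‖) ≤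
          2 * (n * C₀ * C₂) := by gcongr
      have t2 : (n : ℝ) ^ 2 * |deriv (deriv Real.smoothTransition) (n * x i - 1)| * ‖ψ x‖ ≤
          n ^ 2 * C₀ * (C₁ * |x i|) := by gcongr
      have t3 : (n : ℝ) ^ 2 * C₀ * (C₁ * |x i|) ≤ n * C₀ * C₁ * 2 := by
        have : (n : ℝ) ^ 2 * C₀ * (C₁ * |x i|) = n * C₀ * C₁ * (n * |x i|) := by ring
        rw [this]
        gcongr
      linarith
    · rw [Set.indicator_of_notMem hx, mul_zero, mul_zero]
      have hcase : x ∉ tsupport ψ ∨ (n * x i - 1) ∉ Set.Icc (0 : ℝ) 1 := by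
        by_contra hcon
        push Not at hcon
        refine hx ⟨hR x hcon.1, ?_, ?_⟩
        · linarith [hcon.2.1]
        · linarith [hcon.2.2]
      rcases hcase with hc | hc
      · have z1 : ψ x = 0 := image_eq_zero_of_notMem_tsupport hc
        have z2 : pd i ψ x = 0 :=
          image_eq_zero_of_notMem_tsupport fun h => hc (tsupport_pd_subset ψ i h)
        rw [z1, z2]
        simp
      · have z1 : deriv Real.smoothTransition (n * x i - 1) = 0 := by
          have := (hθ (n * x i - 1)).1
          rw [Set.indicator_of_notMem hc] at this
          exact abs_nonpos_iff.1 this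
        have z2 : deriv (deriv Real.smoothTransition) (n * x i - 1) = 0 := by
          have := (hθ (n * x i - 1)).2
          rw [Set.indicator_of_notMem hc] at this
          exact abs_nonpos_iff.1 this
        rw [z1, z2]
        simp
  have herr_test : ∀ n, IsTestOn O (err n) := by
    intro n
    have e : err n = fun x => lap (fun x => coordCutoff i n x * ψ x) x -
        coordCutoff i n x * lap ψ x := by
      ext x
      rw [lap_mul (contDiff_coordCutoff i n) hψt.1]
      simp only [herr]
      ring
    rw [e]
    exact (hψt.contDiff_mul (contDiff_coordCutoff i n)).laplace.sub
      (hψt.laplace.contDiff_mul (contDiff_coordCutoff i n))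
  -- The cut-off `ψ` is a legitimate test function on `x_i > 0`, so the main term is minus the
  -- error.
  have heq : ∀ n : ℕ, 0 < n → ∫ x, coordCutoff i n x * (f x * lap ψ x) =
      -∫ x, f x * err n x := by
    intro n hn
    have h0 := hweak _ (hψt.cutoff_mul (i := i) hn)
    have hsplit : ∀ x, f x * lap (fun x => coordCutoff i n x * ψ x) x =
        coordCutoff i n x * (f x * lap ψ x) + f x * err n x := by
      intro x
      rw [lap_mul (contDiff_coordCutoff i n) hψt.1]
      simp only [herr]
      ring
    simp only [hsplit] at h0
    have hi1 : Integrable (fun x => coordCutoff i n x * (f x * lap ψ x)) := by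
      refine (hint (hψt.laplace.contDiff_mul (contDiff_coordCutoff i n))).congr
        (Eventually.of_forall fun x => ?_)
      simp only
      ring
    rw [integral_add hi1 (hint (herr_test n))] at h0
    exact eq_neg_of_add_eq_zero_left h0
  have hz : Tendsto (fun n => ∫ x, f x * err n x) atTop (𝓝 0) := by
    rw [tendsto_zero_iff_enorm_tendsto_zero]
    have hl := tendsto_layer hq hf.aestronglyMeasurable hvan R
    have hl2 := ENNReal.Tendsto.const_mul (a := ENNReal.ofReal (2 * C₀ * C₂ + 2 * C₀ * C₁)) hl
      (Or.inr ENNReal.ofReal_ne_top)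
    rw [mul_zero] at hl2
    refine tendsto_of_tendsto_of_tendsto_of_le_of_le tendsto_const_nhds hl2
      (fun n => zero_le) (fun n => ?_)
    refine (enorm_integral_le_lintegral_enorm _).trans ?_
    rw [← lintegral_const_mul' _ _ (ENNReal.natCast_ne_top n),
      ← lintegral_const_mul' _ _ ENNReal.ofReal_ne_top]
    refine lintegral_mono fun x => ?_
    rw [enorm_mul]
    refine (mul_le_mul_right (herrb n x) _).trans (le_of_eq ?_)
    by_cases hx : x ∈ {x : R4 | ‖x‖ ≤ R ∧ 1 ≤ n * x i ∧ n * x i ≤ 2}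
    · rw [Set.indicator_of_mem hx, Set.indicator_of_mem hx]
      ring
    · rw [Set.indicator_of_notMem hx, Set.indicator_of_notMem hx]
      simp
  have := hz.neg
  rw [neg_zero] at this
  refine this.congr' ?_
  filter_upwards [eventually_gt_atTop 0] with n hn
  exact (heq n hn).symm

end OddPairing

/-! ### A maximum principle for functions vanishing at infinity -/

section MaximumPrinciple

/-- A positive second derivative would make `0` a local minimum as well, hence `g` locally constant
and its second derivative zero. -/
lemma second_deriv_nonpos_of_isLocalMax {g g' g'' : ℝ → ℝ} (h1 : ∀ t, HasDerivAt g (g' t) t)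
    (h2 : ∀ t, HasDerivAt g' (g'' t) t) (hmax : IsLocalMax g 0) : g'' 0 ≤ 0 := by
  by_contra hpos
  push Not at hpos
  have e1 : deriv g = g' := funext fun t => (h1 t).deriv
  have e2 : deriv g' = g'' := funext fun t => (h2 t).deriv
  have hmin : IsLocalMin g 0 := isLocalMin_of_deriv_deriv_pos (by rwa [e1, e2])
    hmax.deriv_eq_zero (h1 0).continuousAt
  have hconst : g =ᶠ[𝓝 0] fun _ => g 0 := by
    filter_upwards [hmax, hmin] with t ht1 ht2
    exact le_antisymm ht1 ht2
  have hd : g' =ᶠ[𝓝 0] fun _ => 0 := by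
    filter_upwards [hconst.eventuallyEq_nhds] with t ht
    rw [← e1, ht.deriv_eq, deriv_const]
  have : g'' 0 = 0 := by rw [← e2, hd.deriv_eq, deriv_const]
  linarith

variable {E : Type*} [NormedAddCommGroup E] [InnerProductSpace ℝ E] [FiniteDimensional ℝ E]
  {ι : Type*} [Fintype ι] [Nonempty ι]

/-- A real function vanishing at infinity, with vanishing sum of second derivatives along
finitely many unit vectors, is nonpositive. -/
lemma nonpos_of_harmonic_of_tendsto_zero {F : E → ℝ} {F₁ F₂ : ι → E → ℝ} {v : ι → E}
    (hv : ∀ j, ‖v j‖ = 1) (hF : Continuous F) (h0 : Tendsto F (cocompact E) (𝓝 0))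
    (h1 : ∀ j a t, HasDerivAt (fun t : ℝ => F (a + t • v j)) (F₁ j (a + t • v j)) t)
    (h2 : ∀ j a t, HasDerivAt (fun t : ℝ => F₁ j (a + t • v j)) (F₂ j (a + t • v j)) t)
    (hsum : ∀ a, ∑ j, F₂ j a = 0) (a₀ : E) : F a₀ ≤ 0 := by
  by_contra hpos
  push Not at hpos
  set m := F a₀ with hm
  obtain ⟨R₀, hR₀⟩ : ∃ R₀ : ℝ, ∀ a, R₀ ≤ ‖a‖ → F a < m / 2 := by
    have h3 : ∀ᶠ a in cocompact E, F a < m / 2 := h0.eventually (gt_mem_nhds (by linarith))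
    obtain ⟨K, hK, hKs⟩ := mem_cocompact.1 h3
    obtain ⟨R, hR⟩ := hK.isBounded.exists_norm_le
    refine ⟨R + 1, fun a ha => hKs fun haK => ?_⟩
    have := hR a haK
    linarith
  set R := max (max R₀ ‖a₀‖) 1 with hRdef
  have hR1 : 1 ≤ R := le_max_right _ _
  -- Adding `ε ‖a‖²` raises `F` by at most `m / 4` on the ball, too little to lift the boundary
  -- values, below `m / 2`, up to `m`. The maximum of `G` is therefore interior, and there each `F₂
  -- j` is at most `-2 ε`, contradicting the vanishing sum.
  set ε := m / (4 * R ^ 2) with hε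
  have hε0 : 0 < ε := by positivity
  set G : E → ℝ := fun a => F a + ε * ‖a‖ ^ 2 with hG
  have hGc : Continuous G := by fun_prop
  obtain ⟨a₁, ha₁, hmax⟩ := (isCompact_closedBall (0 : E) R).exists_isMaxOn
    ⟨0, by simp; linarith⟩ hGc.continuousOn
  have hGa₀ : m ≤ G a₁ := by
    have h4 : a₀ ∈ Metric.closedBall (0 : E) R :=
      mem_closedBall_zero_iff.2 ((le_max_right _ _).trans (le_max_left _ _))
    have h5 : G a₀ ≤ G a₁ := hmax h4
    have : m ≤ G a₀ := by
      simp only [hG]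
      have : 0 ≤ ε * ‖a₀‖ ^ 2 := by positivity
      linarith
    linarith
  have hint : ‖a₁‖ < R := by
    by_contra hge
    push Not at hge
    have h6 : ‖a₁‖ = R := le_antisymm (mem_closedBall_zero_iff.1 ha₁) hge
    have h7 : F a₁ < m / 2 := hR₀ _ (by
      rw [h6]
      exact (le_max_left _ _).trans (le_max_left _ _))
    have h8 : ε * ‖a₁‖ ^ 2 = m / 4 := by rw [h6, hε]; field_simp
    simp only [hG] at hGa₀
    linarith
  have hloc : IsLocalMax G a₁ := by
    refine hmax.isLocalMax ?_
    exact mem_of_superset (Metric.isOpen_ball.mem_nhds (mem_ball_zero_iff.2 hint))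
      Metric.ball_subset_closedBall
  have hj : ∀ j, F₂ j a₁ + 2 * ε ≤ 0 := by
    intro j
    have hline : Continuous fun t : ℝ => a₁ + t • v j := by fun_prop
    have hlm : IsLocalMax (fun t : ℝ => G (a₁ + t • v j)) 0 := by
      have h9 : Tendsto (fun t : ℝ => a₁ + t • v j) (𝓝 0) (𝓝 a₁) := by
        simpa using hline.tendsto 0
      have := h9.eventually hloc
      simpa [IsLocalMax, IsMaxFilter] using this
    have hsq : ∀ t : ℝ, ‖a₁ + t • v j‖ ^ 2 = ‖a₁‖ ^ 2 + 2 * inner ℝ a₁ (v j) * t + t ^ 2 := by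
      intro t
      rw [norm_add_sq_real, norm_smul, hv, inner_smul_right, mul_one, Real.norm_eq_abs, sq_abs]
      ring
    have hd1 : ∀ t : ℝ, HasDerivAt (fun t : ℝ => G (a₁ + t • v j))
        (F₁ j (a₁ + t • v j) + ε * (2 * inner ℝ a₁ (v j) + 2 * t)) t := by
      intro t
      have e : (fun t : ℝ => G (a₁ + t • v j)) = fun t : ℝ => F (a₁ + t • v j) +
          ε * (‖a₁‖ ^ 2 + 2 * inner ℝ a₁ (v j) * t + t ^ 2) := by
        ext t
        simp only [hG, hsq]
      rw [e]
      refine (h1 j a₁ t).add (HasDerivAt.const_mul ε ?_)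
      have d1 := ((hasDerivAt_id t).const_mul (2 * inner ℝ a₁ (v j))).const_add (‖a₁‖ ^ 2)
      have d2 := d1.add (hasDerivAt_pow 2 t)
      exact d2.congr_deriv (by simp)
    have hd2 : ∀ t : ℝ, HasDerivAt
        (fun t : ℝ => F₁ j (a₁ + t • v j) + ε * (2 * inner ℝ a₁ (v j) + 2 * t))
        (F₂ j (a₁ + t • v j) + ε * 2) t := by
      intro t
      refine (h2 j a₁ t).add (HasDerivAt.const_mul ε ?_)
      simpa using ((hasDerivAt_id t).const_mul (2 : ℝ)).const_add (2 * inner ℝ a₁ (v j))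
    have := second_deriv_nonpos_of_isLocalMax hd1 hd2 hlm
    simp only [zero_smul, add_zero] at this
    linarith
  have htot : ∑ j, (F₂ j a₁ + 2 * ε) ≤ 0 := Finset.sum_nonpos fun j _ => hj j
  rw [Finset.sum_add_distrib, hsum, zero_add, Finset.sum_const, Finset.card_univ, nsmul_eq_mul]
    at htot
  have : (0 : ℝ) < Fintype.card ι := by exact_mod_cast Fintype.card_pos
  have : 0 < (Fintype.card ι : ℝ) * (2 * ε) := by positivity
  linarith

lemma eq_zero_of_harmonic_of_tendsto_zero {F : E → ℂ} {F₁ F₂ : ι → E → ℂ} {v : ι → E}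
    (hv : ∀ j, ‖v j‖ = 1) (hF : Continuous F) (h0 : Tendsto F (cocompact E) (𝓝 0))
    (h1 : ∀ j a t, HasDerivAt (fun t : ℝ => F (a + t • v j)) (F₁ j (a + t • v j)) t)
    (h2 : ∀ j a t, HasDerivAt (fun t : ℝ => F₁ j (a + t • v j)) (F₂ j (a + t • v j)) t)
    (hsum : ∀ a, ∑ j, F₂ j a = 0) (a₀ : E) : F a₀ = 0 := by
  have key : ∀ ℓ : ℂ →L[ℝ] ℝ, ℓ (F a₀) ≤ 0 := by
    intro ℓ
    refine nonpos_of_harmonic_of_tendsto_zero (F := fun a => ℓ (F a))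
      (F₁ := fun j a => ℓ (F₁ j a)) (F₂ := fun j a => ℓ (F₂ j a)) hv (ℓ.continuous.comp hF) ?_
      (fun j a t => ℓ.hasFDerivAt.comp_hasDerivAt t (h1 j a t))
      (fun j a t => ℓ.hasFDerivAt.comp_hasDerivAt t (h2 j a t)) (fun a => ?_) a₀
    · have := (ℓ.continuous.tendsto 0).comp h0
      rwa [map_zero] at this
    · rw [← map_sum, hsum, map_zero]
  have r1 := key Complex.reCLM
  have r2 := key (-Complex.reCLM)
  have i1 := key Complex.imCLM
  have i2 := key (-Complex.imCLM)
  simp at r1 r2 i1 i2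
  exact Complex.ext (by simp; linarith) (by simp; linarith)

end MaximumPrinciple

/-! ### Liouville's theorem for weakly harmonic `L^p` functions -/

section Liouville

variable {f : R4 → ℂ} {O : Set R4}

/-- Pairing of `f` with the translates of `φ`. -/
noncomputable def transPair (f φ : R4 → ℂ) (x : R4) : ℂ := ∫ z, f z * φ (z - x)

lemma transPair_eq_convolution (f φ : R4 → ℂ) :
    transPair f φ = convolution f (fun y => φ (-y)) (ContinuousLinearMap.mul ℝ ℂ) volume := by
  ext x
  simp [transPair, convolution]

/-- The pairing is a convolution with the reflected `φ`. Derivatives in the translation therefore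
fall on `φ`, with a sign, and no regularity of `f` is needed. -/
lemma hasFDerivAt_transPair (hf : LocallyIntegrable f) {φ : R4 → ℂ} (hφ : IsTestOn O φ)
    (x : R4) : ∃ A : R4 →L[ℝ] ℂ, HasFDerivAt (transPair f φ) A x ∧
      ∀ j, A (EuclideanSpace.single j 1) = -transPair f (pd j φ) x := by
  have hc : HasCompactSupport (fun y => φ (-y)) := hφ.2.1.comp_homeomorph (Homeomorph.neg R4)
  have hd : ContDiff ℝ 1 (fun y => φ (-y)) := (hφ.1.of_le (by simp)).comp contDiff_neg
  have h := hc.hasFDerivAt_convolution_right (ContinuousLinearMap.mul ℝ ℂ) hf hd x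
  refine ⟨_, by rw [transPair_eq_convolution]; exact h, fun j => ?_⟩
  rw [convolution_precompR_apply _ hf (hc.fderiv ℝ) (hd.continuous_fderiv (by norm_num))]
  simp only [transPair, convolution, ContinuousLinearMap.mul_apply']
  rw [← integral_neg]
  congr 1
  ext z
  have : fderiv ℝ (fun y => φ (-y)) (x - z) (EuclideanSpace.single j 1) = -pd j φ (z - x) := by
    have h3 : HasFDerivAt (fun y : R4 => φ (-y))
        ((fderiv ℝ φ (-(x - z))).comp (-ContinuousLinearMap.id ℝ R4)) (x - z) :=
      (hφ.1.differentiable_infty (-(x - z))).hasFDerivAt.comp (x - z) (hasFDerivAt_id _).neg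
    rw [h3.fderiv]
    simp [pd]
  rw [this]
  ring

lemma continuous_transPair (hf : LocallyIntegrable f) {φ : R4 → ℂ} (hφ : IsTestOn O φ) :
    Continuous (transPair f φ) := by
  rw [continuous_iff_continuousAt]
  intro x
  obtain ⟨A, hA, -⟩ := hasFDerivAt_transPair hf hφ x
  exact hA.continuousAt

/-- Split by `‖f‖ ≤ δ + δ ^ (1 - r) ‖f‖ ^ r`. The constant contributes at most `δ` times the `L¹`
norm of `φ`. The other term tends to zero because the support of the translated `φ` escapes while
`‖f‖ ^ r` is integrable. -/
lemma tendsto_transPair {p : ℝ≥0∞} (hp : 1 ≤ p) (hpt : p ≠ ⊤) (hf : MemLp f p) {φ : R4 → ℂ}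
    (hφ : IsTestOn O φ) : Tendsto (transPair f φ) (cocompact R4) (𝓝 0) := by
  obtain ⟨C, hC⟩ := hφ.2.1.exists_bound_of_continuous hφ.1.continuous
  have hC0 : 0 ≤ C := (norm_nonneg _).trans (hC 0)
  set r := p.toReal with hr
  have hr1 : 1 ≤ r := by
    have := ENNReal.toReal_mono hpt hp
    simpa using this
  have hp0 : p ≠ 0 := (zero_lt_one.trans_le hp).ne'
  have hfr : Integrable (fun z => ‖f z‖ ^ r) := hf.integrable_norm_rpow hp0 hpt
  have hφi : Integrable (fun z => ‖φ z‖) :=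
    (hφ.1.continuous.integrable_of_hasCompactSupport hφ.2.1).norm
  set I := ∫ z, ‖φ z‖ with hI
  have hI0 : 0 ≤ I := integral_nonneg fun z => norm_nonneg _
  -- the local `L^p` mass escapes
  have hlim : Tendsto (fun x => ∫ z, ‖f z‖ ^ r * ‖φ (z - x)‖) (cocompact R4) (𝓝 0) := by
    rw [show (0 : ℝ) = ∫ _ : R4, (0 : ℝ) by simp]
    -- Dominated convergence along a filter requires countable generation; here the filter is the
    -- preimage of `atTop` under the norm.
    have : (cocompact R4).IsCountablyGenerated := by
      rw [← Metric.cobounded_eq_cocompact, ← comap_norm_atTop]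
      infer_instance
    refine tendsto_integral_filter_of_dominated_convergence (fun z => ‖f z‖ ^ r * C)
      (Eventually.of_forall fun x => ?_) (Eventually.of_forall fun x =>
        Eventually.of_forall fun z => ?_) (hfr.mul_const C) (Eventually.of_forall fun z => ?_)
    · exact hfr.aestronglyMeasurable.mul
        (hφ.1.continuous.comp (continuous_id.sub continuous_const)).norm.aestronglyMeasurable
    · rw [Real.norm_of_nonneg (by positivity)]
      exact mul_le_mul_of_nonneg_left (hC _) (by positivity)
    · refine tendsto_const_nhds.congr' ?_
      have hK : IsCompact ((fun y : R4 => z - y) '' tsupport φ) :=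
        hφ.2.1.isCompact.image (by fun_prop)
      filter_upwards [hK.compl_mem_cocompact] with x hx
      have : φ (z - x) = 0 := by
        refine image_eq_zero_of_notMem_tsupport fun h => hx ⟨z - x, h, ?_⟩
        simp
      simp [this]
  rw [Metric.tendsto_nhds]
  intro ε hε
  -- This makes `δ (I + 1) = ε / 2`; the threshold `ε / 2 * δ ^ (r - 1)` then cancels the factor `δ
  -- ^ (1 - r)` of the other half.
  set δ := ε / (2 * (I + 1)) with hδ
  have hδ0 : 0 < δ := by positivity
  have hev : ∀ᶠ x in cocompact R4, ∫ z, ‖f z‖ ^ r * ‖φ (z - x)‖ < ε / 2 * δ ^ (r - 1) :=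
    hlim.eventually (gt_mem_nhds (by positivity))
  filter_upwards [hev] with x hx
  rw [dist_zero_right]
  have hi1 : Integrable (fun z => ‖φ (z - x)‖) := hφi.comp_sub_right x
  have hi2 : Integrable (fun z => ‖f z‖ ^ r * ‖φ (z - x)‖) := by
    refine hfr.mul_bdd (c := C)
      (hφ.1.continuous.comp (continuous_id.sub continuous_const)).norm.aestronglyMeasurable
      (Eventually.of_forall fun z => ?_)
    rw [norm_norm]
    exact hC _
  have hpt2 : ∀ z, ‖f z‖ ≤ δ + δ ^ (1 - r) * ‖f z‖ ^ r := by
    intro z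
    by_cases h : ‖f z‖ ≤ δ
    · have : 0 ≤ δ ^ (1 - r) * ‖f z‖ ^ r := by positivity
      linarith
    · push Not at h
      have hpos : 0 < ‖f z‖ := hδ0.trans h
      have : ‖f z‖ = ‖f z‖ ^ (1 - r) * ‖f z‖ ^ r := by
        rw [← Real.rpow_add hpos]; simp
      have h2 : ‖f z‖ ^ (1 - r) ≤ δ ^ (1 - r) :=
        Real.rpow_le_rpow_of_nonpos hδ0 h.le (by linarith)
      have h3 : ‖f z‖ ^ (1 - r) * ‖f z‖ ^ r ≤ δ ^ (1 - r) * ‖f z‖ ^ r := by gcongr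
      linarith
  calc ‖transPair f φ x‖ ≤ ∫ z, (δ * ‖φ (z - x)‖ + δ ^ (1 - r) * (‖f z‖ ^ r * ‖φ (z - x)‖)) := by
        refine norm_integral_le_of_norm_le ((hi1.const_mul _).add (hi2.const_mul _))
          (Eventually.of_forall fun z => ?_)
        rw [norm_mul]
        have := mul_le_mul_of_nonneg_right (hpt2 z) (norm_nonneg (φ (z - x)))
        linarith
    _ = δ * I + δ ^ (1 - r) * ∫ z, ‖f z‖ ^ r * ‖φ (z - x)‖ := by
        rw [integral_add (hi1.const_mul _) (hi2.const_mul _), integral_const_mul,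
          integral_const_mul, integral_sub_right_eq_self (fun z => ‖φ z‖) x]
    _ < δ * (I + 1) + δ ^ (1 - r) * (ε / 2 * δ ^ (r - 1)) := by
        have h5 : 0 < δ ^ (1 - r) := by positivity
        have := mul_lt_mul_of_pos_left hx h5
        nlinarith
    _ = ε := by
        have h6 : δ ^ (1 - r) * δ ^ (r - 1) = 1 := by
          rw [← Real.rpow_add hδ0]; simp
        have h7 : δ * (I + 1) = ε / 2 := by rw [hδ]; field_simp
        linear_combination h7 + ε / 2 * h6

/-- Liouville's theorem for `L^p` functions that are weakly harmonic in some of the variables, on a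
set invariant under translations in those variables. -/
theorem integral_mul_test_eq_zero_of_weak_harmonic {p : ℝ≥0∞} (hp : 1 ≤ p) (hpt : p ≠ ⊤)
    (hf : MemLp f p) {n : ℕ} [NeZero n] (e : Fin n → Fin 4)
    (ℓ : EuclideanSpace ℝ (Fin n) →ₗᵢ[ℝ] R4)
    (hℓ : ∀ j, ℓ (EuclideanSpace.single j 1) = EuclideanSpace.single (e j) 1)
    (hO : ∀ x ∈ O, ∀ a, x + ℓ a ∈ O)
    (hweak : ∀ φ, IsTestOn O φ → ∫ x, f x * ∑ j, pd (e j) (pd (e j) φ) x = 0) :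
    ∀ φ, IsTestOn O φ → ∫ x, f x * φ x = 0 := by
  intro φ hφ
  have hfl : LocallyIntegrable f := hf.locallyIntegrable hp
  have hder : ∀ {θ : R4 → ℂ}, IsTestOn O θ → ∀ j a t, HasDerivAt
      (fun t : ℝ => transPair f θ (ℓ (a + t • EuclideanSpace.single j (1 : ℝ))))
      (-transPair f (pd (e j) θ) (ℓ (a + t • EuclideanSpace.single j (1 : ℝ)))) t := by
    intro θ hθ j a t
    obtain ⟨A, hA, hAj⟩ := hasFDerivAt_transPair hfl hθ
      (ℓ (a + t • EuclideanSpace.single j (1 : ℝ)))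
    have hl : HasDerivAt (fun t : ℝ => ℓ (a + t • EuclideanSpace.single j (1 : ℝ)))
        (EuclideanSpace.single (e j) (1 : ℝ)) t := by
      have e1 : (fun t : ℝ => ℓ (a + t • EuclideanSpace.single j (1 : ℝ))) =
          fun t : ℝ => ℓ a + t • EuclideanSpace.single (e j) (1 : ℝ) := by
        ext t : 1
        rw [map_add, map_smul, hℓ]
      rw [e1]
      simpa using ((hasDerivAt_id t).smul_const (EuclideanSpace.single (e j) (1 : ℝ))).const_add
        (ℓ a)
    have := hA.comp_hasDerivAt t hl
    rw [hAj] at this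
    exact this
  -- The maximum principle is applied to the pairing along the chosen variables only. Each
  -- derivative in the translation brings a minus sign, hence the sign in `F₁` and none in `F₂`.
  have hzero := eq_zero_of_harmonic_of_tendsto_zero (E := EuclideanSpace ℝ (Fin n))
    (F := fun a => transPair f φ (ℓ a)) (F₁ := fun j a => -transPair f (pd (e j) φ) (ℓ a))
    (F₂ := fun j a => transPair f (pd (e j) (pd (e j) φ)) (ℓ a))
    (v := fun j => EuclideanSpace.single j (1 : ℝ)) (fun j => by simp)
    ((continuous_transPair hfl hφ).comp ℓ.continuous)
    ((tendsto_transPair hp hpt hf hφ).comp ℓ.isometry.isClosedEmbedding.tendsto_cocompact)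
    (hder hφ) (fun j a t => by
      have := (hder (hφ.pderiv (e j)) j a t).neg
      rw [neg_neg] at this
      exact this) ?_ 0
  · simpa [transPair] using hzero
  · intro a
    -- Invariance of `O` makes the translate a test function on `O`, so the weak equation at `φa` is
    -- harmonicity of the pairing at `a`.
    set φa : R4 → ℂ := fun z => φ (z - ℓ a) with hφa
    have hpd : ∀ (θ : R4 → ℂ) j, pd j (fun z => θ (z - ℓ a)) = fun z => pd j θ (z - ℓ a) := by
      intro θ j
      ext z
      simp only [pd]
      rw [fderiv_comp_sub]
    have hta : IsTestOn O φa := by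
      refine ⟨hφ.1.comp (contDiff_id.sub contDiff_const),
        hφ.2.1.comp_homeomorph (Homeomorph.subRight (ℓ a)), fun z hz => ?_⟩
      have h1 : z - ℓ a ∈ tsupport φ :=
        tsupport_comp_subset_preimage φ (f := fun z => z - ℓ a) (by fun_prop) hz
      have h2 := hO _ (hφ.2.2 h1) a
      simpa using h2
    have h3 := hweak φa hta
    have hint : ∀ j, Integrable (fun z => f z * pd (e j) (pd (e j) φ) (z - ℓ a)) := by
      intro j
      have := integrable_mul_test hfl ((hta.pderiv (e j)).pderiv (e j)).1.continuous
        ((hta.pderiv (e j)).pderiv (e j)).2.1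
      simpa only [hφa, hpd] using this
    simp only [transPair]
    rw [← integral_finsetSum _ fun j _ => hint j, ← h3]
    congr 1
    ext z
    rw [Finset.mul_sum]
    simp only [hφa, hpd]

end Liouville

/-! ### The odd extensions of functions on the corner -/

section Extensions

lemma extO1_of_nonpos (f : R4 → ℂ) {x : R4} (h : x 3 ≤ 0) : extO1 f x = 0 := if_pos h

lemma extO1_of_mem (f : R4 → ℂ) {x : R4} (h : x ∈ cornerDomain) : extO1 f x = f x := by
  rw [extO1, if_neg (not_le.2 h.2), if_pos h.1]

lemma extO1_coordRefl (f : R4 → ℂ) (x : R4) : extO1 f (coordRefl 2 x) = -extO1 f x := by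
  have h2 : coordRefl 2 x 2 = -x 2 := by simp [coordRefl_apply]
  have h3 : coordRefl 2 x 3 = x 3 := by simp [coordRefl_apply]
  have hr : reflY1 (coordRefl 2 x) = x := by rw [← coordRefl_two, coordRefl_coordRefl]
  simp only [extO1, h2, h3, hr]
  split_ifs with a b c d e g <;> first | linarith | simp [coordRefl_two]

lemma extO12_coordRefl (f : R4 → ℂ) (x : R4) : extO12 f (coordRefl 3 x) = -extO12 f x := by
  simp only [extO12, ← coordRefl_three, coordRefl_coordRefl]
  ring

lemma extO12_of_pos (f : R4 → ℂ) {x : R4} (h : 0 < x 3) : extO12 f x = extO1 f x := by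
  rw [extO12, extO1_of_nonpos f (x := reflY2 x) (by simp [reflY2]; exact h.le), sub_zero]

lemma extO1_sub (f g : R4 → ℂ) (x : R4) :
    extO1 (fun x => f x - g x) x = extO1 f x - extO1 g x := by
  simp only [extO1]
  split_ifs <;> ring

lemma extO12_sub (f g : R4 → ℂ) (x : R4) :
    extO12 (fun x => f x - g x) x = extO12 f x - extO12 g x := by
  simp only [extO12, extO1_sub]
  ring

lemma MemLp.extO12 {f : R4 → ℂ} {p : ℝ≥0∞} (h : MemLp (extO1 f) p) : MemLp (extO12 f) p := by
  have h2 := h.comp_measurePreserving (measurePreserving_coordRefl 3)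
  have e : _root_.extO12 f = extO1 f - extO1 f ∘ coordRefl 3 := by
    ext x
    simp [_root_.extO12, coordRefl_three]
  rw [e]
  exact h.sub h2

lemma isOpen_cornerDomain : IsOpen cornerDomain := by
  have h1 : IsOpen {x : R4 | 0 < x 2} := isOpen_lt continuous_const (by fun_prop)
  have h2 : IsOpen {x : R4 | 0 < x 3} := isOpen_lt continuous_const (by fun_prop)
  exact h1.inter h2

lemma integral_extO1_mul (f : R4 → ℂ) {φ : R4 → ℂ} (hφ : tsupport φ ⊆ cornerDomain) :
    ∫ x, extO1 f x * φ x = ∫ x in cornerDomain, f x * φ x := by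
  rw [← integral_indicator isOpen_cornerDomain.measurableSet]
  congr 1
  ext x
  by_cases hx : x ∈ cornerDomain
  · rw [Set.indicator_of_mem hx, extO1_of_mem f hx]
  · rw [Set.indicator_of_notMem hx, image_eq_zero_of_notMem_tsupport fun h => hx (hφ h), mul_zero]

end Extensions

/-! ### Uniqueness -/

section Uniqueness

/-- The half-space `y₂ > 0`. -/
def upperHalf : Set R4 := {x | 0 < x 3}

lemma upperHalf_inter : upperHalf ∩ {x | 0 < x 2} = cornerDomain := by
  ext x
  exact and_comm

lemma coordRefl_mem_upperHalf (x : R4) (hx : x ∈ upperHalf) : coordRefl 2 x ∈ upperHalf := by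
  have : coordRefl 2 x 3 = x 3 := by simp [coordRefl_apply]
  change 0 < coordRefl 2 x 3
  rw [this]
  exact hx

lemma tendsto_slice_sub {i : Fin 4} {f g : R4 → ℂ} {q : ℝ≥0∞} (hq : 1 ≤ q)
    (hf : AEStronglyMeasurable f) (hg : AEStronglyMeasurable g)
    (h1 : Tendsto (fun t : ℝ => eLpNorm (fun s : R3 => f (insEquiv i (s, t))) q volume)
      (𝓝 0 ⊓ ae volume) (𝓝 0))
    (h2 : Tendsto (fun t : ℝ => eLpNorm (fun s : R3 => g (insEquiv i (s, t))) q volume)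
      (𝓝 0 ⊓ ae volume) (𝓝 0)) :
    Tendsto (fun t : ℝ => eLpNorm (fun s : R3 => f (insEquiv i (s, t)) - g (insEquiv i (s, t)))
      q volume) (𝓝 0 ⊓ ae volume) (𝓝 0) := by
  have h3 := h1.add h2
  rw [add_zero] at h3
  refine tendsto_of_tendsto_of_tendsto_of_le_of_le' tendsto_const_nhds h3
    (Eventually.of_forall fun t => zero_le) ?_
  have h4 := (aestronglyMeasurable_insEquiv i hf).and (aestronglyMeasurable_insEquiv i hg)
  filter_upwards [h4.filter_mono inf_le_right] with t ht
  exact eLpNorm_sub_le ht.1 ht.2 hq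

/-- `∂/∂z̄₂` does not differentiate in `y₁`, so it commutes with a cutoff in `y₁`. The equation
crosses `y₁ = 0` without error terms, and no vanishing of slices is involved. -/
lemma weak_dbar_of_odd {f v : R4 → ℂ} (hf : LocallyIntegrable f) (hv : LocallyIntegrable v)
    (hfo : ∀ x, f (coordRefl 2 x) = -f x) (hvo : ∀ x, v (coordRefl 2 x) = -v x)
    (hweak : ∀ φ, IsTestOn cornerDomain φ → ∫ x, f x * dbar2 φ x = -∫ x, v x * φ x) :
    ∀ φ, IsTestOn upperHalf φ → ∫ x, f x * dbar2 φ x = -∫ x, v x * φ x := by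
  intro φ hφ
  set ψ : R4 → ℂ := fun x => φ x - φ (coordRefl 2 x) with hψ
  have hr := hφ.comp_refl 2 coordRefl_mem_upperHalf
  have hψt : IsTestOn upperHalf ψ := isTestOn_antisymm hφ coordRefl_mem_upperHalf
  have d1 := hφ.1.differentiable_infty
  have d2 := hr.1.differentiable_infty
  have hdbar : ∀ x, dbar2 φ x - dbar2 φ (coordRefl 2 x) = dbar2 ψ x := by
    intro x
    rw [dbar2_eq, dbar2_eq, dbar2_eq, pd_sub d1 d2, pd_sub d1 d2, pd_comp_refl d1,
      pd_comp_refl d1]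
    simp
    ring
  have hif : ∀ {θ}, IsTestOn upperHalf θ → Integrable (fun x => f x * θ x) := fun h =>
    integrable_mul_test hf h.1.continuous h.2.1
  have hiv : ∀ {θ}, IsTestOn upperHalf θ → Integrable (fun x => v x * θ x) := fun h =>
    integrable_mul_test hv h.1.continuous h.2.1
  rw [integral_mul_eq_of_odd hfo (hif hφ.dbar), integral_mul_eq_of_odd hvo (hiv hφ)]
  simp only [hdbar]
  refine tendsto_nhds_unique (tendsto_integral_cutoff_mul 2 (hif hψt.dbar)) ?_
  refine (tendsto_integral_cutoff_mul 2 (hiv hψt)).neg.congr' ?_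
  filter_upwards [eventually_gt_atTop 0] with n hn
  have hcut := hψt.cutoff_mul (i := 2) hn
  rw [upperHalf_inter] at hcut
  have h0 := hweak _ hcut
  have hd : ∀ x, dbar2 (fun x => coordCutoff 2 n x * ψ x) x = coordCutoff 2 n x * dbar2 ψ x := by
    intro x
    have c := (contDiff_coordCutoff 2 n).differentiable_infty
    have dψ := hψt.1.differentiable_infty
    rw [dbar2_eq, pd_mul c dψ, pd_mul c dψ, pd_coordCutoff, pd_coordCutoff, dbar2_eq]
    simp
    ring
  simp only [hd] at h0
  have e1 : ∫ x, coordCutoff 2 n x * (f x * dbar2 ψ x) = ∫ x, f x * (coordCutoff 2 n x * dbar2 ψ x) := by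
    congr 1; ext x; ring
  have e2 : ∫ x, coordCutoff 2 n x * (v x * ψ x) = ∫ x, v x * (coordCutoff 2 n x * ψ x) := by
    congr 1; ext x; ring
  rw [e1, e2, h0]

/-- The embedding of the `(x₁, y₁)`-plane. -/
noncomputable def planeIsometry : EuclideanSpace ℝ (Fin 2) →ₗᵢ[ℝ] R4 where
  toFun a := !₂[a 0, 0, a 1, 0]
  map_add' a b := by
    ext j
    fin_cases j <;> simp
  map_smul' c a := by
    ext j
    fin_cases j <;> simp
  norm_map' a := by
    simp [EuclideanSpace.norm_eq, Fin.sum_univ_four]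

lemma planeIsometry_apply (a : EuclideanSpace ℝ (Fin 2)) :
    planeIsometry a = !₂[a 0, 0, a 1, 0] := rfl

lemma planeIsometry_single (j : Fin 2) : planeIsometry (EuclideanSpace.single j 1) =
    EuclideanSpace.single ((![0, 2] : Fin 2 → Fin 4) j) 1 := by
  rw [planeIsometry_apply]
  ext k
  fin_cases j <;> fin_cases k <;> simp

lemma ae_eq_zero_of_test {O : Set R4} (hO : IsOpen O) {f : R4 → ℂ} (hf : LocallyIntegrable f)
    (h : ∀ φ, IsTestOn O φ → ∫ x, f x * φ x = 0) : ∀ᵐ x, x ∈ O → f x = 0 := by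
  refine hO.ae_eq_zero_of_integral_contDiff_smul_eq_zero (hf.locallyIntegrableOn O) ?_
  intro g hg hgc hgs
  have hsup : Function.support (fun x => (g x : ℂ)) = Function.support g := by
    ext x; simp
  have ht : IsTestOn O (fun x => (g x : ℂ)) := by
    refine ⟨Complex.ofRealCLM.contDiff.comp hg, hgc.comp_left Complex.ofReal_zero, ?_⟩
    rw [tsupport, hsup]
    exact hgs
  rw [← h _ ht]
  congr 1
  ext x
  rw [Complex.real_smul, mul_comm]

theorem ae_eq_of_isMixedSolution {g : R4 → ℂ} {p q r : ℝ≥0∞} (hp : 1 ≤ p) (hpt : p ≠ ⊤)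
    (hq : 1 ≤ q) (hr : 1 ≤ r) {w u : R4 → ℂ} (hw : IsMixedSolution g p q r w)
    (hu : IsMixedSolution g p q r u) : extO1 w =ᵐ[volume] extO1 u := by
  obtain ⟨hw1, hw2, hw3, vw, hw4, hw5, hw6⟩ := hw
  obtain ⟨hu1, hu2, hu3, vu, hu4, hu5, hu6⟩ := hu
  set f : R4 → ℂ := extO1 (fun x => w x - u x) with hfdef
  set v : R4 → ℂ := fun x => vw x - vu x with hvdef
  have hfe : f = fun x => extO1 w x - extO1 u x := funext (extO1_sub w u)
  have hve : extO1 v = fun x => extO1 vw x - extO1 vu x := funext (extO1_sub vw vu)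
  have hVe : extO12 v = fun x => extO12 vw x - extO12 vu x := funext (extO12_sub vw vu)
  have hfp : MemLp f p := by rw [hfe]; exact hw1.sub hu1
  have hvp : MemLp (extO1 v) p := by rw [hve]; exact hw5.sub hu5
  have hVp : MemLp (extO12 v) p := MemLp.extO12 hvp
  have hfl := hfp.locallyIntegrable hp
  have hvl := hvp.locallyIntegrable hp
  have hVl := hVp.locallyIntegrable hp
  have hsub : ∀ (a b : R4 → ℂ) {θ}, MemLp (extO1 a) p → MemLp (extO1 b) p →
      IsTestOn cornerDomain θ → ∫ x, (extO1 a x - extO1 b x) * θ x =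
      (∫ x in cornerDomain, a x * θ x) - ∫ x in cornerDomain, b x * θ x := by
    intro a b θ ha hb hθ
    rw [← integral_extO1_mul a hθ.2.2, ← integral_extO1_mul b hθ.2.2, ← integral_sub
      (integrable_mul_test (ha.locallyIntegrable hp) hθ.1.continuous hθ.2.1)
      (integrable_mul_test (hb.locallyIntegrable hp) hθ.1.continuous hθ.2.1)]
    simp only [sub_mul]
  have harm : ∀ φ, IsTestOn upperHalf φ → ∫ x, f x * lap φ x = 0 := by
    refine weak_lap_of_odd (i := 2) hq hfl coordRefl_mem_upperHalf (extO1_coordRefl _) ?_ ?_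
    · have h1 : VanishesAtY1 (extO1 w) q := hw3
      have h2 : VanishesAtY1 (extO1 u) q := hu3
      simp only [VanishesAtY1, ← insEquiv_two] at h1 h2
      rw [hfe]
      exact tendsto_slice_sub hq hw1.1 hu1.1 h1 h2
    · intro φ hφ
      rw [upperHalf_inter] at hφ
      rw [hfe, hsub w u hw1 hu1 hφ.laplace, ← laplacian_eq_lap hφ.1, hw2 φ hφ, hu2 φ hφ, sub_self]
  have hdbar : ∀ φ, IsTestOn upperHalf φ → ∫ x, f x * dbar2 φ x = -∫ x, extO12 v x * φ x := by
    intro φ hφ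
    have h1 := weak_dbar_of_odd hfl hvl (extO1_coordRefl _) (extO1_coordRefl _) (by
      intro φ hφ
      rw [hfe, hve, hsub w u hw1 hu1 hφ.dbar, hsub vw vu hw5 hu5 hφ, hw4 φ hφ, hu4 φ hφ]
      ring) φ hφ
    rw [h1]
    congr 2
    ext x
    by_cases hx : x ∈ upperHalf
    · rw [extO12_of_pos v hx]
    · rw [image_eq_zero_of_notMem_tsupport fun h => hx (hφ.2.2 h), mul_zero, mul_zero]
  -- On `y₂ > 0` this is harmonicity of `f` tested against `dbar2 φ`, as the two operators commute.
  -- The trace condition on `y₂ = 0` then carries it across for the odd extension.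
  have hVharm : ∀ φ, IsTestOn Set.univ φ → ∫ x, extO12 v x * lap φ x = 0 := by
    refine weak_lap_of_odd (i := 3) hr hVl (fun _ _ => Set.mem_univ _) (extO12_coordRefl _) ?_ ?_
    · have h1 : VanishesAtY2 (extO12 vw) r := hw6
      have h2 : VanishesAtY2 (extO12 vu) r := hu6
      simp only [VanishesAtY2, ← insEquiv_three] at h1 h2
      rw [hVe]
      exact tendsto_slice_sub hr (MemLp.extO12 hw5).1 (MemLp.extO12 hu5).1 h1 h2
    · intro φ hφ
      rw [Set.univ_inter] at hφ
      have hφ : IsTestOn upperHalf φ := hφ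
      have h1 := hdbar _ hφ.laplace
      have h2 : dbar2 (lap φ) = lap (dbar2 φ) := funext fun x => (lap_dbar2 hφ.1 x).symm
      rw [h2, harm _ hφ.dbar] at h1
      exact neg_eq_zero.1 h1.symm
  have hVzero : ∀ φ, IsTestOn Set.univ φ → ∫ x, extO12 v x * φ x = 0 :=
    integral_mul_test_eq_zero_of_weak_harmonic hp hpt hVp (n := 4) id LinearIsometry.id
      (fun j => rfl) (fun _ _ _ => Set.mem_univ _) hVharm
  have hdz : ∀ φ, IsTestOn upperHalf φ → ∫ x, f x * dbar2 φ x = 0 := by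
    intro φ hφ
    rw [hdbar φ hφ, hVzero φ (hφ.mono (Set.subset_univ _)), neg_zero]
  -- Translations along the `(x₁, y₁)`-plane preserve `y₂ > 0`, so Liouville's theorem applies in
  -- these two variables.
  have hfz : ∀ φ, IsTestOn upperHalf φ → ∫ x, f x * φ x = 0 := by
    refine integral_mul_test_eq_zero_of_weak_harmonic hp hpt hfp (![0, 2] : Fin 2 → Fin 4)
      planeIsometry planeIsometry_single ?_ ?_
    · intro x hx a
      have hx : 0 < x 3 := hx
      change 0 < (x + planeIsometry a) 3
      simpa [planeIsometry_apply] using hx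
    · intro φ hφ
      -- `θ` is `4 ∂φ/∂z₂`, so that `dbar2 θ` is the Laplacian of `φ` in `(x₂, y₂)`. Subtracting its
      -- vanishing pairing from that of the full Laplacian leaves the variables `(x₁, y₁)`.
      set θ : R4 → ℂ := fun x => 2 * (pd 1 φ x - Complex.I * pd 3 φ x) with hθ
      have hθt : IsTestOn upperHalf θ :=
        ((hφ.pderiv 1).sub ((hφ.pderiv 3).const_mul Complex.I)).const_mul 2
      have d1 := (hφ.pderiv 1).1.differentiable_infty
      have d3 := (hφ.pderiv 3).1.differentiable_infty
      have hθd : ∀ x, dbar2 θ x = pd 1 (pd 1 φ) x + pd 3 (pd 3 φ) x := by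
        intro x
        have e : ∀ j, pd j θ x = 2 * (pd j (pd 1 φ) x - Complex.I * pd j (pd 3 φ) x) := by
          intro j
          rw [hθ, pd_const_mul (d1.fun_sub (d3.const_mul _)), pd_sub d1 (d3.const_mul _),
            pd_const_mul d3]
        rw [dbar2_eq, e, e, pd_comm hφ.1 3 1]
        linear_combination (-pd 3 (pd 3 φ) x) * Complex.I_sq
      have h1 := harm φ hφ
      have h2 := hdz θ hθt
      have i1 := integrable_mul_test hfl hφ.laplace.1.continuous hφ.laplace.2.1
      have i2 := integrable_mul_test hfl hθt.dbar.1.continuous hθt.dbar.2.1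
      rw [← sub_eq_zero.2 (h1.trans h2.symm), ← integral_sub i1 i2]
      congr 1
      ext x
      rw [hθd, lap, Fin.sum_univ_two, Fin.sum_univ_four]
      simp
      ring
  have hopen : IsOpen upperHalf := isOpen_lt continuous_const (by fun_prop)
  filter_upwards [ae_eq_zero_of_test hopen hfl hfz] with x hx
  by_cases h3 : x ∈ upperHalf
  · have := hx h3
    rw [hfe] at this
    exact sub_eq_zero.1 this
  · rw [extO1_of_nonpos w (not_lt.1 h3), extO1_of_nonpos u (not_lt.1 h3)]

end Uniqueness

/-! ### Integrable product weights and Schwartz decay -/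

lemma integrable_of_even {f : ℝ → ℝ} (he : ∀ t, f (-t) = f t) (hf : IntegrableOn f (Set.Ioi 0)) :
    Integrable f := by
  rw [← integrableOn_univ, ← Set.Iic_union_Ioi (a := (0 : ℝ))]
  refine IntegrableOn.union ?_ hf
  have h1 : IntegrableOn f (Set.Ici (-0)) := by
    rw [neg_zero]
    exact (integrableOn_Ici_iff_integrableOn_Ioi (by simp)).2 hf
  have h2 := h1.comp_neg_Iic
  exact h2.congr_fun (fun t _ => he t) measurableSet_Iic

lemma integrable_abs_rpow_mul {a b : ℝ} (ha : a < 1) (hab : 1 < a + b) :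
    Integrable (fun t : ℝ => |t| ^ (-a) * (1 + |t|) ^ (-b)) := by
  refine integrable_of_even (fun t => by rw [abs_neg]) ?_
  have hm : Measurable (fun t : ℝ => |t| ^ (-a) * (1 + |t|) ^ (-b)) := by fun_prop
  rw [← Set.Ioc_union_Ioi_eq_Ioi (zero_le_one' ℝ)]
  refine IntegrableOn.union ?_ ?_
  · have h := (intervalIntegral.intervalIntegrable_rpow' (a := 0) (b := 1)
      (r := -a) (by linarith)).1
    refine Integrable.mono' h hm.aestronglyMeasurable ?_
    filter_upwards [ae_restrict_mem measurableSet_Ioc] with t ht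
    have ht0 : 0 < t := ht.1
    rw [abs_of_pos ht0, Real.norm_of_nonneg (by positivity)]
    refine mul_le_of_le_one_right (by positivity) ?_
    exact Real.rpow_le_one_of_one_le_of_nonpos (by linarith) (by linarith)
  · have h := integrableOn_Ioi_rpow_of_lt (a := -(a + b)) (by linarith) (zero_lt_one' ℝ)
    refine Integrable.mono' h hm.aestronglyMeasurable ?_
    filter_upwards [ae_restrict_mem measurableSet_Ioi] with t ht
    have ht0 : 0 < t := lt_trans one_pos ht
    rw [abs_of_pos ht0, Real.norm_of_nonneg (by positivity), neg_add, Real.rpow_add ht0]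
    refine mul_le_mul_of_nonneg_left ?_ (by positivity)
    exact Real.rpow_le_rpow_of_nonpos ht0 (by linarith) (by linarith)

lemma integrable_inv_one_add_abs_pow {n : ℕ} (hn : 2 ≤ n) :
    Integrable (fun t : ℝ => ((1 + |t|) ^ n)⁻¹) := by
  have h := integrable_abs_rpow_mul (a := 0) (b := n) one_pos
    (by rw [zero_add]; exact_mod_cast hn)
  refine h.congr (Eventually.of_forall fun t => ?_)
  have : 0 ≤ 1 + |t| := by positivity
  simp [Real.rpow_neg this]

lemma integrable_prod_coord {n : ℕ} {f : Fin n → ℝ → ℝ} (hf : ∀ j, Integrable (f j)) :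
    Integrable (fun s : EuclideanSpace ℝ (Fin n) => ∏ j, f j (s j)) := by
  have h := Integrable.fintype_prod (μ := fun _ : Fin n => (volume : Measure ℝ)) hf
  exact (EuclideanSpace.volume_preserving_symm_measurableEquiv_toLp (Fin n)).integrable_comp_of_integrable h

lemma abs_coord_le_norm {n : ℕ} (x : EuclideanSpace ℝ (Fin n)) (j : Fin n) : |x j| ≤ ‖x‖ := by
  simpa using PiLp.norm_apply_le x j

/-- Each factor `1 + |x j|` is at most `1 + ‖x‖`, so radial decay of order `n m` suffices. The
product form reduces later integrability questions to one variable. -/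
lemma exists_schwartz_bound {n : ℕ} (G : 𝓢(EuclideanSpace ℝ (Fin n), ℂ)) (m : ℕ) :
    ∃ C : ℝ, 0 ≤ C ∧ ∀ x, ‖G x‖ ≤ C * ∏ j, ((1 + |x j|) ^ m)⁻¹ := by
  refine ⟨2 ^ (n * m) * (Finset.Iic (n * m, 0)).sup
    (fun m => SchwartzMap.seminorm ℝ m.1 m.2) G, by positivity, fun x => ?_⟩
  have h := SchwartzMap.one_add_le_sup_seminorm_apply (𝕜 := ℝ) (m := (n * m, 0)) (k := n * m)
    (n := 0) le_rfl le_rfl G x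
  rw [norm_iteratedFDeriv_zero] at h
  have h1 : ∏ j, (1 + |x j|) ^ m ≤ (1 + ‖x‖) ^ (n * m) := by
    calc ∏ j, (1 + |x j|) ^ m ≤ ∏ _j : Fin n, (1 + ‖x‖) ^ m := by
          refine Finset.prod_le_prod (fun j _ => by positivity) fun j _ => ?_
          have := abs_coord_le_norm x j
          gcongr
      _ = (1 + ‖x‖) ^ (n * m) := by
          rw [Finset.prod_const, Finset.card_univ, Fintype.card_fin, ← pow_mul, mul_comm]
  have h0 : 0 < ∏ j, (1 + |x j|) ^ m := Finset.prod_pos fun j _ => by positivity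
  rw [Finset.prod_inv_distrib, ← div_eq_mul_inv, le_div_iff₀ h0, mul_comm]
  exact (mul_le_mul_of_nonneg_right h1 (norm_nonneg _)).trans h

/-! ### Bounds for the sine transform -/

lemma norm_exp_neg_sub_exp_le (r : ℝ) :
    ‖Complex.exp (-Complex.I * (r : ℂ)) - Complex.exp (Complex.I * (r : ℂ))‖ ≤ 2 * |r| := by
  have e : Complex.exp (-Complex.I * (r : ℂ)) - Complex.exp (Complex.I * (r : ℂ))
      = ((2 * Real.sin r : ℝ) : ℂ) * (-Complex.I) := by
    push_cast
    rw [Complex.sin]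
    rw [show Complex.I * (r : ℂ) = r * Complex.I by ring,
      show -Complex.I * (r : ℂ) = -r * Complex.I by ring]
    linear_combination (Complex.exp (-r * Complex.I) - Complex.exp (r * Complex.I)) *
      Complex.I_sq
  rw [e, norm_mul, norm_neg, Complex.norm_I, mul_one, Complex.norm_real, norm_mul,
    Real.norm_two, Real.norm_eq_abs]
  have := Real.abs_sin_le_abs (x := r)
  linarith

/-- The constant `∫ (1 + |t|)⁻² dt`. -/
noncomputable def decayConst : ℝ := ∫ t : ℝ, ((1 + |t|) ^ 2)⁻¹

lemma decayConst_nonneg : 0 ≤ decayConst := integral_nonneg fun t => by positivity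

lemma setIntegral_inv_sq_le : ∫ t in Set.Ioi (0 : ℝ), ((1 + |t|) ^ 2)⁻¹ ≤ decayConst :=
  setIntegral_le_integral (integrable_inv_one_add_abs_pow le_rfl)
    (Eventually.of_forall fun t => by positivity)

/-- The sine transform of a function with integrable derivative vanishes at `0` and decays. -/
lemma norm_sine_transform_le {h h' : ℝ → ℂ} {A : ℝ} (hd : ∀ y, HasDerivAt h (h' y) y)
    (hc : Continuous h')
    (b0 : ∀ y, ‖h y‖ ≤ A * ((1 + |y|) ^ 3)⁻¹) (b1 : ∀ y, ‖h' y‖ ≤ A * ((1 + |y|) ^ 3)⁻¹) (η : ℝ) :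
    ‖∫ y in Set.Ioi (0 : ℝ), h y * (Complex.exp (-Complex.I * ((y * η : ℝ) : ℂ)) -
      Complex.exp (Complex.I * ((y * η : ℝ) : ℂ)))‖
      ≤ 8 * (1 + decayConst) * A * (|η| / (1 + |η|) ^ 2) := by
  have hA : 0 ≤ A := by simpa using (norm_nonneg _).trans (b0 0)
  have hcont : Continuous h := continuous_iff_continuousAt.2 fun y => (hd y).continuousAt
  have hJ := decayConst_nonneg
  set I := ∫ y in Set.Ioi (0 : ℝ), h y * (Complex.exp (-Complex.I * ((y * η : ℝ) : ℂ)) -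
      Complex.exp (Complex.I * ((y * η : ℝ) : ℂ))) with hI
  have hint2 : IntegrableOn (fun t : ℝ => ((1 + |t|) ^ 2)⁻¹) (Set.Ioi 0) :=
    (integrable_inv_one_add_abs_pow le_rfl).integrableOn
  have hint3 : IntegrableOn (fun t : ℝ => ((1 + |t|) ^ 3)⁻¹) (Set.Ioi 0) :=
    (integrable_inv_one_add_abs_pow (by norm_num)).integrableOn
  have h32 : ∀ t : ℝ, ((1 + |t|) ^ 3)⁻¹ ≤ ((1 + |t|) ^ 2)⁻¹ := fun t => by
    have : 1 ≤ 1 + |t| := by linarith [abs_nonneg t]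
    gcongr
    norm_num
  have hn : ∀ r : ℝ, ‖Complex.exp (-Complex.I * (r : ℂ))‖ = 1 := fun r => by
    have := norm_exp_I_mul_ofReal (-r)
    rwa [Complex.ofReal_neg, mul_neg, ← neg_mul] at this
  -- For small `|η|`: the sine is at most its argument, and the third power in the decay of `h` pays
  -- for the factor `|y|`.
  have e1 : ‖I‖ ≤ 2 * (1 + decayConst) * A * |η| := by
    have : ‖I‖ ≤ ∫ y in Set.Ioi (0 : ℝ), 2 * A * |η| * ((1 + |y|) ^ 2)⁻¹ := by
      refine norm_integral_le_of_norm_le (hint2.const_mul _) (Eventually.of_forall fun y => ?_)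
      rw [norm_mul]
      calc _ ≤ (A * ((1 + |y|) ^ 3)⁻¹) * (2 * |y * η|) :=
            mul_le_mul (b0 y) (norm_exp_neg_sub_exp_le _) (norm_nonneg _) (by positivity)
        _ = (2 * A * |η|) * (|y| * ((1 + |y|) ^ 3)⁻¹) := by rw [abs_mul]; ring
        _ ≤ _ := by
          refine mul_le_mul_of_nonneg_left ?_ (by positivity)
          rw [← div_eq_mul_inv, div_le_iff₀ (by positivity)]
          have : 0 < 1 + |y| := by positivity
          field_simp
          linarith
    rw [integral_const_mul] at this
    refine this.trans ?_
    have h1 := mul_le_mul_of_nonneg_left setIntegral_inv_sq_le (show 0 ≤ 2 * A * |η| by positivity)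
    nlinarith [mul_nonneg hA (abs_nonneg η)]
  -- For large `|η|`: one integration by parts. The boundary term `h 0 * E 0` need not vanish, so
  -- only one power of `η` is gained.
  have e2 : |η| * ‖I‖ ≤ 2 * (1 + decayConst) * A := by
    set E : ℝ → ℂ := fun y => Complex.exp (-Complex.I * ((y * η : ℝ) : ℂ)) +
      Complex.exp (Complex.I * ((y * η : ℝ) : ℂ)) with hE
    set D : ℝ → ℂ := fun y => Complex.exp (-Complex.I * ((y * η : ℝ) : ℂ)) -
      Complex.exp (Complex.I * ((y * η : ℝ) : ℂ)) with hD
    have hEd : ∀ y, HasDerivAt E (-Complex.I * η * D y) y := fun y => by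
      have hlin : HasDerivAt (fun y : ℝ => ((y * η : ℝ) : ℂ)) (η : ℂ) y := by
        have := ((hasDerivAt_id y).mul_const η).ofReal_comp
        simpa using this
      exact ((hlin.const_mul (-Complex.I)).cexp.add (hlin.const_mul Complex.I).cexp).congr_deriv
        (by simp only [hD]; ring)
    have hEn : ∀ y, ‖E y‖ ≤ 2 := fun y => by
      refine (norm_add_le _ _).trans ?_
      rw [hn, norm_exp_I_mul_ofReal]; norm_num
    have hDn : ∀ y, ‖D y‖ ≤ 2 := fun y => by
      refine (norm_sub_le _ _).trans ?_
      rw [hn, norm_exp_I_mul_ofReal]; norm_num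
    have hEc : Continuous E := by simp only [hE]; fun_prop
    have hDc : Continuous D := by simp only [hD]; fun_prop
    have i1 : IntegrableOn (fun y => h' y * E y) (Set.Ioi 0) := by
      refine Integrable.mono' (hint3.const_mul (A * 2)) (by fun_prop)
        (Eventually.of_forall fun y => ?_)
      rw [norm_mul]
      have := mul_le_mul (b1 y) (hEn y) (norm_nonneg _) (by positivity)
      linarith
    have i2 : IntegrableOn (fun y => h y * D y) (Set.Ioi 0) := by
      refine Integrable.mono' (hint3.const_mul (A * 2)) (by fun_prop)
        (Eventually.of_forall fun y => ?_)
      rw [norm_mul]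
      have := mul_le_mul (b0 y) (hDn y) (norm_nonneg _) (by positivity)
      linarith
    have hlim : Tendsto (fun y => h y * E y) atTop (𝓝 0) := by
      have h0 : Tendsto (fun y : ℝ => A * 2 * (1 + |y|)⁻¹) atTop (𝓝 0) := by
        have : Tendsto (fun y : ℝ => (1 + |y|)⁻¹) atTop (𝓝 0) :=
          (tendsto_atTop_add_const_left _ _ tendsto_abs_atTop_atTop).inv_tendsto_atTop
        simpa using this.const_mul (A * 2)
      refine squeeze_zero_norm (fun y => ?_) h0
      rw [norm_mul]
      have h1 := mul_le_mul (b0 y) (hEn y) (norm_nonneg _) (by positivity)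
      have h2 : ((1 + |y|) ^ 3)⁻¹ ≤ (1 + |y|)⁻¹ := by
        have : 1 ≤ 1 + |y| := by linarith [abs_nonneg y]
        gcongr
        exact le_self_pow₀ this (by norm_num)
      nlinarith
    have ftc := integral_Ioi_of_hasDerivAt_of_tendsto (a := 0) (f := fun y => h y * E y)
      (f' := fun y => h' y * E y + -Complex.I * η * (h y * D y))
      (hcont.mul hEc).continuousWithinAt
      (fun y _ => ((hd y).mul (hEd y)).congr_deriv (by ring)) (i1.add (i2.const_mul _)) hlim
    rw [integral_add i1 (i2.const_mul _), integral_const_mul] at ftc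
    have hI2 : Complex.I * η * I = (∫ y in Set.Ioi (0 : ℝ), h' y * E y) + h 0 * E 0 := by
      have : I = ∫ y in Set.Ioi (0 : ℝ), h y * D y := rfl
      rw [this]
      linear_combination -ftc
    have hJ1 : ‖∫ y in Set.Ioi (0 : ℝ), h' y * E y‖ ≤ 2 * A * decayConst := by
      have : ‖∫ y in Set.Ioi (0 : ℝ), h' y * E y‖
          ≤ ∫ y in Set.Ioi (0 : ℝ), 2 * A * ((1 + |y|) ^ 2)⁻¹ := by
        refine norm_integral_le_of_norm_le (hint2.const_mul _) (Eventually.of_forall fun y => ?_)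
        rw [norm_mul]
        have := mul_le_mul (b1 y) (hEn y) (norm_nonneg _) (by positivity)
        have := mul_le_mul_of_nonneg_left (h32 y) hA
        linarith
      rw [integral_const_mul] at this
      exact this.trans (mul_le_mul_of_nonneg_left setIntegral_inv_sq_le (by positivity))
    have hJ2 : ‖h 0 * E 0‖ ≤ 2 * A := by
      rw [norm_mul]
      have := mul_le_mul (b0 0) (hEn 0) (norm_nonneg _) (by positivity)
      simp only [abs_zero, add_zero, one_pow, inv_one, mul_one] at this
      linarith
    have hfin := norm_add_le (∫ y in Set.Ioi (0 : ℝ), h' y * E y) (h 0 * E 0)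
    rw [← hI2, norm_mul, norm_mul, Complex.norm_I, one_mul, Complex.norm_real,
      Real.norm_eq_abs] at hfin
    linarith
  set X := 2 * (1 + decayConst) * A with hX
  have hX0 : 0 ≤ X := by positivity
  rw [← mul_div_assoc, le_div_iff₀ (by positivity)]
  have h8 : 8 * (1 + decayConst) * A * |η| = 4 * (X * |η|) := by rw [hX]; ring
  rw [h8]
  -- The factor `4` comes from `(1 + |η|)² ≤ 4` in the first range and `(1 + |η|)² ≤ 4 |η|²` in the
  -- second.
  rcases le_total |η| 1 with h1 | h1
  · have : (1 + |η|) ^ 2 ≤ 4 := by nlinarith [abs_nonneg η]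
    nlinarith [norm_nonneg I, mul_le_mul_of_nonneg_left this (norm_nonneg I)]
  · have h2 : (1 + |η|) ^ 2 ≤ 4 * |η| ^ 2 := by nlinarith
    have h3 := mul_le_mul_of_nonneg_left h2 (norm_nonneg I)
    have h4 := mul_le_mul_of_nonneg_left e2 (abs_nonneg η)
    nlinarith

/-! ### The partially transformed source and its decay -/

/-- The extension of `G` which is odd in `y₁`. -/
noncomputable def oddExt (G : R4 → ℂ) (x : R4) : ℂ :=
  if 0 < x 2 then G x else if x 2 < 0 then -G (reflY1 x) else 0

/-- The Fourier transform in `(x₁, x₂, y₁)` of the odd extension, at height `y₂ = t`. -/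
noncomputable def src (G : R4 → ℂ) (k : R3) (t : ℝ) : ℂ :=
  osc (fun s : R3 => oddExt G (insEquiv (3 : Fin 4) (s, t))) (-k)

lemma inner_R3 (a b : R3) : inner ℝ a b = a 0 * b 0 + a 1 * b 1 + a 2 * b 2 := by
  simp [PiLp.inner_apply, Fin.sum_univ_three, mul_comm]

lemma measurable_reflY1 : Measurable reflY1 := by
  have : reflY1 = coordRefl 2 := funext fun x => (coordRefl_two x).symm
  rw [this]
  exact (coordRefl 2).continuous.measurable

lemma measurable_oddExt {G : R4 → ℂ} (hG : Measurable G) : Measurable (oddExt G) := by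
  have m1 : MeasurableSet {x : R4 | 0 < x 2} := measurableSet_coord_pos 2
  have m2 : MeasurableSet {x : R4 | x 2 < 0} :=
    measurableSet_lt (by fun_prop) measurable_const
  exact Measurable.ite m1 hG (Measurable.ite m2 (hG.comp measurable_reflY1).neg measurable_const)

lemma norm_oddExt_le {G : R4 → ℂ} {w : R4 → ℝ} (hw : ∀ x, ‖G x‖ ≤ w x)
    (hs : ∀ x, w (reflY1 x) = w x) (x : R4) : ‖oddExt G x‖ ≤ w x := by
  unfold oddExt
  split_ifs
  · exact hw x
  · rw [norm_neg, ← hs]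
    exact hw _
  · rw [norm_zero]
    exact (norm_nonneg _).trans (hw x)

lemma exists_oddExt_bound (G : 𝓢(R4, ℂ)) (m : ℕ) :
    ∃ C : ℝ, 0 ≤ C ∧ ∀ x, ‖oddExt G x‖ ≤ C * ∏ j, ((1 + |x j|) ^ m)⁻¹ := by
  obtain ⟨C, hC, hb⟩ := exists_schwartz_bound G m
  refine ⟨C, hC, norm_oddExt_le hb fun x => ?_⟩
  simp [Fin.prod_univ_four, reflY1]

lemma exists_oddExt_slice_bound (G : 𝓢(R4, ℂ)) (m : ℕ) :
    ∃ C : ℝ, 0 ≤ C ∧ ∀ (s : R3) (t : ℝ), ‖oddExt G (insEquiv (3 : Fin 4) (s, t))‖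
      ≤ C * ((1 + |t|) ^ m)⁻¹ * ∏ j, ((1 + |s j|) ^ m)⁻¹ := by
  obtain ⟨C, hC, hb⟩ := exists_oddExt_bound G m
  refine ⟨C, hC, fun s t => (hb _).trans (le_of_eq ?_)⟩
  simp [Fin.prod_univ_four, Fin.prod_univ_three, insEquiv_three]
  ring

lemma integrable_decay {n m : ℕ} (hm : 2 ≤ m) :
    Integrable (fun s : EuclideanSpace ℝ (Fin n) => ∏ j, ((1 + |s j|) ^ m)⁻¹) :=
  integrable_prod_coord fun _ => integrable_inv_one_add_abs_pow hm

lemma measurable_oddExt_slice (G : 𝓢(R4, ℂ)) :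
    Measurable (fun p : R3 × ℝ => oddExt G (insEquiv (3 : Fin 4) p)) :=
  (measurable_oddExt G.continuous.measurable).comp (insEquiv 3).measurable

lemma integrable_oddExt_slice (G : 𝓢(R4, ℂ)) (t : ℝ) :
    Integrable (fun s : R3 => oddExt G (insEquiv (3 : Fin 4) (s, t))) := by
  obtain ⟨C, hC, hb⟩ := exists_oddExt_slice_bound G 2
  refine Integrable.mono' ((integrable_decay le_rfl).const_mul (C * ((1 + |t|) ^ 2)⁻¹)) ?_
    (Eventually.of_forall fun s => hb s t)
  exact ((measurable_oddExt_slice G).comp measurable_prodMk_right).aestronglyMeasurable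

lemma measurable_src (G : 𝓢(R4, ℂ)) : Measurable (fun p : R3 × ℝ => src G p.1 p.2) := by
  unfold src osc
  have : StronglyMeasurable (fun q : (R3 × ℝ) × R3 =>
      oddExt G (insEquiv (3 : Fin 4) (q.2, q.1.2)) *
        Complex.exp (Complex.I * ((inner ℝ (-q.1.1) q.2 : ℝ) : ℂ))) := by
    refine Measurable.stronglyMeasurable (Measurable.mul ?_ (by fun_prop))
    exact (measurable_oddExt_slice G).comp
      (measurable_snd.prodMk (measurable_snd.comp measurable_fst))
  exact (this.integral_prod_right (ν := (volume : Measure R3))).measurable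

/-- The odd extension turns the Fourier transform into a sine transform. -/
lemma src_eq (G : 𝓢(R4, ℂ)) (k : R3) (t : ℝ) :
    src G k t = ∫ a : EuclideanSpace ℝ (Fin 2),
      Complex.exp (-Complex.I * ((a 0 * k 0 + a 1 * k 1 : ℝ) : ℂ)) *
        ∫ y in Set.Ioi (0 : ℝ), G !₂[a 0, a 1, y, t] *
          (Complex.exp (-Complex.I * ((y * k 2 : ℝ) : ℂ)) -
            Complex.exp (Complex.I * ((y * k 2 : ℝ) : ℂ))) := by
  unfold src osc
  have hint : Integrable (fun s : R3 => oddExt G (insEquiv (3 : Fin 4) (s, t)) *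
      Complex.exp (Complex.I * ((inner ℝ (-k) s : ℝ) : ℂ))) := by
    refine (integrable_oddExt_slice G t).mul_bdd (c := 1) (by fun_prop)
      (Eventually.of_forall fun s => ?_)
    rw [norm_exp_I_mul_ofReal]
  rw [integral_eq_integral_integral_insEquiv (2 : Fin 3) hint]
  have hae := (((measurePreserving_insEquiv (2 : Fin 3)).integrable_comp_of_integrable
    hint).prod_right_ae)
  refine integral_congr_ae ?_
  filter_upwards [hae] with a ha
  have hpt : ∀ y, insEquiv (3 : Fin 4) (insEquiv (2 : Fin 3) (a, y), t) = !₂[a 0, a 1, y, t] := by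
    intro y
    rw [insEquiv_three, insEquiv_two_R3]
    simp
  have hexp : ∀ y, Complex.exp (Complex.I * ((inner ℝ (-k) (insEquiv (2 : Fin 3) (a, y)) : ℝ) : ℂ))
      = Complex.exp (-Complex.I * ((a 0 * k 0 + a 1 * k 1 : ℝ) : ℂ)) *
        Complex.exp (-Complex.I * ((y * k 2 : ℝ) : ℂ)) := by
    intro y
    rw [← Complex.exp_add, inner_R3, insEquiv_two_R3]
    congr 1
    simp
    ring
  simp only [Function.comp_apply, hpt, hexp] at ha ⊢
  rw [← intervalIntegral.integral_Iic_add_Ioi (b := 0) ha.integrableOn ha.integrableOn]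
  have i1 := ha.integrableOn (s := Set.Ioi 0)
  have i2 : IntegrableOn (fun y => oddExt G !₂[a 0, a 1, -y, t] *
      (Complex.exp (-Complex.I * ((a 0 * k 0 + a 1 * k 1 : ℝ) : ℂ)) *
        Complex.exp (-Complex.I * ((-y * k 2 : ℝ) : ℂ)))) (Set.Ioi 0) := ha.comp_neg.integrableOn
  rw [← neg_zero, ← integral_comp_neg_Ioi, neg_zero, ← integral_add i2 i1, ← integral_const_mul]
  refine setIntegral_congr_fun measurableSet_Ioi fun y hy => ?_
  have hy : 0 < y := hy
  have o1 : oddExt G !₂[a 0, a 1, y, t] = G !₂[a 0, a 1, y, t] := by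
    simp [oddExt, hy]
  have o2 : oddExt G !₂[a 0, a 1, -y, t] = -G !₂[a 0, a 1, y, t] := by
    simp [oddExt, hy, hy.le, reflY1]
  simp only [o1, o2]
  have : Complex.exp (-Complex.I * ((-y * k 2 : ℝ) : ℂ))
      = Complex.exp (Complex.I * ((y * k 2 : ℝ) : ℂ)) := by
    congr 1; push_cast; ring
  rw [this]
  ring

lemma src_odd (G : 𝓢(R4, ℂ)) (a b c t : ℝ) : src G !₂[a, b, -c] t = -src G !₂[a, b, c] t := by
  rw [src_eq, src_eq, ← integral_neg]
  congr 1
  ext x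
  rw [← mul_neg, ← integral_neg]
  congr 2
  simp
  ext y
  ring

lemma hasDerivAt_schwartz_coord (G : 𝓢(R4, ℂ)) (a b t y : ℝ) :
    HasDerivAt (fun y : ℝ => G !₂[a, b, y, t])
      (LineDeriv.lineDerivOp (EuclideanSpace.single (2 : Fin 4) (1 : ℝ)) G !₂[a, b, y, t]) y := by
  have h1 : (fun y : ℝ => (!₂[a, b, y, t] : R4)) =
      fun y => !₂[a, b, 0, t] + y • EuclideanSpace.single (2 : Fin 4) (1 : ℝ) := by
    ext y j
    fin_cases j <;> simp
  have h2 : HasDerivAt (fun y : ℝ => (!₂[a, b, y, t] : R4))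
      (EuclideanSpace.single (2 : Fin 4) (1 : ℝ)) y := by
    rw [h1]
    have := ((hasDerivAt_id y).smul_const
      (EuclideanSpace.single (2 : Fin 4) (1 : ℝ))).const_add (!₂[a, b, 0, t] : R4)
    simpa using this
  rw [SchwartzMap.lineDerivOp_apply_eq_fderiv]
  exact (G.differentiableAt.hasFDerivAt).comp_hasDerivAt y h2

/-- The sine transform in `y₁` supplies the whole weight in `k 2`: it vanishes at `k 2 = 0` by
oddness, and decays to first order since the odd extension may jump at `y₁ = 0`. The variables `x₁,
x₂` are merely integrated out. -/
lemma exists_src_bound_aux (G : 𝓢(R4, ℂ)) :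
    ∃ C : ℝ, 0 ≤ C ∧ ∀ k t, ‖src G k t‖ ≤
      C * (|k 2| / (1 + |k 2|) ^ 2 * ((1 + |t|) ^ 3)⁻¹) := by
  obtain ⟨C₀, hC₀, b0⟩ := exists_schwartz_bound G 3
  obtain ⟨C₁, hC₁, b1⟩ := exists_schwartz_bound
    (LineDeriv.lineDerivOp (EuclideanSpace.single (2 : Fin 4) (1 : ℝ)) G) 3
  set J := ∫ a : EuclideanSpace ℝ (Fin 2), ∏ j, ((1 + |a j|) ^ 3)⁻¹ with hJ
  have hJ0 : 0 ≤ J := integral_nonneg fun a => Finset.prod_nonneg fun j _ => by positivity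
  have hD := decayConst_nonneg
  refine ⟨8 * (1 + decayConst) * (C₀ + C₁) * J, by positivity, fun k t => ?_⟩
  rw [src_eq]
  have hb : ∀ a : EuclideanSpace ℝ (Fin 2),
      ‖Complex.exp (-Complex.I * ((a 0 * k 0 + a 1 * k 1 : ℝ) : ℂ)) *
        ∫ y in Set.Ioi (0 : ℝ), G !₂[a 0, a 1, y, t] *
          (Complex.exp (-Complex.I * ((y * k 2 : ℝ) : ℂ)) -
            Complex.exp (Complex.I * ((y * k 2 : ℝ) : ℂ)))‖ ≤
      8 * (1 + decayConst) * (C₀ + C₁) * (|k 2| / (1 + |k 2|) ^ 2 * ((1 + |t|) ^ 3)⁻¹) *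
        ∏ j, ((1 + |a j|) ^ 3)⁻¹ := by
    intro a
    have hn : ‖Complex.exp (-Complex.I * ((a 0 * k 0 + a 1 * k 1 : ℝ) : ℂ))‖ = 1 := by
      have := norm_exp_I_mul_ofReal (-(a 0 * k 0 + a 1 * k 1))
      rwa [Complex.ofReal_neg, mul_neg, ← neg_mul] at this
    rw [norm_mul, hn, one_mul]
    have hprod : ∀ y : ℝ, ∏ j, ((1 + |(!₂[a 0, a 1, y, t] : R4) j|) ^ 3)⁻¹
        = (∏ j, ((1 + |a j|) ^ 3)⁻¹) * ((1 + |t|) ^ 3)⁻¹ * ((1 + |y|) ^ 3)⁻¹ := by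
      intro y
      simp [Fin.prod_univ_four, Fin.prod_univ_two]
      ring
    have hP : 0 ≤ ∏ j, ((1 + |a j|) ^ 3)⁻¹ := Finset.prod_nonneg fun j _ => by positivity
    refine (norm_sine_transform_le
      (A := (C₀ + C₁) * ((∏ j, ((1 + |a j|) ^ 3)⁻¹) * ((1 + |t|) ^ 3)⁻¹))
      (fun y => hasDerivAt_schwartz_coord G (a 0) (a 1) t y) ?_ ?_ ?_ (k 2)).trans
      (le_of_eq (by ring))
    · refine (SchwartzMap.continuous _).comp ?_
      fun_prop
    · intro y
      refine (b0 _).trans ?_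
      rw [hprod, mul_assoc (C₀ + C₁)]
      gcongr
      linarith
    · intro y
      refine (b1 _).trans ?_
      rw [hprod, mul_assoc (C₀ + C₁)]
      gcongr
      linarith
  have h1 := norm_integral_le_of_norm_le ((integrable_decay (by norm_num)).const_mul
    (8 * (1 + decayConst) * (C₀ + C₁) * (|k 2| / (1 + |k 2|) ^ 2 * ((1 + |t|) ^ 3)⁻¹)))
    (Eventually.of_forall hb)
  rw [integral_const_mul] at h1
  exact h1.trans (le_of_eq (by ring))

/-- Integration by parts along one direction, with line derivatives only. The odd extension may be
discontinuous across `y₁ = 0`, but it is differentiable along `x₁` and `x₂`. -/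
lemma osc_lineDeriv {V : Type*} [NormedAddCommGroup V] [InnerProductSpace ℝ V] [MeasurableSpace V]
    [BorelSpace V] [FiniteDimensional ℝ V] {f f' : V → ℂ} {v : V} (hf : Integrable f)
    (hf' : Integrable f') (hd : ∀ s, HasLineDerivAt ℝ f (f' s) s v) (x : V) :
    osc f' x = -(Complex.I * ((inner ℝ x v : ℝ) : ℂ)) * osc f x := by
  set e : V → ℂ := fun k => Complex.exp (Complex.I * ((inner ℝ x k : ℝ) : ℂ)) with he
  have hint : ∀ {h : V → ℂ}, Integrable h → Integrable (fun k => h k * e k) := by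
    intro h hi
    refine hi.mul_bdd (c := 1) (by fun_prop) (Eventually.of_forall fun k => ?_)
    rw [he, norm_exp_I_mul_ofReal]
  have hed : ∀ s, HasLineDerivAt ℝ e (Complex.I * ((inner ℝ x v : ℝ) : ℂ) * e s) s v := by
    intro s
    have h1 : HasDerivAt (fun t : ℝ => ((inner ℝ x (s + t • v) : ℝ) : ℂ))
        ((inner ℝ x v : ℝ) : ℂ) 0 := by
      have : HasDerivAt (fun t : ℝ => inner ℝ x s + t * inner ℝ x v) (inner ℝ x v : ℝ) 0 := by
        simpa using ((hasDerivAt_id (0 : ℝ)).mul_const (inner ℝ x v : ℝ)).const_add (inner ℝ x s : ℝ)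
      refine (this.ofReal_comp).congr_of_eventuallyEq (Eventually.of_forall fun t => ?_)
      simp only [inner_add_right, inner_smul_right]
    refine ((h1.const_mul Complex.I).cexp).congr_deriv ?_
    simp only [he, zero_smul, add_zero]
    ring
  have h := integral_bilinear_hasLineDerivAt_right_eq_neg_left_of_integrable
    (μ := (volume : Measure V)) (B := ContinuousLinearMap.mul ℝ ℂ) (f := f) (f' := f') (g := e)
    (g' := fun s => Complex.I * ((inner ℝ x v : ℝ) : ℂ) * e s) (v := v) (hint hf')
    (by
      refine ((hint hf).const_mul (Complex.I * ((inner ℝ x v : ℝ) : ℂ))).congr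
        (Eventually.of_forall fun s => ?_)
      simp only [ContinuousLinearMap.mul_apply']
      ring)
    (hint hf) (fun s _ => hd s) (fun s _ => hed s)
  simp only [ContinuousLinearMap.mul_apply'] at h
  have e1 : osc f' x = ∫ s, f' s * e s := rfl
  have e2 : osc f x = ∫ s, f s * e s := rfl
  have e3 : ∫ s, f s * (Complex.I * ((inner ℝ x v : ℝ) : ℂ) * e s)
      = Complex.I * ((inner ℝ x v : ℝ) : ℂ) * ∫ s, f s * e s := by
    rw [← integral_const_mul]
    congr 1
    ext s
    ring
  rw [e1, e2, neg_mul, ← e3, h, neg_neg]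

/-- Moving along a direction other than `y₁` changes neither the sign of `y₁` nor the branch of the
odd extension, and it commutes with the reflection. -/
lemma hasLineDerivAt_oddExt_slice (G : 𝓢(R4, ℂ)) {i : Fin 4} (j : Fin 3) (hi : i = j.castSucc)
    (hj : j ≠ 2) (t : ℝ) (s : R3) :
    HasLineDerivAt ℝ (fun s : R3 => oddExt G (insEquiv (3 : Fin 4) (s, t)))
      (oddExt (LineDeriv.lineDerivOp (EuclideanSpace.single i (1 : ℝ)) G)
        (insEquiv (3 : Fin 4) (s, t))) s (EuclideanSpace.single j 1) := by
  subst hi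
  have hadd : ∀ τ : ℝ, insEquiv (3 : Fin 4) (s + τ • EuclideanSpace.single j 1, t)
      = insEquiv (3 : Fin 4) (s, t) + τ • EuclideanSpace.single j.castSucc (1 : ℝ) := by
    intro τ
    rw [insEquiv_three, insEquiv_three]
    ext l
    fin_cases l <;> fin_cases j <;> simp
  have hrefl : ∀ (x : R4) (τ : ℝ), reflY1 (x + τ • EuclideanSpace.single j.castSucc (1 : ℝ))
      = reflY1 x + τ • EuclideanSpace.single j.castSucc (1 : ℝ) := by
    intro x τ
    ext l
    fin_cases j
    · fin_cases l <;> simp [reflY1]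
    · fin_cases l <;> simp [reflY1]
    · exact absurd rfl hj
  have h2 : ∀ (x : R4) (τ : ℝ), (x + τ • EuclideanSpace.single j.castSucc (1 : ℝ)) 2 = x 2 := by
    intro x τ
    fin_cases j
    · simp
    · simp
    · exact absurd rfl hj
  have hG : ∀ x : R4, HasDerivAt (fun τ : ℝ => G (x + τ • EuclideanSpace.single j.castSucc (1 : ℝ)))
      (LineDeriv.lineDerivOp (EuclideanSpace.single j.castSucc (1 : ℝ)) G x) 0 := by
    intro x
    rw [SchwartzMap.lineDerivOp_apply_eq_fderiv]
    exact (G.differentiableAt.hasFDerivAt).hasLineDerivAt _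
  unfold HasLineDerivAt
  simp only [hadd]
  set x := insEquiv (3 : Fin 4) (s, t)
  simp only [oddExt, h2, hrefl]
  split_ifs
  · exact hG x
  · exact (hG _).neg
  · exact hasDerivAt_const _ _

lemma src_lineDeriv (G : 𝓢(R4, ℂ)) {i : Fin 4} (j : Fin 3) (hi : i = j.castSucc)
    (hj : j ≠ 2) (k : R3) (t : ℝ) :
    src (LineDeriv.lineDerivOp (EuclideanSpace.single i (1 : ℝ)) G) k t
      = Complex.I * (k j : ℂ) * src G k t := by
  unfold src
  rw [osc_lineDeriv (integrable_oddExt_slice G t) (integrable_oddExt_slice _ t)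
    (fun s => hasLineDerivAt_oddExt_slice G j hi hj t s)]
  have : inner ℝ (-k) (EuclideanSpace.single j (1 : ℝ)) = -k j := by
    simp [EuclideanSpace.inner_single_right]
  rw [this]
  simp

/-- Three derivatives in direction `j` multiply `src` by `(i k_j)³`, and `(1 + a)³ ≤ 4 (1 + a³)` for
`a ≥ 0`. The hypothesis is for all `G`, so it covers the derivatives and the step can be iterated;
`j = 2` is excluded because of the jump. -/
lemma exists_src_bound_step {b : R3 → ℝ → ℝ} {i : Fin 4} (j : Fin 3)
    (hi : i = j.castSucc) (hj : j ≠ 2)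
    (h : ∀ G : 𝓢(R4, ℂ), ∃ C : ℝ, 0 ≤ C ∧ ∀ k t, ‖src G k t‖ ≤ C * b k t) (G : 𝓢(R4, ℂ)) :
    ∃ C : ℝ, 0 ≤ C ∧ ∀ k t, ‖src G k t‖ ≤ C * (((1 + |k j|) ^ 3)⁻¹ * b k t) := by
  set m : R4 := EuclideanSpace.single i (1 : ℝ)
  obtain ⟨C₀, hC₀, h0⟩ := h G
  obtain ⟨C₃, hC₃, h3⟩ := h (LineDeriv.lineDerivOp m (LineDeriv.lineDerivOp m
    (LineDeriv.lineDerivOp m G)))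
  refine ⟨4 * (C₀ + C₃), by positivity, fun k t => ?_⟩
  have h3' := h3 k t
  rw [src_lineDeriv _ j hi hj, src_lineDeriv _ j hi hj, src_lineDeriv _ j hi hj] at h3'
  simp only [norm_mul, Complex.norm_I, one_mul, Complex.norm_real, Real.norm_eq_abs] at h3'
  have h0' := h0 k t
  have hk := abs_nonneg (k j)
  rw [← mul_assoc, mul_comm _ (((1 + |k j|) ^ 3)⁻¹), mul_assoc, ← div_eq_inv_mul,
    le_div_iff₀ (by positivity)]
  have h4 : (1 + |k j|) ^ 3 ≤ 4 * (1 + |k j| ^ 3) := by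
    nlinarith [mul_nonneg (by positivity : 0 ≤ 1 + |k j|) (sq_nonneg (|k j| - 1))]
  have h5 := mul_le_mul_of_nonneg_left h4 (norm_nonneg (src G k t))
  nlinarith

/-- The weight which controls `src`. -/
noncomputable def srcWeight (k : R3) : ℝ :=
  ((1 + |k 0|) ^ 3)⁻¹ * (((1 + |k 1|) ^ 3)⁻¹ * (|k 2| / (1 + |k 2|) ^ 2))

lemma srcWeight_nonneg (k : R3) : 0 ≤ srcWeight k := by unfold srcWeight; positivity

lemma exists_src_bound (G : 𝓢(R4, ℂ)) :
    ∃ C : ℝ, 0 ≤ C ∧ ∀ k t, ‖src G k t‖ ≤ C * (srcWeight k * ((1 + |t|) ^ 3)⁻¹) := by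
  obtain ⟨C, hC, h⟩ := exists_src_bound_step (i := 0)
    (b := fun k t => ((1 + |k 1|) ^ 3)⁻¹ * (|k 2| / (1 + |k 2|) ^ 2 * ((1 + |t|) ^ 3)⁻¹))
    0 rfl (by decide)
    (fun G => exists_src_bound_step (i := 1) 1 rfl (by decide)
      exists_src_bound_aux G) G
  refine ⟨C, hC, fun k t => (h k t).trans (le_of_eq ?_)⟩
  unfold srcWeight
  ring

/-- For `Im η ≤ 0` the exponential is bounded on `t > 0`, so Fubini applies. This covers both the
real frequency and the value `-iζ` occurring in the formula. -/
lemma fourierC_eq {g : R4 → ℂ} {G : 𝓢(R4, ℂ)} (hg : Set.EqOn g G (closure cornerDomain))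
    (k : R3) {η : ℂ} (hη : η.im ≤ 0) :
    fourierC (extO1 g) (k 0) (k 1) (k 2) η
      = ∫ t in Set.Ioi (0 : ℝ), src G k t * Complex.exp (-Complex.I * (t * η)) := by
  have hext : ∀ x, extO1 g x = if x 3 ≤ 0 then 0 else oddExt G x := by
    intro x
    unfold extO1 oddExt
    split_ifs with h1 h2 h3
    · rfl
    · exact hg (subset_closure ⟨h2, not_le.1 h1⟩)
    · rw [hg (subset_closure ⟨by simpa [reflY1] using h3, by simpa [reflY1] using h1⟩)]
    · rfl
  unfold fourierC
  set F : R4 → ℂ := fun x => extO1 g x * Complex.exp (-Complex.I *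
    ((x 0 : ℂ) * k 0 + (x 1 : ℂ) * k 1 + (x 2 : ℂ) * k 2 + (x 3 : ℂ) * η)) with hF
  have hslice : ∀ s t, F (insEquiv (3 : Fin 4) (s, t)) = if t ≤ 0 then 0 else
      Complex.exp (-Complex.I * (t * η)) * (oddExt G (insEquiv (3 : Fin 4) (s, t)) *
        Complex.exp (Complex.I * ((inner ℝ (-k) s : ℝ) : ℂ))) := by
    intro s t
    simp only [hF, hext, insEquiv_same]
    split_ifs
    · rw [zero_mul]
    · rw [mul_left_comm, ← Complex.exp_add, inner_R3, insEquiv_three]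
      congr 2
      simp
      ring
  have hint : Integrable F := by
    obtain ⟨C, hC, hb⟩ := exists_oddExt_bound G 2
    refine Integrable.mono' ((integrable_decay le_rfl).const_mul C) ?_
      (Eventually.of_forall fun x => ?_)
    · simp only [hF, hext]
      have m3 : MeasurableSet {x : R4 | x 3 ≤ 0} := measurableSet_le (by fun_prop) measurable_const
      exact ((Measurable.ite m3 measurable_const
        (measurable_oddExt G.continuous.measurable)).mul (by fun_prop)).aestronglyMeasurable
    · have := hslice ((insEquiv (3 : Fin 4)).symm x).1 ((insEquiv (3 : Fin 4)).symm x).2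
      simp only [Prod.mk.eta, MeasurableEquiv.apply_symm_apply] at this
      rw [this]
      split_ifs with h
      · rw [norm_zero]
        exact mul_nonneg hC (Finset.prod_nonneg fun j _ => by positivity)
      · rw [norm_mul, norm_mul, norm_exp_I_mul_ofReal, mul_one]
        refine (mul_le_of_le_one_left (norm_nonneg _) ?_).trans (hb x)
        rw [Complex.norm_exp, Real.exp_le_one_iff]
        simp
        exact mul_nonpos_of_nonneg_of_nonpos (not_le.1 h).le hη
  rw [integral_eq_integral_integral_insEquiv_swap (3 : Fin 4) hint, ← integral_indicator measurableSet_Ioi]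
  congr 1
  ext t
  simp only [hslice, Set.indicator, Set.mem_Ioi]
  by_cases h : t ≤ 0
  · simp [h, not_lt.2 h]
  · simp only [h, not_le.1 h, if_true, if_false]
    rw [integral_const_mul, mul_comm]
    rfl

/-! ### Exponential kernels on the half line -/

/-- The sign of `t`, with the value `-1` at `0`. -/
noncomputable def sg (t : ℝ) : ℝ := if 0 < t then 1 else -1

lemma measurable_sg : Measurable sg :=
  Measurable.ite measurableSet_Ioi measurable_const measurable_const

lemma abs_sg (t : ℝ) : |sg t| = 1 := by
  unfold sg; split_ifs <;> simp

/-- The free kernel `e^{-z|y-s|}`. -/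
noncomputable def expK (z y s : ℝ) : ℝ := Real.exp (-z * |y - s|)

/-- The reflected kernel `e^{-z(y+s)}`. -/
noncomputable def expF (z y s : ℝ) : ℝ := Real.exp (-z * (y + s))

lemma expK_pos (z y s : ℝ) : 0 < expK z y s := Real.exp_pos _

lemma expF_pos (z y s : ℝ) : 0 < expF z y s := Real.exp_pos _

lemma expK_le_one {z : ℝ} (hz : 0 ≤ z) (y s : ℝ) : expK z y s ≤ 1 := by
  unfold expK
  rw [Real.exp_le_one_iff]
  nlinarith [mul_nonneg hz (abs_nonneg (y - s))]

lemma expF_le_expK {z y s : ℝ} (hz : 0 ≤ z) (hy : 0 ≤ y) (hs : 0 ≤ s) :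
    expF z y s ≤ expK z y s := by
  unfold expF expK
  refine Real.exp_le_exp.2 ?_
  have : |y - s| ≤ y + s := abs_le.2 ⟨by linarith, by linarith⟩
  nlinarith

/-- For `y ≤ s` decay in `y` is decay in `s`; for `y ≥ s` one has `z (y - s) e^{-z (y - s)} ≤ 1`.
Decay in the height is thus bought with the factors `1 + s` and `1 + z`, which the decay of `src`
can pay for. -/
lemma mul_expK_le {z y s : ℝ} (hz : 0 ≤ z) (hy : 0 ≤ y) (hs : 0 ≤ s) :
    z * expK z y s ≤ (1 + z) * (1 + s) * (1 + y)⁻¹ := by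
  rw [← div_eq_mul_inv, le_div_iff₀ (by positivity)]
  have h1 := expK_le_one hz y s
  have h0 := (expK_pos z y s).le
  rcases le_total y s with h | h
  · have : z * expK z y s * (1 + y) ≤ z * 1 * (1 + s) := by gcongr
    nlinarith
  · have h2 : z * (y - s) * expK z y s ≤ 1 := by
      unfold expK
      rw [abs_of_nonneg (by linarith), neg_mul, Real.exp_neg, ← div_eq_mul_inv,
        div_le_one (Real.exp_pos _)]
      have := Real.add_one_le_exp (z * (y - s))
      linarith
    have h3 : z * expK z y s * (1 + s) ≤ z * 1 * (1 + s) := by gcongr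
    nlinarith

lemma integrable_expK {z : ℝ} (hz : 0 < z) (s : ℝ) : Integrable (fun y => expK z y s) := by
  have h : Integrable (fun t : ℝ => Real.exp (-z * |t|)) := by
    refine integrable_of_even (fun t => by rw [abs_neg]) ?_
    refine (integrableOn_exp_mul_Ioi (a := -z) (by linarith) 0).congr_fun (fun t ht => ?_)
      measurableSet_Ioi
    simp only
    rw [abs_of_pos ht]
  exact h.comp_sub_right s

lemma integral_expK {z : ℝ} (hz : 0 < z) (s : ℝ) : ∫ y, expK z y s = 2 / z := by
  have h := integral_sub_right_eq_self (μ := (volume : Measure ℝ))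
    (fun t : ℝ => Real.exp (-z * |t|)) s
  unfold expK
  rw [h, integral_comp_abs (f := fun t => Real.exp (-z * t)),
    integral_exp_mul_Ioi (by linarith)]
  simp
  field_simp

lemma expK_comm (z y s : ℝ) : expK z y s = expK z s y := by
  unfold expK; rw [abs_sub_comm]

section OneDim

variable {z : ℝ} {a a' : ℝ → ℂ} {A : ℝ}

lemma integrableOn_exp_mul (hz : 0 < z) (s c : ℝ) {b : ℝ → ℂ} (hb : Continuous b)
    (hA : ∀ y, ‖b y‖ ≤ A) :
    IntegrableOn (fun y => ((Real.exp (-z * (y - s)) : ℝ) : ℂ) * b y) (Set.Ioi c) := by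
  have h := (integrableOn_exp_mul_Ioi (a := -z) (by linarith) c).const_mul (Real.exp (z * s))
  have h' : IntegrableOn (fun y => ((Real.exp (-z * (y - s)) : ℝ) : ℂ)) (Set.Ioi c) := by
    refine (Integrable.ofReal h (𝕜 := ℂ)).congr (Eventually.of_forall fun y => ?_)
    simp only [← Real.exp_add]
    norm_num
    ring_nf
  exact h'.mul_bdd (c := A) hb.aestronglyMeasurable (Eventually.of_forall hA)

lemma hasDerivAt_exp_coe (z s y : ℝ) :
    HasDerivAt (fun y => ((Real.exp (z * (y - s)) : ℝ) : ℂ))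
      ((z : ℂ) * ((Real.exp (z * (y - s)) : ℝ) : ℂ)) y := by
  have h : HasDerivAt (fun y => z * (y - s)) z y := by
    simpa using ((hasDerivAt_id y).sub_const s).const_mul z
  refine (h.exp.ofReal_comp).congr_deriv ?_
  push_cast
  ring

lemma integral_Ioi_exp_mul_deriv (hz : 0 < z) (s c : ℝ) (hd : ∀ y, HasDerivAt a (a' y) y)
    (hc : Continuous a') (hA : ∀ y, ‖a y‖ ≤ A) (hA' : ∀ y, ‖a' y‖ ≤ A) :
    ∫ y in Set.Ioi c, ((Real.exp (-z * (y - s)) : ℝ) : ℂ) * a' y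
      = -(((Real.exp (-z * (c - s)) : ℝ) : ℂ) * a c)
        + z * ∫ y in Set.Ioi c, ((Real.exp (-z * (y - s)) : ℝ) : ℂ) * a y := by
  have hcont : Continuous a := continuous_iff_continuousAt.2 fun y => (hd y).continuousAt
  have i1 := integrableOn_exp_mul hz s c hc hA'
  have i2 := integrableOn_exp_mul hz s c hcont hA
  have hlim : Tendsto (fun y => ((Real.exp (-z * (y - s)) : ℝ) : ℂ) * a y) atTop (𝓝 0) := by
    have h0 : Tendsto (fun y => Real.exp (-z * (y - s)) * A) atTop (𝓝 0) := by
      have h1 : Tendsto (fun y : ℝ => -z * (y - s)) atTop atBot :=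
        (tendsto_atTop_add_const_right _ _ tendsto_id).const_mul_atTop_of_neg (by linarith)
      simpa using (Real.tendsto_exp_atBot.comp h1).mul_const A
    refine squeeze_zero_norm (fun y => ?_) h0
    rw [norm_mul, Complex.norm_real, Real.norm_of_nonneg (Real.exp_pos _).le]
    exact mul_le_mul_of_nonneg_left (hA y) (Real.exp_pos _).le
  have ftc := integral_Ioi_of_hasDerivAt_of_tendsto (a := c)
    (f := fun y => ((Real.exp (-z * (y - s)) : ℝ) : ℂ) * a y)
    (f' := fun y => ((Real.exp (-z * (y - s)) : ℝ) : ℂ) * a' y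
      + (-z : ℂ) * (((Real.exp (-z * (y - s)) : ℝ) : ℂ) * a y))
    (Continuous.continuousWithinAt (by fun_prop))
    (fun y _ => ((hasDerivAt_exp_coe (-z) s y).mul (hd y)).congr_deriv (by push_cast; ring))
    (i1.add (i2.const_mul _)) hlim
  rw [integral_add i1 (i2.const_mul _), integral_const_mul] at ftc
  linear_combination ftc

lemma integral_Ioc_exp_mul_deriv (z : ℝ) {s : ℝ} (hs : 0 ≤ s) (hd : ∀ y, HasDerivAt a (a' y) y)
    (hc : Continuous a') :
    ∫ y in Set.Ioc 0 s, ((Real.exp (z * (y - s)) : ℝ) : ℂ) * a' y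
      = a s - ((Real.exp (-z * s) : ℝ) : ℂ) * a 0
        - z * ∫ y in Set.Ioc 0 s, ((Real.exp (z * (y - s)) : ℝ) : ℂ) * a y := by
  have hcont : Continuous a := continuous_iff_continuousAt.2 fun y => (hd y).continuousAt
  rw [← intervalIntegral.integral_of_le hs, ← intervalIntegral.integral_of_le hs]
  have i1 : IntervalIntegrable (fun y => ((Real.exp (z * (y - s)) : ℝ) : ℂ) * a' y) volume 0 s :=
    Continuous.intervalIntegrable (by fun_prop) _ _
  have i2 : IntervalIntegrable (fun y => ((Real.exp (z * (y - s)) : ℝ) : ℂ) * a y) volume 0 s :=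
    Continuous.intervalIntegrable (by fun_prop) _ _
  have ftc := intervalIntegral.integral_eq_sub_of_hasDerivAt (a := 0) (b := s)
    (f := fun y => ((Real.exp (z * (y - s)) : ℝ) : ℂ) * a y)
    (f' := fun y => ((Real.exp (z * (y - s)) : ℝ) : ℂ) * a' y
      + (z : ℂ) * (((Real.exp (z * (y - s)) : ℝ) : ℂ) * a y))
    (fun y _ => ((hasDerivAt_exp_coe z s y).mul (hd y)).congr_deriv (by ring))
    (i1.add (i2.const_mul _))
  rw [intervalIntegral.integral_add i1 (i2.const_mul _), intervalIntegral.integral_const_mul] at ftc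
  have e0 : Real.exp (z * (s - s)) = 1 := by simp
  have e1 : z * (0 - s) = -z * s := by ring
  simp only [e0, e1, Complex.ofReal_one, one_mul] at ftc
  linear_combination ftc

lemma integrable_expK_mul (hz : 0 < z) (s : ℝ) {b : ℝ → ℂ} (hb : AEStronglyMeasurable b)
    (hA : ∀ y, ‖b y‖ ≤ A) : Integrable (fun y => (expK z y s : ℂ) * b y) :=
  ((integrable_expK hz s).ofReal (𝕜 := ℂ)).mul_bdd (c := A) hb (Eventually.of_forall hA)

/-- Splitting of the half line at `s`. -/
lemma integral_Ioi_split {s : ℝ} (hs : 0 ≤ s) {b : ℝ → ℂ} (c : ℝ → ℝ)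
    (hb : IntegrableOn (fun y => (c (sg (y - s)) : ℂ) * ((expK z y s : ℂ) * b y)) (Set.Ioi 0)) :
    ∫ y in Set.Ioi (0 : ℝ), (c (sg (y - s)) : ℂ) * ((expK z y s : ℂ) * b y)
      = (c (-1) : ℂ) * (∫ y in Set.Ioc 0 s, ((Real.exp (z * (y - s)) : ℝ) : ℂ) * b y)
        + (c 1 : ℂ) * ∫ y in Set.Ioi s, ((Real.exp (-z * (y - s)) : ℝ) : ℂ) * b y := by
  rw [← Set.Ioc_union_Ioi_eq_Ioi hs,
    setIntegral_union (Set.Ioc_disjoint_Ioi le_rfl) measurableSet_Ioi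
      (hb.mono_set Set.Ioc_subset_Ioi_self) (hb.mono_set (Set.Ioi_subset_Ioi hs)),
    ← integral_const_mul, ← integral_const_mul]
  congr 1
  · refine setIntegral_congr_fun measurableSet_Ioc fun y hy => ?_
    have h1 : sg (y - s) = -1 := if_neg (by linarith [hy.2])
    have h2 : expK z y s = Real.exp (z * (y - s)) := by
      unfold expK
      rw [abs_of_nonpos (by linarith [hy.2])]
      congr 1; ring
    simp only [h1, h2]
  · refine setIntegral_congr_fun measurableSet_Ioi fun y hy => ?_
    have hy' : s < y := hy
    have h1 : sg (y - s) = 1 := if_pos (by linarith)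
    have h2 : expK z y s = Real.exp (-z * (y - s)) := by
      unfold expK
      rw [abs_of_nonneg (by linarith)]
    simp only [h1, h2]

lemma integrableOn_split (hz : 0 < z) (s : ℝ) {b : ℝ → ℂ} (hb : Continuous b)
    (hA : ∀ y, ‖b y‖ ≤ A) {c : ℝ → ℝ} (hc : Measurable c) :
    IntegrableOn (fun y => (c (sg (y - s)) : ℂ) * ((expK z y s : ℂ) * b y)) (Set.Ioi 0) := by
  refine (Integrable.bdd_mul (c := max |c 1| |c (-1)|)
    (integrable_expK_mul hz s hb.aestronglyMeasurable hA) ?_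
    (Eventually.of_forall fun y => ?_)).integrableOn
  · exact (Complex.measurable_ofReal.comp (hc.comp (measurable_sg.comp
      (measurable_id.sub_const s)))).aestronglyMeasurable
  · rw [Complex.norm_real, Real.norm_eq_abs]
    unfold sg
    split_ifs
    · exact le_max_left _ _
    · exact le_max_right _ _

lemma integral_expK_mul_deriv (hz : 0 < z) {s : ℝ} (hs : 0 ≤ s) (hd : ∀ y, HasDerivAt a (a' y) y)
    (hc : Continuous a') (hA : ∀ y, ‖a y‖ ≤ A) (hA' : ∀ y, ‖a' y‖ ≤ A) :
    ∫ y in Set.Ioi (0 : ℝ), (expK z y s : ℂ) * a' y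
      = -((Real.exp (-z * s) : ℝ) : ℂ) * a 0
        + z * ∫ y in Set.Ioi (0 : ℝ), (sg (y - s) : ℂ) * ((expK z y s : ℂ) * a y) := by
  have hcont : Continuous a := continuous_iff_continuousAt.2 fun y => (hd y).continuousAt
  have e1 := integral_Ioi_split hs (fun _ => 1)
    (integrableOn_split hz s hc hA' (c := fun _ => 1) measurable_const)
  have e2 := integral_Ioi_split hs (fun t => t)
    (integrableOn_split hz s hcont hA (c := fun t => t) measurable_id)
  simp only [Complex.ofReal_one, one_mul, Complex.ofReal_neg] at e1 e2
  rw [e1, e2, integral_Ioi_exp_mul_deriv hz s s hd hc hA hA', integral_Ioc_exp_mul_deriv z hs hd hc]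
  simp
  ring

/-- Integrate by parts on each side of `s`. In `integral_expK_mul_deriv` the boundary terms at `s`
cancel because the kernel is continuous. Here the sign makes them add up to `-2 a s`, the point mass
behind the Green identity. -/
lemma integral_sg_expK_mul_deriv (hz : 0 < z) {s : ℝ} (hs : 0 ≤ s)
    (hd : ∀ y, HasDerivAt a (a' y) y)
    (hc : Continuous a') (hA : ∀ y, ‖a y‖ ≤ A) (hA' : ∀ y, ‖a' y‖ ≤ A) :
    ∫ y in Set.Ioi (0 : ℝ), (sg (y - s) : ℂ) * ((expK z y s : ℂ) * a' y)
      = ((Real.exp (-z * s) : ℝ) : ℂ) * a 0 - 2 * a s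
        + z * ∫ y in Set.Ioi (0 : ℝ), (expK z y s : ℂ) * a y := by
  have hcont : Continuous a := continuous_iff_continuousAt.2 fun y => (hd y).continuousAt
  have e1 := integral_Ioi_split hs (fun _ => 1)
    (integrableOn_split hz s hcont hA (c := fun _ => 1) measurable_const)
  have e2 := integral_Ioi_split hs (fun t => t)
    (integrableOn_split hz s hc hA' (c := fun t => t) measurable_id)
  simp only [Complex.ofReal_one, one_mul, Complex.ofReal_neg] at e1 e2
  rw [e1, e2, integral_Ioi_exp_mul_deriv hz s s hd hc hA hA', integral_Ioc_exp_mul_deriv z hs hd hc]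
  simp
  ring

lemma integral_expF_mul_deriv (hz : 0 < z) (s : ℝ) (hd : ∀ y, HasDerivAt a (a' y) y)
    (hc : Continuous a') (hA : ∀ y, ‖a y‖ ≤ A) (hA' : ∀ y, ‖a' y‖ ≤ A) :
    ∫ y in Set.Ioi (0 : ℝ), (expF z y s : ℂ) * a' y
      = -((Real.exp (-z * s) : ℝ) : ℂ) * a 0
        + z * ∫ y in Set.Ioi (0 : ℝ), (expF z y s : ℂ) * a y := by
  have h := integral_Ioi_exp_mul_deriv hz (-s) 0 hd hc hA hA'
  simp only [sub_neg_eq_add, zero_add] at h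
  rw [neg_mul]
  exact h

lemma integrable_expF_mul (hz : 0 < z) (s : ℝ) {b : ℝ → ℂ} (hb : Continuous b)
    (hA : ∀ y, ‖b y‖ ≤ A) : IntegrableOn (fun y => (expF z y s : ℂ) * b y) (Set.Ioi 0) := by
  have h := integrableOn_exp_mul hz (-s) 0 hb hA
  simp only [sub_neg_eq_add] at h
  exact h

end OneDim

/-! ### The Green kernel with the oblique boundary condition -/

/-- The Green kernel of `∂² - z²` on the half line with an oblique boundary condition. -/
noncomputable def greenK (z κ y s : ℝ) : ℝ :=
  -(1 / (2 * z)) * (expK z y s + (z + κ) / (z - κ) * expF z y s)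

/-- The image of `greenK` under `½ (i κ + i ∂)`. -/
noncomputable def dbarK (z κ y s : ℝ) : ℂ :=
  -(Complex.I / (4 * z)) * (((κ - z * sg (y - s)) * expK z y s - (z + κ) * expF z y s : ℝ) : ℂ)

section Measurability

variable {α : Type*} [MeasurableSpace α] {z κ y s : α → ℝ}

lemma measurable_expK (hz : Measurable z) (hy : Measurable y) (hs : Measurable s) :
    Measurable (fun x => expK (z x) (y x) (s x)) := by
  unfold expK; fun_prop

lemma measurable_expF (hz : Measurable z) (hy : Measurable y) (hs : Measurable s) :
    Measurable (fun x => expF (z x) (y x) (s x)) := by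
  unfold expF; fun_prop

lemma measurable_greenK (hz : Measurable z) (hκ : Measurable κ) (hy : Measurable y)
    (hs : Measurable s) : Measurable (fun x => (greenK (z x) (κ x) (y x) (s x) : ℂ)) := by
  have h1 := measurable_expK hz hy hs
  have h2 := measurable_expF hz hy hs
  unfold greenK
  fun_prop

lemma measurable_dbarK (hz : Measurable z) (hκ : Measurable κ) (hy : Measurable y)
    (hs : Measurable s) : Measurable (fun x => dbarK (z x) (κ x) (y x) (s x)) := by
  have h1 := measurable_expK hz hy hs
  have h2 := measurable_expF hz hy hs
  have h3 : Measurable fun x => sg (y x - s x) := measurable_sg.comp (hy.sub hs)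
  unfold dbarK
  fun_prop

end Measurability

section Kernel

variable {z κ : ℝ} {a a' a'' : ℝ → ℂ} {A : ℝ}

lemma greenK_mul (y s : ℝ) (b : ℂ) : (greenK z κ y s : ℂ) * b =
    (-(1 / (2 * z)) : ℂ) * ((expK z y s : ℂ) * b)
      + (-(1 / (2 * z)) * ((z + κ) / (z - κ)) : ℂ) * ((expF z y s : ℂ) * b) := by
  unfold greenK
  push_cast
  ring

lemma integrableOn_greenK_mul (hz : 0 < z) (s : ℝ) (hc : Continuous a) (hA : ∀ y, ‖a y‖ ≤ A) :
    IntegrableOn (fun y => (greenK z κ y s : ℂ) * a y) (Set.Ioi 0) := by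
  simp only [greenK_mul]
  exact ((integrable_expK_mul hz s hc.aestronglyMeasurable hA).integrableOn.const_mul _).add
    ((integrable_expF_mul hz s hc hA).const_mul _)

lemma integral_greenK_mul (hz : 0 < z) (s : ℝ) (hc : Continuous a) (hA : ∀ y, ‖a y‖ ≤ A) :
    ∫ y in Set.Ioi (0 : ℝ), (greenK z κ y s : ℂ) * a y =
      (-(1 / (2 * z)) : ℂ) * (∫ y in Set.Ioi (0 : ℝ), (expK z y s : ℂ) * a y)
      + (-(1 / (2 * z)) * ((z + κ) / (z - κ)) : ℂ) *
        ∫ y in Set.Ioi (0 : ℝ), (expF z y s : ℂ) * a y := by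
  simp only [greenK_mul]
  rw [integral_add
    ((integrable_expK_mul hz s hc.aestronglyMeasurable hA).integrableOn.const_mul _)
    ((integrable_expF_mul hz s hc hA).const_mul _), integral_const_mul, integral_const_mul]

/-- Two integrations by parts: the free kernel reproduces `a s`, and the reflected one solves the
homogeneous equation. Because `a` and `a'` vanish at `0` there are no boundary terms, and any
reflection coefficient would do. -/
lemma integral_greenK_mul_poisson (hz : 0 < z) {s : ℝ} (hs : 0 ≤ s)
    (hd : ∀ y, HasDerivAt a (a' y) y) (hd' : ∀ y, HasDerivAt a' (a'' y) y)
    (hc : Continuous a'') (hA : ∀ y, ‖a y‖ ≤ A) (hA' : ∀ y, ‖a' y‖ ≤ A) (hA'' : ∀ y, ‖a'' y‖ ≤ A)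
    (h0 : a 0 = 0) (h0' : a' 0 = 0) :
    ∫ y in Set.Ioi (0 : ℝ), (greenK z κ y s : ℂ) * (a'' y - z ^ 2 * a y) = a s := by
  have hca : Continuous a := continuous_iff_continuousAt.2 fun y => (hd y).continuousAt
  have hca' : Continuous a' := continuous_iff_continuousAt.2 fun y => (hd' y).continuousAt
  have i1 := integrableOn_greenK_mul (κ := κ) hz s hc hA''
  have i2 := (integrableOn_greenK_mul (κ := κ) hz s hca hA).const_mul ((z : ℂ) ^ 2)
  have e : ∀ y, (greenK z κ y s : ℂ) * (a'' y - z ^ 2 * a y)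
      = (greenK z κ y s : ℂ) * a'' y - z ^ 2 * ((greenK z κ y s : ℂ) * a y) := fun y => by ring
  simp only [e]
  rw [integral_sub i1 i2, integral_const_mul, integral_greenK_mul hz s hc hA'',
    integral_greenK_mul hz s hca hA, integral_expK_mul_deriv hz hs hd' hc hA' hA'',
    integral_sg_expK_mul_deriv hz hs hd hca' hA hA', integral_expF_mul_deriv hz s hd' hc hA' hA'',
    integral_expF_mul_deriv hz s hd hca' hA hA', h0, h0']
  have : (z : ℂ) ≠ 0 := by exact_mod_cast hz.ne'
  generalize ((z : ℂ) + κ) / (z - κ) = c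
  field_simp
  ring

lemma integral_dbarK_mul (hz : 0 < z) (s : ℝ) (hc : Continuous a) (hA : ∀ y, ‖a y‖ ≤ A) :
    ∫ y in Set.Ioi (0 : ℝ), dbarK z κ y s * a y =
      -(Complex.I / (4 * z)) * (κ * (∫ y in Set.Ioi (0 : ℝ), (expK z y s : ℂ) * a y)
        - z * (∫ y in Set.Ioi (0 : ℝ), (sg (y - s) : ℂ) * ((expK z y s : ℂ) * a y))
        - (z + κ) * ∫ y in Set.Ioi (0 : ℝ), (expF z y s : ℂ) * a y) := by
  have i1 : IntegrableOn (fun y => (κ : ℂ) * ((expK z y s : ℂ) * a y)) (Set.Ioi 0) :=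
    (integrable_expK_mul hz s hc.aestronglyMeasurable hA).integrableOn.const_mul _
  have i2 : IntegrableOn (fun y => (z : ℂ) * ((sg (y - s) : ℂ) * ((expK z y s : ℂ) * a y)))
      (Set.Ioi 0) :=
    (integrableOn_split hz s hc hA (c := fun t => t) measurable_id).const_mul _
  have i3 : IntegrableOn (fun y => ((z : ℂ) + κ) * ((expF z y s : ℂ) * a y)) (Set.Ioi 0) :=
    (integrable_expF_mul hz s hc hA).const_mul _
  have i12 : IntegrableOn (fun y => (κ : ℂ) * ((expK z y s : ℂ) * a y) -
      (z : ℂ) * ((sg (y - s) : ℂ) * ((expK z y s : ℂ) * a y))) (Set.Ioi 0) := i1.sub i2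
  rw [← integral_const_mul, ← integral_const_mul, ← integral_const_mul, ← integral_sub i1 i2,
    ← integral_sub i12 i3, ← integral_const_mul]
  congr 1
  ext y
  unfold dbarK
  push_cast
  ring

/-- The derivative is moved onto the kernel. On the reflected part it produces the factor `κ - z`,
which cancels the denominator of the coefficient; hence `dbarK` has no singularity at `κ = z`. -/
lemma integral_greenK_mul_dbar (hz : 0 < z) (hκ : κ ≠ z) {s : ℝ} (hs : 0 ≤ s)
    (hd : ∀ y, HasDerivAt a (a' y) y)
    (hc : Continuous a') (hA : ∀ y, ‖a y‖ ≤ A) (hA' : ∀ y, ‖a' y‖ ≤ A) (h0 : a 0 = 0) :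
    ∫ y in Set.Ioi (0 : ℝ), (greenK z κ y s : ℂ) *
      (1 / 2 * (-(Complex.I * κ) * a y + Complex.I * a' y))
      = -∫ y in Set.Ioi (0 : ℝ), dbarK z κ y s * a y := by
  have hca : Continuous a := continuous_iff_continuousAt.2 fun y => (hd y).continuousAt
  have i1 := (integrableOn_greenK_mul (κ := κ) hz s hc hA').const_mul (Complex.I / 2)
  have i2 := (integrableOn_greenK_mul (κ := κ) hz s hca hA).const_mul (Complex.I * κ / 2)
  have e : ∀ y, (greenK z κ y s : ℂ) * (1 / 2 * (-(Complex.I * κ) * a y + Complex.I * a' y))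
      = Complex.I / 2 * ((greenK z κ y s : ℂ) * a' y)
        - Complex.I * κ / 2 * ((greenK z κ y s : ℂ) * a y) := fun y => by ring
  simp only [e]
  rw [integral_sub i1 i2, integral_const_mul, integral_const_mul, integral_greenK_mul hz s hc hA',
    integral_greenK_mul hz s hca hA, integral_expK_mul_deriv hz hs hd hc hA hA',
    integral_expF_mul_deriv hz s hd hc hA hA', integral_dbarK_mul hz s hca hA, h0]
  have h1 : (z : ℂ) ≠ 0 := by exact_mod_cast hz.ne'
  have h2 : (z : ℂ) - κ ≠ 0 := by
    rw [sub_ne_zero]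
    exact_mod_cast hκ.symm
  field_simp
  ring

/-- The exponential is an eigenfunction of the derivative, so the integration by parts identities
become linear equations for the three integrals. Solving them yields the multiplier of the explicit
formula. -/
lemma integral_greenK_mul_exp (hz : 0 < z) (hκ : κ ≠ z) {s : ℝ} (hs : 0 ≤ s) (η : ℝ) :
    ∫ y in Set.Ioi (0 : ℝ), (greenK z κ y s : ℂ) * Complex.exp (-Complex.I * ((y : ℂ) * η))
      = -(Complex.exp (-Complex.I * ((s : ℂ) * η)) / ((z ^ 2 + η ^ 2 : ℝ) : ℂ))
        + (Complex.I * η - κ) / (z - κ) *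
          (((Real.exp (-z * s) : ℝ) : ℂ) / ((z ^ 2 + η ^ 2 : ℝ) : ℂ)) := by
  set a : ℝ → ℂ := fun y => Complex.exp (-Complex.I * ((y : ℂ) * η)) with ha
  have hn : ∀ y, ‖a y‖ = 1 := fun y => by
    have := norm_exp_I_mul_ofReal (-(y * η))
    rwa [Complex.ofReal_neg, mul_neg, ← neg_mul, Complex.ofReal_mul] at this
  have hd : ∀ y, HasDerivAt a (-Complex.I * η * a y) y := fun y => by
    have h1 : HasDerivAt (fun y : ℝ => -Complex.I * ((y : ℂ) * η)) (-Complex.I * η) y := by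
      have := ((hasDerivAt_id y).ofReal_comp.mul_const (η : ℂ)).const_mul (-Complex.I)
      simpa using this
    exact h1.cexp.congr_deriv (by simp only [ha]; ring)
  have hca : Continuous a := continuous_iff_continuousAt.2 fun y => (hd y).continuousAt
  have hA : ∀ y, ‖a y‖ ≤ 1 + |η| := fun y => by rw [hn]; linarith [abs_nonneg η]
  have hA' : ∀ y, ‖-Complex.I * η * a y‖ ≤ 1 + |η| := fun y => by
    rw [norm_mul, hn]; simp
  have hc' : Continuous fun y => -Complex.I * η * a y := by fun_prop
  have eA := integral_expK_mul_deriv hz hs hd hc' hA hA'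
  have eB := integral_sg_expK_mul_deriv hz hs hd hc' hA hA'
  have eC := integral_expF_mul_deriv hz s hd hc' hA hA'
  rw [integral_greenK_mul hz s hca hA]
  simp only [mul_left_comm _ (-Complex.I * (η : ℂ)), integral_const_mul] at eA eB eC
  have a0 : a 0 = 1 := by simp [ha]
  rw [a0] at eA eB eC
  set X := ∫ y in Set.Ioi (0 : ℝ), (expK z y s : ℂ) * a y
  set Y := ∫ y in Set.Ioi (0 : ℝ), (sg (y - s) : ℂ) * ((expK z y s : ℂ) * a y)
  set Z := ∫ y in Set.Ioi (0 : ℝ), (expF z y s : ℂ) * a y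
  set ε : ℂ := ((Real.exp (-z * s) : ℝ) : ℂ)
  have h1 : (z : ℂ) ≠ 0 := by exact_mod_cast hz.ne'
  have h2 : (z : ℂ) - κ ≠ 0 := by
    rw [sub_ne_zero]
    exact_mod_cast hκ.symm
  have h3 : (z : ℂ) ^ 2 + (η : ℂ) ^ 2 ≠ 0 := by
    have : z ^ 2 + η ^ 2 ≠ 0 := by positivity
    exact_mod_cast this
  -- Elimination of `Y` between the two identities for the free kernel.
  have hX : X = (2 * z * a s - (z + Complex.I * η) * ε) / (z ^ 2 + η ^ 2) := by
    rw [eq_div_iff h3]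
    linear_combination (Complex.I * η) * eA - z * eB + X * η ^ 2 * Complex.I_sq
  have hZ : Z = (z - Complex.I * η) * ε / (z ^ 2 + η ^ 2) := by
    rw [eq_div_iff h3]
    linear_combination (-(z - Complex.I * η)) * eC + Z * η ^ 2 * Complex.I_sq
  rw [hX, hZ]
  change _ = -(a s / _) + _
  generalize a s = b
  push_cast
  field_simp
  ring

/-- The reflected kernel is dominated by the free one, and the coefficients then add up to `1 / (z -
κ)`. The bound is written with `z² - κ²` because at the frequencies in use this equals `k 0 ^ 2 + k
2 ^ 2`. -/
lemma abs_greenK_le {y s : ℝ} (hκ : |κ| < z) (hy : 0 ≤ y) (hs : 0 ≤ s) :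
    |greenK z κ y s| ≤ 2 * z / (z ^ 2 - κ ^ 2) * expK z y s := by
  obtain ⟨hl, hr⟩ := abs_lt.1 hκ
  have hz : 0 < z := (abs_nonneg κ).trans_lt hκ
  have hd : 0 < z - κ := by linarith
  have hp : 0 < z + κ := by linarith
  have hF := expF_le_expK hz.le hy hs
  have hF0 := (expF_pos z y s).le
  have hK0 := (expK_pos z y s).le
  have hc : 0 < (z + κ) / (z - κ) := by positivity
  unfold greenK
  rw [abs_mul, abs_neg, abs_of_pos (by positivity : 0 < 1 / (2 * z)),
    abs_of_nonneg (by positivity)]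
  calc 1 / (2 * z) * (expK z y s + (z + κ) / (z - κ) * expF z y s)
      ≤ 1 / (2 * z) * (expK z y s + (z + κ) / (z - κ) * expK z y s) := by gcongr
    _ = 1 / (z - κ) * expK z y s := by field_simp; ring
    _ ≤ 2 * z / (z ^ 2 - κ ^ 2) * expK z y s := by
      refine mul_le_mul_of_nonneg_right ?_ hK0
      rw [show z ^ 2 - κ ^ 2 = (z - κ) * (z + κ) by ring, div_le_div_iff₀ hd (by positivity)]
      nlinarith

lemma norm_dbarK_le {y s : ℝ} (hκ : |κ| ≤ z) (hz : 0 < z) (hy : 0 ≤ y) (hs : 0 ≤ s) :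
    ‖dbarK z κ y s‖ ≤ expK z y s := by
  have hF := expF_le_expK hz.le hy hs
  have hF0 := (expF_pos z y s).le
  have hK0 := (expK_pos z y s).le
  unfold dbarK
  rw [norm_mul, norm_neg, norm_div, Complex.norm_I, Complex.norm_real, Real.norm_eq_abs]
  have h4 : ‖(4 * z : ℂ)‖ = 4 * z := by
    rw [norm_mul, Complex.norm_real, Real.norm_of_nonneg hz.le]; norm_num
  rw [h4, div_mul_eq_mul_div, one_mul, div_le_iff₀ (by positivity)]
  have h1 : |κ - z * sg (y - s)| ≤ 2 * z := by
    refine (abs_sub _ _).trans ?_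
    rw [abs_mul, abs_sg, abs_of_pos hz]
    linarith
  have h2 : |z + κ| ≤ 2 * z := by
    refine (abs_add_le _ _).trans ?_
    rw [abs_of_pos hz]
    linarith
  refine (abs_sub _ _).trans ?_
  rw [abs_mul, abs_mul, abs_of_nonneg hK0, abs_of_nonneg hF0]
  have h3 : |κ - z * sg (y - s)| * expK z y s ≤ 2 * z * expK z y s := by gcongr
  have h5 : |z + κ| * expF z y s ≤ 2 * z * expK z y s := by gcongr
  linarith

/-- This is the boundary condition built into `greenK`: below the source the sign is `-1`, and at `y
= 0` the two terms are `(κ + z) e^{-z s}` and its negative. -/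
lemma tendsto_dbarK {s : ℝ} (hs : 0 < s) :
    Tendsto (fun y => dbarK z κ y s) (𝓝 0) (𝓝 0) := by
  have h : Tendsto (fun y : ℝ => -(Complex.I / (4 * z)) *
      (((κ - z * (-1)) * Real.exp (-z * |y - s|) - (z + κ) * Real.exp (-z * (y + s)) : ℝ) : ℂ))
      (𝓝 0) (𝓝 (-(Complex.I / (4 * z)) *
      (((κ - z * (-1)) * Real.exp (-z * |0 - s|) - (z + κ) * Real.exp (-z * (0 + s)) : ℝ) : ℂ))) :=
    Continuous.tendsto (by fun_prop) 0
  have e : (-(Complex.I / (4 * z)) *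
      (((κ - z * (-1)) * Real.exp (-z * |0 - s|) - (z + κ) * Real.exp (-z * (0 + s)) : ℝ) : ℂ))
      = 0 := by
    rw [zero_sub, abs_neg, abs_of_pos hs, zero_add]
    have : (κ - z * (-1)) * Real.exp (-z * s) - (z + κ) * Real.exp (-z * s) = 0 := by ring
    rw [this]
    simp
  rw [e] at h
  refine h.congr' ?_
  filter_upwards [eventually_lt_nhds hs] with y hy
  have : sg (y - s) = -1 := if_neg (by linarith)
  simp only [dbarK, this, expK, expF]

end Kernel

/-! ### Amplitudes of the solution and of its derivative -/

lemma measurable_src_comp {α : Type*} [MeasurableSpace α] (G : 𝓢(R4, ℂ)) {k : α → R3} {t : α → ℝ}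
    (hk : Measurable k) (ht : Measurable t) : Measurable (fun x => src G (k x) (t x)) := by
  have h := (measurable_src G).comp (hk.prodMk ht)
  exact h

lemma measurable_src_left (G : 𝓢(R4, ℂ)) (k : R3) : Measurable (fun s => src G k s) :=
  measurable_src_comp G measurable_const measurable_id

lemma norm_sq_R3 (k : R3) : ‖k‖ ^ 2 = k 0 ^ 2 + k 1 ^ 2 + k 2 ^ 2 := by
  rw [EuclideanSpace.norm_sq_eq, Fin.sum_univ_three]
  simp

lemma abs_lt_norm {k : R3} (hk : k 2 ≠ 0) : |k 1| < ‖k‖ := by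
  refine abs_lt_of_sq_lt_sq ?_ (norm_nonneg _)
  rw [norm_sq_R3]
  have := sq_pos_of_ne_zero hk
  nlinarith [sq_nonneg (k 0)]

lemma norm_pos_of_ne {k : R3} (hk : k 2 ≠ 0) : 0 < ‖k‖ := (abs_nonneg _).trans_lt (abs_lt_norm hk)

lemma one_add_norm_le (k : R3) : 1 + ‖k‖ ≤ (1 + |k 0|) * (1 + |k 1|) * (1 + |k 2|) := by
  have h0 := abs_nonneg (k 0)
  have h1 := abs_nonneg (k 1)
  have h2 := abs_nonneg (k 2)
  have h : ‖k‖ ≤ |k 0| + |k 1| + |k 2| := by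
    refine le_of_sq_le_sq ?_ (by positivity)
    rw [norm_sq_R3, ← sq_abs (k 0), ← sq_abs (k 1), ← sq_abs (k 2)]
    nlinarith [mul_nonneg h0 h1, mul_nonneg h0 h2, mul_nonneg h1 h2]
  nlinarith [mul_nonneg h0 h1, mul_nonneg h0 h2, mul_nonneg h1 h2,
    mul_nonneg (mul_nonneg h0 h1) h2]

/-- The amplitude of the solution at frequency `k` and height `y`. -/
noncomputable def solW (G : R4 → ℂ) (k : R3) (y : ℝ) : ℂ :=
  ∫ s in Set.Ioi (0 : ℝ), (greenK ‖k‖ (k 1) y s : ℂ) * src G k s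

/-- The amplitude of the `∂/∂z̄₂`-derivative of the solution. -/
noncomputable def solV (G : R4 → ℂ) (k : R3) (y : ℝ) : ℂ :=
  ∫ s in Set.Ioi (0 : ℝ), dbarK ‖k‖ (k 1) y s * src G k s

/-- The weight which controls `solW`. -/
noncomputable def weightW (k : R3) : ℝ :=
  |k 2| / (k 0 ^ 2 + k 2 ^ 2) * (((1 + |k 0|) ^ 2)⁻¹ * ((1 + |k 1|) ^ 2)⁻¹ * (1 + |k 2|)⁻¹)

/-- The square integrable weight which controls `solV`. -/
noncomputable def weightV (k : R3) : ℝ :=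
  ((1 + |k 0|) ^ 2)⁻¹ * ((1 + |k 1|) ^ 2)⁻¹ * (1 + |k 2|)⁻¹

lemma weightW_nonneg (k : R3) : 0 ≤ weightW k := by unfold weightW; positivity

lemma weightV_nonneg (k : R3) : 0 ≤ weightV k := by unfold weightV; positivity

lemma measurable_weightW : Measurable weightW := by unfold weightW; fun_prop

lemma srcWeight_mul_le (k : R3) : srcWeight k * (1 + ‖k‖) ≤ |k 2| * weightV k := by
  calc srcWeight k * (1 + ‖k‖)
      ≤ srcWeight k * ((1 + |k 0|) * (1 + |k 1|) * (1 + |k 2|)) :=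
        mul_le_mul_of_nonneg_left (one_add_norm_le k) (srcWeight_nonneg k)
    _ = |k 2| * weightV k := by
        unfold srcWeight weightV
        have h0 : 0 < 1 + |k 0| := by positivity
        have h1 : 0 < 1 + |k 1| := by positivity
        have h2 : 0 < 1 + |k 2| := by positivity
        field_simp

lemma weightW_eq (k : R3) : weightW k = |k 2| * weightV k / (k 0 ^ 2 + k 2 ^ 2) := by
  unfold weightW weightV; ring

lemma srcWeight_eq_zero {k : R3} (hk : k 2 = 0) : srcWeight k = 0 := by
  simp [srcWeight, hk]

lemma src_eq_zero (G : 𝓢(R4, ℂ)) {k : R3} (hk : k 2 = 0) (t : ℝ) : src G k t = 0 := by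
  obtain ⟨C, -, h⟩ := exists_src_bound G
  have := h k t
  rw [srcWeight_eq_zero hk, zero_mul, mul_zero] at this
  exact norm_le_zero_iff.1 this

lemma norm_sq_sub (k : R3) : ‖k‖ ^ 2 - k 1 ^ 2 = k 0 ^ 2 + k 2 ^ 2 := by
  rw [norm_sq_R3]; ring

lemma integrableOn_inv_pow {n : ℕ} (hn : 2 ≤ n) :
    IntegrableOn (fun s : ℝ => ((1 + |s|) ^ n)⁻¹) (Set.Ioi 0) :=
  (integrable_inv_one_add_abs_pow hn).integrableOn

lemma one_add_mul_inv_pow {s : ℝ} (hs : 0 ≤ s) : (1 + s) * ((1 + |s|) ^ 3)⁻¹ = ((1 + |s|) ^ 2)⁻¹ := by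
  rw [abs_of_nonneg hs]
  field_simp

/-- The kernel costs `1 / (k 0 ^ 2 + k 2 ^ 2)` and the source supplies `|k 2|`, leaving a
singularity of order one in the two variables `(k 0, k 2)`. Decay in the height comes from
`mul_expK_le`, whose factors `1 + ‖k‖` and `1 + s` are absorbed by `srcWeight` and by the decay of
`src` in `s`. -/
lemma exists_greenK_src_bound (G : 𝓢(R4, ℂ)) : ∃ C : ℝ, 0 ≤ C ∧ ∀ (k : R3) (y s : ℝ), 0 ≤ y → 0 ≤ s →
    ‖(greenK ‖k‖ (k 1) y s : ℂ) * src G k s‖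
      ≤ C * weightW k * (1 + y)⁻¹ * ((1 + |s|) ^ 2)⁻¹ := by
  obtain ⟨C, hC, h⟩ := exists_src_bound G
  refine ⟨2 * C, by positivity, fun k y s hy hs => ?_⟩
  by_cases hk : k 2 = 0
  · rw [src_eq_zero G hk, mul_zero, norm_zero]
    have := weightW_nonneg k
    positivity
  · have hz := norm_pos_of_ne hk
    have hρ : 0 < k 0 ^ 2 + k 2 ^ 2 := by positivity
    have hB := srcWeight_nonneg k
    rw [norm_mul, Complex.norm_real, Real.norm_eq_abs]
    have hg := abs_greenK_le (abs_lt_norm hk) hy hs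
    rw [norm_sq_sub] at hg
    have hE := mul_expK_le hz.le hy hs
    calc |greenK ‖k‖ (k 1) y s| * ‖src G k s‖
        ≤ (2 * ‖k‖ / (k 0 ^ 2 + k 2 ^ 2) * expK ‖k‖ y s) *
            (C * (srcWeight k * ((1 + |s|) ^ 3)⁻¹)) :=
          mul_le_mul hg (h k s) (norm_nonneg _) (le_trans (abs_nonneg _) hg)
      _ = (2 * C / (k 0 ^ 2 + k 2 ^ 2) * srcWeight k * ((1 + |s|) ^ 3)⁻¹) *
            (‖k‖ * expK ‖k‖ y s) := by ring
      _ ≤ (2 * C / (k 0 ^ 2 + k 2 ^ 2) * srcWeight k * ((1 + |s|) ^ 3)⁻¹) *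
            ((1 + ‖k‖) * (1 + s) * (1 + y)⁻¹) :=
          mul_le_mul_of_nonneg_left hE (by positivity)
      _ = 2 * C / (k 0 ^ 2 + k 2 ^ 2) * (srcWeight k * (1 + ‖k‖)) * (1 + y)⁻¹ *
            ((1 + s) * ((1 + |s|) ^ 3)⁻¹) := by ring
      _ ≤ 2 * C / (k 0 ^ 2 + k 2 ^ 2) * (|k 2| * weightV k) * (1 + y)⁻¹ *
            ((1 + s) * ((1 + |s|) ^ 3)⁻¹) := by
          have := srcWeight_mul_le k
          gcongr
      _ = 2 * C * weightW k * (1 + y)⁻¹ * ((1 + |s|) ^ 2)⁻¹ := by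
          rw [one_add_mul_inv_pow hs, weightW_eq]; ring

lemma exists_solW_bound (G : 𝓢(R4, ℂ)) : ∃ C : ℝ, 0 ≤ C ∧ ∀ (k : R3) (y : ℝ), 0 ≤ y →
    ‖solW G k y‖ ≤ C * weightW k * (1 + y)⁻¹ := by
  obtain ⟨C, hC, h⟩ := exists_greenK_src_bound G
  refine ⟨C * decayConst, mul_nonneg hC decayConst_nonneg, fun k y hy => ?_⟩
  have hW := weightW_nonneg k
  have h1 : ‖solW G k y‖ ≤ ∫ s in Set.Ioi (0 : ℝ), C * weightW k * (1 + y)⁻¹ * ((1 + |s|) ^ 2)⁻¹ := by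
    refine norm_integral_le_of_norm_le ((integrableOn_inv_pow le_rfl).const_mul _) ?_
    filter_upwards [ae_restrict_mem measurableSet_Ioi] with s hs
    exact h k y s hy (le_of_lt hs)
  rw [integral_const_mul] at h1
  refine h1.trans ?_
  have := mul_le_mul_of_nonneg_left setIntegral_inv_sq_le
    (show 0 ≤ C * weightW k * (1 + y)⁻¹ by positivity)
  linarith

lemma norm_dbarK_src_le {G : 𝓢(R4, ℂ)} {C : ℝ}
    (h : ∀ k t, ‖src G k t‖ ≤ C * (srcWeight k * ((1 + |t|) ^ 3)⁻¹)) (k : R3) {y s : ℝ}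
    (hy : 0 ≤ y) (hs : 0 ≤ s) :
    ‖dbarK ‖k‖ (k 1) y s * src G k s‖ ≤ expK ‖k‖ y s * (C * (srcWeight k * ((1 + |s|) ^ 3)⁻¹)) := by
  by_cases hk : k 2 = 0
  · rw [src_eq_zero G hk, mul_zero, norm_zero, srcWeight_eq_zero hk]
    simp
  · rw [norm_mul]
    exact mul_le_mul (norm_dbarK_le (abs_lt_norm hk).le (norm_pos_of_ne hk) hy hs) (h k s)
      (norm_nonneg _) (expK_pos _ _ _).le

lemma exists_solV_bound (G : 𝓢(R4, ℂ)) : ∃ C : ℝ, 0 ≤ C ∧ ∀ (k : R3) (y : ℝ), 0 ≤ y →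
    ‖solV G k y‖ ≤ C * weightV k * (1 + y)⁻¹ := by
  obtain ⟨C, hC, h⟩ := exists_src_bound G
  refine ⟨C * decayConst, mul_nonneg hC decayConst_nonneg, fun k y hy => ?_⟩
  have hV := weightV_nonneg k
  have h1 : ‖solV G k y‖ ≤ ∫ s in Set.Ioi (0 : ℝ), C * weightV k * (1 + y)⁻¹ * ((1 + |s|) ^ 2)⁻¹ := by
    refine norm_integral_le_of_norm_le ((integrableOn_inv_pow le_rfl).const_mul _) ?_
    filter_upwards [ae_restrict_mem measurableSet_Ioi] with s hs
    have hs : 0 ≤ s := le_of_lt hs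
    refine (norm_dbarK_src_le h k hy hs).trans ?_
    by_cases hk : k 2 = 0
    · rw [srcWeight_eq_zero hk, zero_mul, mul_zero, mul_zero]
      positivity
    have hz := norm_pos_of_ne hk
    have hB := srcWeight_nonneg k
    have hk2 : |k 2| ≤ ‖k‖ := abs_coord_le_norm k 2
    have hE := mul_expK_le hz.le hy hs
    refine le_of_mul_le_mul_left ?_ hz
    calc ‖k‖ * (expK ‖k‖ y s * (C * (srcWeight k * ((1 + |s|) ^ 3)⁻¹)))
        = C * srcWeight k * ((1 + |s|) ^ 3)⁻¹ * (‖k‖ * expK ‖k‖ y s) := by ring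
      _ ≤ C * srcWeight k * ((1 + |s|) ^ 3)⁻¹ * ((1 + ‖k‖) * (1 + s) * (1 + y)⁻¹) :=
          mul_le_mul_of_nonneg_left hE (by positivity)
      _ = C * (srcWeight k * (1 + ‖k‖)) * (1 + y)⁻¹ * ((1 + s) * ((1 + |s|) ^ 3)⁻¹) := by ring
      _ ≤ C * (‖k‖ * weightV k) * (1 + y)⁻¹ * ((1 + s) * ((1 + |s|) ^ 3)⁻¹) := by
          have := srcWeight_mul_le k
          have h4 : srcWeight k * (1 + ‖k‖) ≤ ‖k‖ * weightV k := this.trans (by gcongr)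
          gcongr C * ?_ * (1 + y)⁻¹ * ((1 + s) * ((1 + |s|) ^ 3)⁻¹)
      _ = ‖k‖ * (C * weightV k * (1 + y)⁻¹ * ((1 + |s|) ^ 2)⁻¹) := by
          rw [one_add_mul_inv_pow hs]; ring
  rw [integral_const_mul] at h1
  refine h1.trans ?_
  have := mul_le_mul_of_nonneg_left setIntegral_inv_sq_le
    (show 0 ≤ C * weightV k * (1 + y)⁻¹ by positivity)
  linarith

/-- Integrating the free kernel over the source height gives `2 / ‖k‖`, which uses up the factor `|k
2|` of the source. Compared with `exists_solV_bound`, decay in `y` is given up for one more power of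
decay in `k 2`. -/
lemma exists_solV_bound' (G : 𝓢(R4, ℂ)) : ∃ C : ℝ, 0 ≤ C ∧ ∀ (k : R3) (y : ℝ), 0 ≤ y →
    ‖solV G k y‖ ≤ C * ∏ j, ((1 + |k j|) ^ 2)⁻¹ := by
  obtain ⟨C, hC, h⟩ := exists_src_bound G
  refine ⟨2 * C, by positivity, fun k y hy => ?_⟩
  have hP : 0 ≤ ∏ j, ((1 + |k j|) ^ 2)⁻¹ := Finset.prod_nonneg fun j _ => by positivity
  by_cases hk : k 2 = 0
  · have : solV G k y = 0 := by simp [solV, src_eq_zero G hk]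
    rw [this, norm_zero]
    positivity
  have hz := norm_pos_of_ne hk
  have hB := srcWeight_nonneg k
  have h1 : ‖solV G k y‖ ≤ ∫ s in Set.Ioi (0 : ℝ), expK ‖k‖ s y * (C * srcWeight k) := by
    refine norm_integral_le_of_norm_le ((integrable_expK hz y).mul_const _).integrableOn ?_
    filter_upwards [ae_restrict_mem measurableSet_Ioi] with s hs
    refine (norm_dbarK_src_le h k hy (le_of_lt hs)).trans ?_
    rw [expK_comm]
    refine mul_le_mul_of_nonneg_left ?_ (expK_pos _ _ _).le
    refine mul_le_mul_of_nonneg_left (mul_le_of_le_one_right hB ?_) hC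
    exact inv_le_one_of_one_le₀ (one_le_pow₀ (by linarith [abs_nonneg s]))
  have h2 : ∫ s in Set.Ioi (0 : ℝ), expK ‖k‖ s y * (C * srcWeight k)
      ≤ ∫ s, expK ‖k‖ s y * (C * srcWeight k) :=
    setIntegral_le_integral ((integrable_expK hz y).mul_const _)
      (Eventually.of_forall fun s => mul_nonneg (expK_pos _ _ _).le (by positivity))
  rw [integral_mul_const (μ := volume), integral_expK hz] at h2
  refine (h1.trans h2).trans ?_
  have hk2 : |k 2| ≤ ‖k‖ := abs_coord_le_norm k 2
  have h3 : srcWeight k ≤ ‖k‖ * ∏ j, ((1 + |k j|) ^ 2)⁻¹ := by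
    unfold srcWeight
    rw [Fin.prod_univ_three, div_eq_mul_inv]
    have a0 : ((1 + |k 0|) ^ 3)⁻¹ ≤ ((1 + |k 0|) ^ 2)⁻¹ := by
      have : 1 ≤ 1 + |k 0| := by linarith [abs_nonneg (k 0)]
      gcongr
      norm_num
    have a1 : ((1 + |k 1|) ^ 3)⁻¹ ≤ ((1 + |k 1|) ^ 2)⁻¹ := by
      have : 1 ≤ 1 + |k 1| := by linarith [abs_nonneg (k 1)]
      gcongr
      norm_num
    calc _ ≤ ((1 + |k 0|) ^ 2)⁻¹ * (((1 + |k 1|) ^ 2)⁻¹ * (‖k‖ * ((1 + |k 2|) ^ 2)⁻¹)) := by gcongr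
      _ = _ := by ring
  calc 2 / ‖k‖ * (C * srcWeight k) ≤ 2 / ‖k‖ * (C * (‖k‖ * ∏ j, ((1 + |k j|) ^ 2)⁻¹)) := by gcongr
    _ = _ := by field_simp

lemma tendsto_solV (G : 𝓢(R4, ℂ)) (k : R3) :
    Tendsto (fun y => solV G k y) (𝓝[>] 0) (𝓝 0) := by
  obtain ⟨C, hC, h⟩ := exists_src_bound G
  have hsm := measurable_src_left G k
  have hlim := tendsto_integral_filter_of_dominated_convergence (l := 𝓝[>] (0 : ℝ))
    (μ := volume.restrict (Set.Ioi (0 : ℝ)))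
    (F := fun y s => dbarK ‖k‖ (k 1) y s * src G k s) (f := fun _ => 0)
    (fun s => C * srcWeight k * ((1 + |s|) ^ 3)⁻¹)
    (Eventually.of_forall fun y => ?_) ?_ ((integrableOn_inv_pow (by norm_num)).const_mul _) ?_
  · simpa [solV] using hlim
  · exact ((measurable_dbarK measurable_const measurable_const measurable_const
      measurable_id).mul hsm).aestronglyMeasurable
  · filter_upwards [self_mem_nhdsWithin] with y hy
    filter_upwards [ae_restrict_mem measurableSet_Ioi] with s hs
    refine (norm_dbarK_src_le h k (le_of_lt hy) (le_of_lt hs)).trans ?_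
    rw [mul_assoc]
    have hB := srcWeight_nonneg k
    exact mul_le_of_le_one_left (by positivity) (expK_le_one (norm_nonneg _) _ _)
  · filter_upwards [ae_restrict_mem measurableSet_Ioi] with s hs
    have := ((tendsto_dbarK (z := ‖k‖) (κ := k 1) hs).mono_left
      (nhdsWithin_le_nhds (s := Set.Ioi 0))).mul_const (src G k s)
    rwa [zero_mul] at this

lemma measurable_solW (G : 𝓢(R4, ℂ)) : Measurable (fun p : R3 × ℝ => solW G p.1 p.2) := by
  unfold solW
  have : StronglyMeasurable (fun q : (R3 × ℝ) × ℝ =>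
      (greenK ‖q.1.1‖ (q.1.1 1) q.1.2 q.2 : ℂ) * src G q.1.1 q.2) := by
    refine Measurable.stronglyMeasurable (Measurable.mul ?_ ?_)
    · exact measurable_greenK (by fun_prop) (by fun_prop) (by fun_prop) (by fun_prop)
    · exact measurable_src_comp G (by fun_prop) (by fun_prop)
  exact (this.integral_prod_right (ν := (volume : Measure ℝ).restrict (Set.Ioi 0))).measurable

lemma measurable_solV (G : 𝓢(R4, ℂ)) : Measurable (fun p : R3 × ℝ => solV G p.1 p.2) := by
  unfold solV
  have : StronglyMeasurable (fun q : (R3 × ℝ) × ℝ =>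
      dbarK ‖q.1.1‖ (q.1.1 1) q.1.2 q.2 * src G q.1.1 q.2) := by
    refine Measurable.stronglyMeasurable (Measurable.mul ?_ ?_)
    · exact measurable_dbarK (by fun_prop) (by fun_prop) (by fun_prop) (by fun_prop)
    · exact measurable_src_comp G (by fun_prop) (by fun_prop)
  exact (this.integral_prod_right (ν := (volume : Measure ℝ).restrict (Set.Ioi 0))).measurable

lemma solW_odd (G : 𝓢(R4, ℂ)) (a b c y : ℝ) : solW G !₂[a, b, -c] y = -solW G !₂[a, b, c] y := by
  unfold solW
  rw [← integral_neg]
  congr 1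
  ext s
  have hn : ‖(!₂[a, b, -c] : R3)‖ = ‖(!₂[a, b, c] : R3)‖ := by
    rw [EuclideanSpace.norm_eq, EuclideanSpace.norm_eq]
    simp [Fin.sum_univ_three]
  rw [hn, src_odd]
  simp

lemma solV_odd (G : 𝓢(R4, ℂ)) (a b c y : ℝ) : solV G !₂[a, b, -c] y = -solV G !₂[a, b, c] y := by
  unfold solV
  rw [← integral_neg]
  congr 1
  ext s
  have hn : ‖(!₂[a, b, -c] : R3)‖ = ‖(!₂[a, b, c] : R3)‖ := by
    rw [EuclideanSpace.norm_eq, EuclideanSpace.norm_eq]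
    simp [Fin.sum_univ_three]
  rw [hn, src_odd]
  simp

lemma integrable_expK_prod {z : ℝ} (hz : 0 < z) :
    Integrable (fun p : ℝ × ℝ => expK z p.1 p.2 * ((1 + |p.2|) ^ 3)⁻¹) (volume.prod volume) := by
  have hm : Measurable (fun p : ℝ × ℝ => expK z p.1 p.2 * ((1 + |p.2|) ^ 3)⁻¹) := by
    unfold expK
    fun_prop
  refine (integrable_prod_iff' hm.aestronglyMeasurable).2
    ⟨Eventually.of_forall fun s => (integrable_expK hz s).mul_const (((1 + |s|) ^ 3)⁻¹), ?_⟩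
  have : ∀ s, ∫ y, ‖expK z y s * ((1 + |s|) ^ 3)⁻¹‖ = 2 / z * ((1 + |s|) ^ 3)⁻¹ := by
    intro s
    rw [← integral_expK hz s, ← integral_mul_const]
    congr 1
    ext y
    have := (expK_pos z y s).le
    exact Real.norm_of_nonneg (by positivity)
  simp only [this]
  exact (integrable_inv_one_add_abs_pow (by norm_num)).const_mul _

/-! ### Interchanging the height and source integrals -/

section Swap

variable (G : 𝓢(R4, ℂ)) {k : R3} {b : ℝ → ℂ} {A : ℝ}

lemma integrable_kernel_mul (hz : 0 < ‖k‖) {N : ℝ → ℝ → ℂ} {D : ℝ}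
    (hN : Measurable (fun p : ℝ × ℝ => N p.1 p.2))
    (hb : ∀ y s, 0 < y → 0 < s → ‖N y s‖ ≤ D * expK ‖k‖ y s) (hbm : Measurable b)
    (hA : ∀ y, ‖b y‖ ≤ A) :
    Integrable (fun p : ℝ × ℝ => N p.1 p.2 * src G k p.2 * b p.1)
      ((volume.restrict (Set.Ioi 0)).prod (volume.restrict (Set.Ioi 0))) := by
  obtain ⟨C, hC, h⟩ := exists_src_bound G
  have hsm := measurable_src_left G k
  refine Integrable.mono' (g := fun p : ℝ × ℝ => D * C * srcWeight k * A *
    (expK ‖k‖ p.1 p.2 * ((1 + |p.2|) ^ 3)⁻¹)) ?_ ?_ ?_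
  · rw [Measure.prod_restrict]
    exact ((integrable_expK_prod hz).const_mul _).integrableOn
  · exact ((hN.mul (hsm.comp measurable_snd)).mul
      (hbm.comp measurable_fst)).aestronglyMeasurable
  · rw [Measure.prod_restrict]
    filter_upwards [ae_restrict_mem (measurableSet_Ioi.prod measurableSet_Ioi)] with p hp
    rw [norm_mul, norm_mul]
    have h1 := hb p.1 p.2 hp.1 hp.2
    calc ‖N p.1 p.2‖ * ‖src G k p.2‖ * ‖b p.1‖
        ≤ (D * expK ‖k‖ p.1 p.2) * (C * (srcWeight k * ((1 + |p.2|) ^ 3)⁻¹)) * A := by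
          have := (norm_nonneg _).trans h1
          have := (norm_nonneg _).trans (h k p.2)
          gcongr
          · exact h k p.2
          · exact hA p.1
      _ = _ := by ring

/-- Interchange of the integrals over the height and over the source. -/
lemma integral_kernel_swap (hz : 0 < ‖k‖) {N : ℝ → ℝ → ℂ} {D : ℝ}
    (hN : Measurable (fun p : ℝ × ℝ => N p.1 p.2))
    (hb : ∀ y s, 0 < y → 0 < s → ‖N y s‖ ≤ D * expK ‖k‖ y s) (hbm : Measurable b)
    (hA : ∀ y, ‖b y‖ ≤ A) :
    ∫ y in Set.Ioi (0 : ℝ), (∫ s in Set.Ioi (0 : ℝ), N y s * src G k s) * b y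
      = ∫ s in Set.Ioi (0 : ℝ), src G k s * ∫ y in Set.Ioi (0 : ℝ), N y s * b y := by
  have hint := integrable_kernel_mul G hz hN hb hbm hA
  simp only [← integral_mul_const, ← integral_const_mul]
  rw [integral_integral_swap hint]
  congr 1
  ext s
  congr 1
  ext y
  ring

lemma norm_greenK_le (hk : k 2 ≠ 0) {y s : ℝ} (hy : 0 < y) (hs : 0 < s) :
    ‖(greenK ‖k‖ (k 1) y s : ℂ)‖ ≤ 2 * ‖k‖ / (‖k‖ ^ 2 - k 1 ^ 2) * expK ‖k‖ y s := by
  rw [Complex.norm_real]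
  exact abs_greenK_le (abs_lt_norm hk) hy.le hs.le

/-- The pointwise bound `(1 + y)⁻¹` is not integrable. Integrability in `y` comes from the joint
integrability of kernel times source. -/
lemma integrableOn_solW (hk : k 2 ≠ 0) : IntegrableOn (solW G k) (Set.Ioi 0) := by
  have h := (integrable_kernel_mul G (norm_pos_of_ne hk)
    (measurable_greenK measurable_const measurable_const measurable_fst measurable_snd)
    (fun y s hy hs => norm_greenK_le hk hy hs) (b := fun _ => 1) (A := 1) measurable_const
    (fun _ => by simp)).integral_prod_left
  simp only [mul_one] at h
  exact h

lemma integral_solW_mul (hk : k 2 ≠ 0) (hbm : Measurable b) (hA : ∀ y, ‖b y‖ ≤ A) :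
    ∫ y in Set.Ioi (0 : ℝ), solW G k y * b y = ∫ s in Set.Ioi (0 : ℝ), src G k s *
      ∫ y in Set.Ioi (0 : ℝ), (greenK ‖k‖ (k 1) y s : ℂ) * b y := by
  refine integral_kernel_swap G (norm_pos_of_ne hk)
    (D := 2 * ‖k‖ / (‖k‖ ^ 2 - k 1 ^ 2)) ?_ (fun y s hy hs => ?_) hbm hA
  · exact measurable_greenK measurable_const measurable_const measurable_fst measurable_snd
  · exact norm_greenK_le hk hy hs

lemma integral_solV_mul (hk : k 2 ≠ 0) (hbm : Measurable b) (hA : ∀ y, ‖b y‖ ≤ A) :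
    ∫ y in Set.Ioi (0 : ℝ), solV G k y * b y = ∫ s in Set.Ioi (0 : ℝ), src G k s *
      ∫ y in Set.Ioi (0 : ℝ), dbarK ‖k‖ (k 1) y s * b y := by
  refine integral_kernel_swap G (norm_pos_of_ne hk) (D := 1) ?_ (fun y s hy hs => ?_) hbm hA
  · exact measurable_dbarK measurable_const measurable_const measurable_fst measurable_snd
  · rw [one_mul]
    exact norm_dbarK_le (abs_lt_norm hk).le (norm_pos_of_ne hk) hy.le hs.le

end Swap

/-! ### Fourier inversion and Parseval for `osc` -/

section Inversion

variable {V : Type*} [NormedAddCommGroup V] [InnerProductSpace ℝ V] [MeasurableSpace V]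
  [BorelSpace V] [FiniteDimensional ℝ V]

/-- This is the standard inversion formula after the dilation by `-(2π)⁻¹`, whose Jacobian produces
the power of `2π`. -/
lemma osc_osc_neg {ψ : V → ℂ} (hc : Continuous ψ) (hi : Integrable ψ) (ho : Integrable (osc ψ))
    (x : V) : osc (osc ψ) (-x) = ((2 * Real.pi : ℝ) : ℂ) ^ Module.finrank ℝ V * ψ x := by
  have hπ : (2 * Real.pi : ℝ) ≠ 0 := by positivity
  have hr : (-(2 * Real.pi)⁻¹ : ℝ) ≠ 0 := neg_ne_zero.2 (inv_ne_zero hπ)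
  have hF : Integrable (𝓕 ψ) := by
    have h : Integrable (fun x => 𝓕 ψ ((-(2 * Real.pi)⁻¹ : ℝ) • x)) := by
      simpa only [← osc_eq_fourier] using ho
    exact (integrable_comp_smul_iff volume _ hr).1 h
  have hinv := congrFun (hc.fourierInv_fourier_eq hi hF) x
  rw [Real.fourierInv_eq'] at hinv
  set f : V → ℂ := fun m => 𝓕 ψ m * Complex.exp (((2 * Real.pi * inner ℝ m x : ℝ) : ℂ) * Complex.I)
    with hf
  have h1 : osc (osc ψ) (-x) = ∫ k, f ((-(2 * Real.pi)⁻¹ : ℝ) • k) := by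
    unfold osc
    congr 1
    ext k
    simp only [hf, ← osc_eq_fourier]
    unfold osc
    congr 2
    rw [inner_smul_left, real_inner_comm, inner_neg_right]
    have : (Real.pi : ℂ) ≠ 0 := by exact_mod_cast Real.pi_ne_zero
    simp
    field_simp
  rw [h1, Measure.integral_comp_smul]
  have h2 : ∫ m, f m = ψ x := by
    rw [← hinv]
    congr 1
    ext m
    rw [smul_eq_mul, mul_comm, hf]
  rw [h2, Complex.real_smul]
  congr 1
  rw [neg_pow, mul_inv, abs_mul, abs_inv, abs_pow, abs_neg, abs_one, one_pow, inv_one, one_mul,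
    inv_pow, inv_inv, abs_of_pos (by positivity)]
  push_cast
  rfl

lemma integral_osc_mul {f g : V → ℂ} (hf : Integrable f) (hg : Integrable g) :
    ∫ x, osc f x * g x = ∫ x, f x * osc g x := by
  have hint : Integrable (fun p : V × V => g p.1 * f p.2 *
      Complex.exp (Complex.I * ((inner ℝ p.1 p.2 : ℝ) : ℂ))) (volume.prod volume) := by
    refine (hg.mul_prod hf).mul_bdd (c := 1) (by fun_prop) (Eventually.of_forall fun p => ?_)
    rw [norm_exp_I_mul_ofReal]
  unfold osc
  simp only [← integral_mul_const, ← integral_const_mul]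
  calc _ = ∫ x, ∫ k, g x * f k * Complex.exp (Complex.I * ((inner ℝ x k : ℝ) : ℂ)) := by
        congr 1; ext x; congr 1; ext k; ring
    _ = ∫ k, ∫ x, g x * f k * Complex.exp (Complex.I * ((inner ℝ x k : ℝ) : ℂ)) :=
        integral_integral_swap hint
    _ = _ := by
        congr 1; ext k; congr 1; ext x; rw [real_inner_comm]; ring

lemma osc_comp_neg (h : V → ℂ) (x : V) : osc (fun k => h (-k)) x = osc h (-x) := by
  unfold osc
  rw [← integral_neg_eq_self]
  simp

/-- Parseval's identity for `osc`. -/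
lemma integral_osc_neg_mul_osc {f ψ : V → ℂ} (hf : Integrable f) (hc : Continuous ψ)
    (hi : Integrable ψ) (ho : Integrable (osc ψ)) :
    ∫ k, osc f (-k) * osc ψ k
      = ((2 * Real.pi : ℝ) : ℂ) ^ Module.finrank ℝ V * ∫ x, f x * ψ x := by
  rw [← integral_neg_eq_self]
  simp only [neg_neg]
  rw [integral_osc_mul hf ho.comp_neg, ← integral_const_mul]
  congr 1
  ext x
  rw [osc_comp_neg, osc_osc_neg hc hi ho]
  ring

end Inversion

/-! ### Partial transforms of Schwartz functions -/

section Schwartz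

variable {n : ℕ}

lemma osc_schwartz_lineDeriv (Φ : 𝓢(EuclideanSpace ℝ (Fin n), ℂ)) (j : Fin n)
    (x : EuclideanSpace ℝ (Fin n)) :
    osc (LineDeriv.lineDerivOp (EuclideanSpace.single j (1 : ℝ)) Φ) x
      = -(Complex.I * (x j : ℂ)) * osc Φ x := by
  rw [osc_lineDeriv (f := Φ) (v := EuclideanSpace.single j (1 : ℝ)) Φ.integrable
    (SchwartzMap.integrable _)]
  · simp [EuclideanSpace.inner_single_right]
  · intro s
    rw [SchwartzMap.lineDerivOp_apply_eq_fderiv]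
    exact (Φ.differentiableAt.hasFDerivAt).hasLineDerivAt _

lemma sq_weight_le {a x c d : ℝ} (ha : 0 ≤ a) (hx : 0 ≤ x) (h0 : x ≤ c) (h2 : a * (a * x) ≤ d) :
    x ≤ 2 * (c + d) * ((1 + a) ^ 2)⁻¹ := by
  rw [← div_eq_mul_inv, le_div_iff₀ (by positivity)]
  nlinarith [mul_nonneg hx (sq_nonneg (a - 1))]

end Schwartz

/-- The partial transform of `φ` in the first three variables. -/
noncomputable def til (φ : R4 → ℂ) (k : R3) (y : ℝ) : ℂ :=
  osc (fun s : R3 => φ (insEquiv (3 : Fin 4) (s, y))) k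

lemma insEquiv_three_eq_add (s : R3) (y : ℝ) : insEquiv (3 : Fin 4) (s, y) =
    insEquiv (3 : Fin 4) (s, 0) + y • EuclideanSpace.single (3 : Fin 4) (1 : ℝ) := by
  rw [insEquiv_three, insEquiv_three]
  ext j
  fin_cases j <;> simp

lemma continuous_insEquiv_three : Continuous (fun p : R3 × ℝ => insEquiv (3 : Fin 4) p) := by
  have : (fun p : R3 × ℝ => insEquiv (3 : Fin 4) p)
      = fun p => (!₂[p.1 0, p.1 1, p.1 2, p.2] : R4) := by
    ext p : 1
    exact insEquiv_three p.1 p.2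
  rw [this]
  fun_prop

lemma hasDerivAt_schwartz_last (Φ : 𝓢(R4, ℂ)) (s : R3) (y : ℝ) :
    HasDerivAt (fun y : ℝ => Φ (insEquiv (3 : Fin 4) (s, y)))
      (LineDeriv.lineDerivOp (EuclideanSpace.single (3 : Fin 4) (1 : ℝ)) Φ
        (insEquiv (3 : Fin 4) (s, y))) y := by
  have h2 : HasDerivAt (fun y : ℝ => insEquiv (3 : Fin 4) (s, y))
      (EuclideanSpace.single (3 : Fin 4) (1 : ℝ)) y := by
    have h1 : (fun y : ℝ => insEquiv (3 : Fin 4) (s, y)) = fun y =>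
      insEquiv (3 : Fin 4) (s, 0) + y • EuclideanSpace.single (3 : Fin 4) (1 : ℝ) :=
      funext (insEquiv_three_eq_add s)
    rw [h1]
    have := ((hasDerivAt_id y).smul_const
      (EuclideanSpace.single (3 : Fin 4) (1 : ℝ))).const_add (insEquiv (3 : Fin 4) (s, 0))
    simpa using this
  rw [SchwartzMap.lineDerivOp_apply_eq_fderiv]
  exact (Φ.differentiableAt.hasFDerivAt).comp_hasDerivAt y h2

lemma continuous_slice (Φ : 𝓢(R4, ℂ)) (y : ℝ) :
    Continuous (fun s : R3 => Φ (insEquiv (3 : Fin 4) (s, y))) :=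
  Φ.continuous.comp (continuous_insEquiv_three.comp (by fun_prop))

lemma exists_slice_bound (Φ : 𝓢(R4, ℂ)) :
    ∃ C : ℝ, 0 ≤ C ∧ ∀ (s : R3) (y : ℝ), ‖Φ (insEquiv (3 : Fin 4) (s, y))‖
      ≤ C * ((1 + |y|) ^ 2)⁻¹ * ∏ j, ((1 + |s j|) ^ 2)⁻¹ := by
  obtain ⟨C, hC, hb⟩ := exists_schwartz_bound Φ 2
  refine ⟨C, hC, fun s t => (hb _).trans (le_of_eq ?_)⟩
  simp [Fin.prod_univ_four, Fin.prod_univ_three, insEquiv_three]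
  ring

lemma integrable_slice (Φ : 𝓢(R4, ℂ)) (y : ℝ) :
    Integrable (fun s : R3 => Φ (insEquiv (3 : Fin 4) (s, y))) := by
  obtain ⟨C, -, hb⟩ := exists_slice_bound Φ
  exact Integrable.mono' ((integrable_decay le_rfl).const_mul (C * ((1 + |y|) ^ 2)⁻¹))
    (continuous_slice Φ y).aestronglyMeasurable (Eventually.of_forall fun s => hb s y)

lemma til_lineDeriv (Φ : 𝓢(R4, ℂ)) (j : Fin 3) (k : R3) (y : ℝ) :
    til (LineDeriv.lineDerivOp (EuclideanSpace.single j.castSucc (1 : ℝ)) Φ) k y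
      = -(Complex.I * (k j : ℂ)) * til Φ k y := by
  unfold til
  rw [osc_lineDeriv (integrable_slice Φ y) (integrable_slice _ y)
    (v := EuclideanSpace.single j (1 : ℝ))]
  · simp [EuclideanSpace.inner_single_right]
  · intro s
    have hadd : ∀ τ : ℝ, insEquiv (3 : Fin 4) (s + τ • EuclideanSpace.single j 1, y)
        = insEquiv (3 : Fin 4) (s, y) + τ • EuclideanSpace.single j.castSucc (1 : ℝ) := by
      intro τ
      rw [insEquiv_three, insEquiv_three]
      ext l
      fin_cases l <;> fin_cases j <;> simp
    unfold HasLineDerivAt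
    simp only [hadd]
    rw [SchwartzMap.lineDerivOp_apply_eq_fderiv]
    exact (Φ.differentiableAt.hasFDerivAt).hasLineDerivAt _

lemma exists_til_bound_aux (Φ : 𝓢(R4, ℂ)) :
    ∃ C : ℝ, 0 ≤ C ∧ ∀ k y, ‖til Φ k y‖ ≤ C * ((1 + |y|) ^ 2)⁻¹ := by
  obtain ⟨C, hC, hb⟩ := exists_slice_bound Φ
  refine ⟨C * ∫ s : R3, ∏ j, ((1 + |s j|) ^ 2)⁻¹, mul_nonneg hC
    (integral_nonneg fun s => Finset.prod_nonneg fun j _ => by positivity), fun k y => ?_⟩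
  refine (norm_osc_le _ _).trans ?_
  have := integral_mono_of_nonneg (μ := (volume : Measure R3))
    (Eventually.of_forall fun s => norm_nonneg (Φ (insEquiv (3 : Fin 4) (s, y))))
    ((integrable_decay le_rfl).const_mul (C * ((1 + |y|) ^ 2)⁻¹))
    (Eventually.of_forall fun s => hb s y)
  rw [integral_const_mul] at this
  linarith

lemma exists_til_bound_step {b : R3 → ℝ → ℝ} (j : Fin 3)
    (h : ∀ Φ : 𝓢(R4, ℂ), ∃ C : ℝ, 0 ≤ C ∧ ∀ k y, ‖til Φ k y‖ ≤ C * b k y) (Φ : 𝓢(R4, ℂ)) :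
    ∃ C : ℝ, 0 ≤ C ∧ ∀ k y, ‖til Φ k y‖ ≤ C * (((1 + |k j|) ^ 2)⁻¹ * b k y) := by
  set m : R4 := EuclideanSpace.single j.castSucc (1 : ℝ)
  obtain ⟨C₀, hC₀, h0⟩ := h Φ
  obtain ⟨C₂, hC₂, h2⟩ := h (LineDeriv.lineDerivOp m (LineDeriv.lineDerivOp m Φ))
  refine ⟨2 * (C₀ + C₂), by positivity, fun k y => ?_⟩
  have h2' := h2 k y
  rw [til_lineDeriv, til_lineDeriv] at h2'
  simp only [norm_mul, norm_neg, Complex.norm_I, one_mul, Complex.norm_real,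
    Real.norm_eq_abs] at h2'
  refine (sq_weight_le (abs_nonneg (k j)) (norm_nonneg _) (h0 k y) h2').trans (le_of_eq ?_)
  ring

lemma exists_til_bound (Φ : 𝓢(R4, ℂ)) :
    ∃ C : ℝ, 0 ≤ C ∧ ∀ k y, ‖til Φ k y‖ ≤ C * ((∏ j, ((1 + |k j|) ^ 2)⁻¹) * ((1 + |y|) ^ 2)⁻¹) := by
  obtain ⟨C, hC, h⟩ := exists_til_bound_step 0 (exists_til_bound_step 1 (exists_til_bound_step 2
    (b := fun _ y => ((1 + |y|) ^ 2)⁻¹) exists_til_bound_aux)) Φ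
  refine ⟨C, hC, fun k y => (h k y).trans (le_of_eq ?_)⟩
  rw [Fin.prod_univ_three]
  ring

lemma hasDerivAt_til (Φ : 𝓢(R4, ℂ)) (k : R3) (y : ℝ) :
    HasDerivAt (fun y => til Φ k y)
      (til (LineDeriv.lineDerivOp (EuclideanSpace.single (3 : Fin 4) (1 : ℝ)) Φ) k y) y := by
  set Ψ := LineDeriv.lineDerivOp (EuclideanSpace.single (3 : Fin 4) (1 : ℝ)) Φ with hΨ
  obtain ⟨C, hC, hb⟩ := exists_slice_bound Ψ
  have hosc : ∀ (Θ : 𝓢(R4, ℂ)) (y : ℝ), Integrable (fun s : R3 => Θ (insEquiv (3 : Fin 4) (s, y)) *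
      Complex.exp (Complex.I * ((inner ℝ k s : ℝ) : ℂ))) := by
    intro Θ y
    refine (integrable_slice Θ y).mul_bdd (c := 1) (by fun_prop) (Eventually.of_forall fun s => ?_)
    rw [norm_exp_I_mul_ofReal]
  refine (hasDerivAt_integral_of_dominated_loc_of_deriv_le (s := Set.univ) (x₀ := y)
    (F := fun y s => Φ (insEquiv (3 : Fin 4) (s, y)) *
      Complex.exp (Complex.I * ((inner ℝ k s : ℝ) : ℂ)))
    (F' := fun y s => Ψ (insEquiv (3 : Fin 4) (s, y)) *
      Complex.exp (Complex.I * ((inner ℝ k s : ℝ) : ℂ)))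
    (bound := fun s => C * ∏ j, ((1 + |s j|) ^ 2)⁻¹) Filter.univ_mem
    (Eventually.of_forall fun y => (hosc Φ y).aestronglyMeasurable) (hosc Φ y)
    (hosc Ψ y).aestronglyMeasurable (Eventually.of_forall fun s y _ => ?_)
    ((integrable_decay le_rfl).const_mul C)
    (Eventually.of_forall fun s y _ => (hasDerivAt_schwartz_last Φ s y).mul_const _)).2
  rw [norm_mul, norm_exp_I_mul_ofReal, mul_one]
  refine (hb s y).trans ?_
  refine mul_le_mul_of_nonneg_right (mul_le_of_le_one_right hC ?_)
    (Finset.prod_nonneg fun j _ => by positivity)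
  exact inv_le_one_of_one_le₀ (one_le_pow₀ (by linarith [abs_nonneg y]))

lemma continuous_til (Φ : 𝓢(R4, ℂ)) (k : R3) : Continuous (fun y => til Φ k y) :=
  continuous_iff_continuousAt.2 fun y => (hasDerivAt_til Φ k y).continuousAt

lemma measurable_til (Φ : 𝓢(R4, ℂ)) : Measurable (fun p : R3 × ℝ => til Φ p.1 p.2) := by
  unfold til osc
  have : StronglyMeasurable (fun q : (R3 × ℝ) × R3 =>
      Φ (insEquiv (3 : Fin 4) (q.2, q.1.2)) *
        Complex.exp (Complex.I * ((inner ℝ q.1.1 q.2 : ℝ) : ℂ))) := by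
    refine Measurable.stronglyMeasurable (Measurable.mul ?_ (by fun_prop))
    exact (Φ.continuous.comp continuous_insEquiv_three).measurable.comp
      (measurable_snd.prodMk (measurable_snd.comp measurable_fst))
  exact (this.integral_prod_right (ν := (volume : Measure R3))).measurable

lemma integrable_til (Φ : 𝓢(R4, ℂ)) (y : ℝ) : Integrable (fun k => til Φ k y) := by
  obtain ⟨C, hC, hb⟩ := exists_til_bound Φ
  refine Integrable.mono' ((integrable_decay le_rfl).const_mul C)
    (continuous_osc (integrable_slice Φ y)).aestronglyMeasurable
    (Eventually.of_forall fun k => (hb k y).trans ?_)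
  refine mul_le_mul_of_nonneg_left (mul_le_of_le_one_right
    (Finset.prod_nonneg fun j _ => by positivity) ?_) hC
  exact inv_le_one_of_one_le₀ (one_le_pow₀ (by linarith [abs_nonneg y]))

lemma exists_til_bound_const (Φ : 𝓢(R4, ℂ)) : ∃ C : ℝ, 0 ≤ C ∧ ∀ k y, ‖til Φ k y‖ ≤ C := by
  obtain ⟨C, hC, h⟩ := exists_til_bound_aux Φ
  refine ⟨C, hC, fun k y => (h k y).trans (mul_le_of_le_one_right hC ?_)⟩
  exact inv_le_one_of_one_le₀ (one_le_pow₀ (by linarith [abs_nonneg y]))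

lemma exists_osc_bound (Φ : 𝓢(R4, ℂ)) :
    ∃ C : ℝ, 0 ≤ C ∧ ∀ k, ‖osc Φ k‖ ≤ C * ((1 + |k 3|) ^ 2)⁻¹ := by
  have h0 := norm_osc_le (Φ : R4 → ℂ)
  set m : R4 := EuclideanSpace.single 3 (1 : ℝ)
  have h2 := norm_osc_le (LineDeriv.lineDerivOp m (LineDeriv.lineDerivOp m Φ) : R4 → ℂ)
  refine ⟨2 * ((∫ x, ‖Φ x‖) + ∫ x, ‖LineDeriv.lineDerivOp m (LineDeriv.lineDerivOp m Φ) x‖),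
    by positivity, fun k => sq_weight_le (abs_nonneg (k 3)) (norm_nonneg _) (h0 k) ?_⟩
  · have h := h2 k
    rw [osc_schwartz_lineDeriv, osc_schwartz_lineDeriv] at h
    simpa only [norm_mul, norm_neg, Complex.norm_I, one_mul, Complex.norm_real,
      Real.norm_eq_abs] using h

lemma osc_insEquiv (Φ : 𝓢(R4, ℂ)) (k : R3) (η : ℝ) :
    osc Φ (insEquiv (3 : Fin 4) (k, η)) = osc (fun y => til Φ k y) η := by
  have hint : Integrable (fun x : R4 => Φ x *
      Complex.exp (Complex.I * ((inner ℝ (insEquiv (3 : Fin 4) (k, η)) x : ℝ) : ℂ))) := by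
    refine Φ.integrable.mul_bdd (c := 1) (by fun_prop) (Eventually.of_forall fun s => ?_)
    rw [norm_exp_I_mul_ofReal]
  unfold til
  rw [osc, integral_eq_integral_integral_insEquiv_swap (3 : Fin 4) hint, osc]
  congr 1
  ext y
  rw [osc, ← integral_mul_const]
  congr 1
  ext s
  rw [mul_assoc, ← Complex.exp_add, ← mul_add, ← Complex.ofReal_add]
  congr 4
  rw [inner_R3, insEquiv_three, insEquiv_three]
  simp [PiLp.inner_apply, Fin.sum_univ_four, mul_comm]

lemma integrable_til_last (Φ : 𝓢(R4, ℂ)) (k : R3) : Integrable (fun y => til Φ k y) := by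
  obtain ⟨C, hC, hb⟩ := exists_til_bound_aux Φ
  exact Integrable.mono' ((integrable_inv_one_add_abs_pow le_rfl).const_mul C)
    (continuous_til Φ k).aestronglyMeasurable (Eventually.of_forall fun y => hb k y)

lemma integrable_osc_last (Φ : 𝓢(R4, ℂ)) (k : R3) :
    Integrable (fun η => osc Φ (insEquiv (3 : Fin 4) (k, η))) := by
  obtain ⟨C, hC, hb⟩ := exists_osc_bound Φ
  refine Integrable.mono' ((integrable_inv_one_add_abs_pow le_rfl).const_mul C) ?_
    (Eventually.of_forall fun η => (hb _).trans (by rw [insEquiv_same]))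
  simp only [osc_insEquiv]
  exact (continuous_osc (integrable_til_last Φ k)).aestronglyMeasurable

/-- Inversion of the transform in the last variable. -/
lemma osc_osc_last (Φ : 𝓢(R4, ℂ)) (k : R3) (y : ℝ) :
    osc (fun η => osc Φ (insEquiv (3 : Fin 4) (k, η))) (-y)
      = ((2 * Real.pi : ℝ) : ℂ) * til Φ k y := by
  have h := integrable_osc_last Φ k
  simp only [osc_insEquiv] at h ⊢
  have := osc_osc_neg (continuous_til Φ k) (integrable_til_last Φ k) h y
  rwa [Module.finrank_self, pow_one] at this

/-! ### Integrability of the frequency weights -/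

section Weights

lemma ae_coord_ne_zero {n : ℕ} (j : Fin n) : ∀ᵐ x : EuclideanSpace ℝ (Fin n), x j ≠ 0 :=
  (EuclideanSpace.volume_preserving_symm_measurableEquiv_toLp (Fin n)).quasiMeasurePreserving.ae
    (Measure.ae_eval_ne (μ := fun _ : Fin n => (volume : Measure ℝ)) j 0)

/-- The one-dimensional weight `|t|^{-a} (1 + |t|)^{-b}`. -/
noncomputable def pw (a b t : ℝ) : ℝ := |t| ^ (-a) * (1 + |t|) ^ (-b)

lemma pw_nonneg (a b t : ℝ) : 0 ≤ pw a b t := by unfold pw; positivity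

lemma pw_rpow (a b t σ : ℝ) : pw a b t ^ σ = pw (a * σ) (b * σ) t := by
  unfold pw
  rw [Real.mul_rpow (by positivity) (by positivity), ← Real.rpow_mul (by positivity),
    ← Real.rpow_mul (by positivity), neg_mul, neg_mul]

lemma integrable_pw {a b : ℝ} (ha : a < 1) (hab : 1 < a + b) : Integrable (pw a b) :=
  integrable_abs_rpow_mul ha hab

/-- With `r² = x² + y²` one has `|y| ≤ r` and `|x| ^ ε |y| ^ (1 - ε) ≤ r`. The parameter `ε`
distributes the first-order singularity between the two variables. -/
lemma div_sq_add_sq_le {x y ε : ℝ} (hx : x ≠ 0) (hy : y ≠ 0) (h0 : 0 ≤ ε) (h1 : ε ≤ 1) :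
    |y| / (x ^ 2 + y ^ 2) ≤ |x| ^ (-ε) * |y| ^ (-(1 - ε)) := by
  have hx' : 0 < |x| := abs_pos.2 hx
  have hy' : 0 < |y| := abs_pos.2 hy
  have hρ : 0 < x ^ 2 + y ^ 2 := by positivity
  set r := Real.sqrt (x ^ 2 + y ^ 2) with hr
  have hr0 : 0 < r := Real.sqrt_pos.2 hρ
  have hr2 : x ^ 2 + y ^ 2 = r * r := (Real.mul_self_sqrt hρ.le).symm
  have hxr : |x| ≤ r := Real.abs_le_sqrt (by linarith [sq_nonneg y])
  have hyr : |y| ≤ r := Real.abs_le_sqrt (by linarith [sq_nonneg x])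
  rw [Real.rpow_neg hx'.le, Real.rpow_neg hy'.le, ← mul_inv, ← one_div,
    div_le_div_iff₀ hρ (by positivity), one_mul, hr2]
  have e : r ^ ε * r ^ (1 - ε) = r := by
    rw [← Real.rpow_add hr0]; simp
  have h3 : |x| ^ ε * |y| ^ (1 - ε) ≤ r := by
    rw [← e]
    have := Real.rpow_le_rpow hx'.le hxr h0
    have := Real.rpow_le_rpow hy'.le hyr (sub_nonneg.2 h1)
    gcongr
  exact mul_le_mul hyr h3 (by positivity) hr0.le

lemma pow_inv_eq_rpow (t : ℝ) (n : ℕ) : ((1 + |t|) ^ n)⁻¹ = (1 + |t|) ^ (-(n : ℝ)) := by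
  rw [Real.rpow_neg (by positivity), Real.rpow_natCast]

lemma weightW_le {k : R3} {ε : ℝ} (h0 : 0 ≤ ε) (h1 : ε ≤ 1) (hk0 : k 0 ≠ 0) (hk2 : k 2 ≠ 0) :
    weightW k ≤ pw ε 2 (k 0) * pw 0 2 (k 1) * pw (1 - ε) 1 (k 2) := by
  have h := div_sq_add_sq_le hk0 hk2 h0 h1
  have e1 : (1 + |k 2|)⁻¹ = (1 + |k 2|) ^ (-(1 : ℝ)) := by
    rw [Real.rpow_neg (by positivity), Real.rpow_one]
  unfold weightW pw
  rw [pow_inv_eq_rpow, pow_inv_eq_rpow, e1]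
  simp only [Nat.cast_ofNat, neg_zero, Real.rpow_zero, one_mul]
  calc _ ≤ (|k 0| ^ (-ε) * |k 2| ^ (-(1 - ε))) * ((1 + |k 0|) ^ (-2 : ℝ) *
        (1 + |k 1|) ^ (-2 : ℝ) * (1 + |k 2|) ^ (-1 : ℝ)) := by gcongr
    _ = _ := by ring

/-- With the even split `ε = 1 / 2` both singular exponents are `σ / 2`, below `1` because `σ < 2`.
For the conjugate exponent `σ = p / (p - 1)` this is the condition `p > 2`. -/
lemma integrable_weightW_rpow {σ : ℝ} (h1 : 1 ≤ σ) (h2 : σ < 2) :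
    Integrable (fun k => weightW k ^ σ) := by
  have h := integrable_prod_coord (n := 3)
    (f := ![pw (1 / 2 * σ) (2 * σ), pw (0 * σ) (2 * σ), pw ((1 - 1 / 2) * σ) (1 * σ)]) (by
      intro j
      fin_cases j
      · exact integrable_pw (by linarith) (by linarith)
      · exact integrable_pw (by linarith) (by linarith)
      · exact integrable_pw (by linarith) (by linarith))
  refine h.mono' (measurable_weightW.pow_const σ).aestronglyMeasurable ?_
  filter_upwards [ae_coord_ne_zero (n := 3) 0, ae_coord_ne_zero (n := 3) 2] with k hk0 hk2
  rw [Real.norm_of_nonneg (Real.rpow_nonneg (weightW_nonneg k) _), Fin.prod_univ_three]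
  refine (Real.rpow_le_rpow (weightW_nonneg k)
    (weightW_le (ε := 1 / 2) (by norm_num) (by norm_num) hk0 hk2) (by linarith)).trans
    (le_of_eq ?_)
  rw [Real.mul_rpow (mul_nonneg (pw_nonneg _ _ _) (pw_nonneg _ _ _)) (pw_nonneg _ _ _),
    Real.mul_rpow (pw_nonneg _ _ _) (pw_nonneg _ _ _), pw_rpow, pw_rpow, pw_rpow]
  rfl

/-- An integrable weight which controls `solV`. -/
noncomputable def weightV' (k : R3) : ℝ := ∏ j, pw 0 (3 / 2) (k j)

lemma weightV'_nonneg (k : R3) : 0 ≤ weightV' k := Finset.prod_nonneg fun _ _ => pw_nonneg _ _ _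

lemma measurable_weightV' : Measurable weightV' := by
  unfold weightV' pw
  simp only [Fin.prod_univ_three]
  fun_prop

lemma integrable_weightV'_rpow {σ : ℝ} (h1 : 1 ≤ σ) : Integrable (fun k => weightV' k ^ σ) := by
  have h := integrable_prod_coord (n := 3) (f := fun _ => pw (0 * σ) (3 / 2 * σ))
    (fun j => integrable_pw (by linarith) (by linarith))
  refine h.congr (Eventually.of_forall fun k => ?_)
  simp only [weightV']
  rw [← Real.finsetProd_rpow _ _ fun _ _ => pw_nonneg _ _ _]
  simp only [pw_rpow]

/-- The geometric mean of the two bounds for `solV`. The first is not integrable in `k 2` and the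
second does not decay in `y`; their mean is dominated by `(1 + |k_j|)^{-3/2}` in each frequency and
keeps `(1 + y)^{-1/2}`. -/
lemma exists_solV_bound_sqrt (G : 𝓢(R4, ℂ)) : ∃ C : ℝ, 0 ≤ C ∧ ∀ (k : R3) (y : ℝ), 0 ≤ y →
    ‖solV G k y‖ ≤ C * weightV' k * (1 + y) ^ (-(1 / 2) : ℝ) := by
  obtain ⟨C₁, hC₁, h1⟩ := exists_solV_bound G
  obtain ⟨C₂, hC₂, h2⟩ := exists_solV_bound' G
  refine ⟨Real.sqrt (C₁ * C₂), Real.sqrt_nonneg _, fun k y hy => ?_⟩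
  have hw := weightV'_nonneg k
  refine le_of_sq_le_sq ?_ (by positivity)
  have e1 : ((1 + y) ^ (-(1 / 2) : ℝ)) ^ 2 = (1 + y)⁻¹ := by
    rw [← Real.rpow_natCast, ← Real.rpow_mul (by positivity)]
    norm_num
    exact Real.rpow_neg_one _
  have e2 : weightV k * ∏ j, ((1 + |k j|) ^ 2)⁻¹ ≤ weightV' k ^ 2 := by
    have hp : ∀ t : ℝ, pw 0 (3 / 2) t ^ 2 = ((1 + |t|) ^ 3)⁻¹ := by
      intro t
      rw [← Real.rpow_natCast, pw_rpow, pow_inv_eq_rpow]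
      simp [pw]
    unfold weightV weightV'
    rw [← Finset.prod_pow]
    simp only [hp, Fin.prod_univ_three]
    have a : ∀ t : ℝ, ((1 + |t|) ^ 2)⁻¹ * ((1 + |t|) ^ 2)⁻¹ ≤ ((1 + |t|) ^ 3)⁻¹ := by
      intro t
      have : 1 ≤ 1 + |t| := by linarith [abs_nonneg t]
      rw [← mul_inv, ← pow_add]
      gcongr
      norm_num
    calc _ = (((1 + |k 0|) ^ 2)⁻¹ * ((1 + |k 0|) ^ 2)⁻¹) *
          (((1 + |k 1|) ^ 2)⁻¹ * ((1 + |k 1|) ^ 2)⁻¹) * ((1 + |k 2|) ^ 3)⁻¹ := by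
          have : (0 : ℝ) < 1 + |k 2| := by positivity
          field_simp
      _ ≤ _ := by
          have a0 := a (k 0)
          have a1 := a (k 1)
          gcongr
  rw [mul_pow, mul_pow, Real.sq_sqrt (mul_nonneg hC₁ hC₂), e1, sq]
  calc ‖solV G k y‖ * ‖solV G k y‖
      ≤ (C₁ * weightV k * (1 + y)⁻¹) * (C₂ * ∏ j, ((1 + |k j|) ^ 2)⁻¹) :=
        mul_le_mul (h1 k y hy) (h2 k y hy) (norm_nonneg _) ((norm_nonneg _).trans (h1 k y hy))
    _ = C₁ * C₂ * (weightV k * ∏ j, ((1 + |k j|) ^ 2)⁻¹) * (1 + y)⁻¹ := by ring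
    _ ≤ _ := by gcongr

lemma exists_solW_bound_sqrt (G : 𝓢(R4, ℂ)) : ∃ C : ℝ, 0 ≤ C ∧ ∀ (k : R3) (y : ℝ), 0 ≤ y →
    ‖solW G k y‖ ≤ C * weightW k * (1 + y) ^ (-(1 / 2) : ℝ) := by
  obtain ⟨C, hC, h⟩ := exists_solW_bound G
  refine ⟨C, hC, fun k y hy => (h k y hy).trans ?_⟩
  have := weightW_nonneg k
  rw [← Real.rpow_neg_one]
  gcongr
  · linarith
  · norm_num

end Weights

/-! ### From amplitudes to functions on the corner -/

section Field

/-- The reflection of the last coordinate of `R3`. -/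
noncomputable def refl3 : R3 ≃ₗᵢ[ℝ] R3 :=
  LinearIsometryEquiv.piLpCongrRight 2
    (fun j => if j = 2 then LinearIsometryEquiv.neg ℝ else LinearIsometryEquiv.refl ℝ ℝ)

lemma refl3_apply (x : R3) : refl3 x = !₂[x 0, x 1, -x 2] := by
  ext j
  simp only [refl3, LinearIsometryEquiv.piLpCongrRight_apply]
  fin_cases j <;> simp

lemma vec3_eta (x : R3) : (!₂[x 0, x 1, x 2] : R3) = x := by
  ext j
  fin_cases j <;> simp

lemma osc_refl3 {h : R3 → ℂ} (hodd : ∀ k, h (refl3 k) = -h k) (x : R3) :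
    osc h (refl3 x) = -osc h x := by
  unfold osc
  rw [← (refl3.measurePreserving).integral_comp refl3.toHomeomorph.measurableEmbedding,
    ← integral_neg]
  congr 1
  ext k
  rw [LinearIsometryEquiv.inner_map_map, hodd, neg_mul]

/-- The constant `(2π)⁻³`. -/
noncomputable def c3 : ℂ := ((2 * Real.pi : ℝ) : ℂ)⁻¹ ^ 3

/-- The function with the amplitude `H` at height `x 3`. -/
noncomputable def fld (H : R3 → ℝ → ℂ) (x : R4) : ℂ :=
  c3 * osc (fun k => H k (x 3)) !₂[x 0, x 1, x 2]

/-- Admissible amplitudes: odd in the third frequency and dominated by `M(k) (1 + y)^{-1/2}`. -/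
structure IsAmplitude (H : R3 → ℝ → ℂ) (M : R3 → ℝ) : Prop where
  meas : Measurable (fun p : R3 × ℝ => H p.1 p.2)
  odd : ∀ k y, H (refl3 k) y = -H k y
  bound : ∀ k y, 0 ≤ y → ‖H k y‖ ≤ M k * (1 + y) ^ (-(1 / 2) : ℝ)
  nonneg : ∀ k, 0 ≤ M k
  measM : Measurable M
  integ : ∀ σ : ℝ, 1 ≤ σ → σ < 2 → Integrable (fun k => M k ^ σ)

variable {H : R3 → ℝ → ℂ} {M : R3 → ℝ}

lemma IsAmplitude.integrableM (h : IsAmplitude H M) : Integrable M := by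
  simpa using h.integ 1 le_rfl (by norm_num)

lemma IsAmplitude.norm_le (h : IsAmplitude H M) (k : R3) {y : ℝ} (hy : 0 ≤ y) : ‖H k y‖ ≤ M k :=
  (h.bound k y hy).trans (mul_le_of_le_one_right (h.nonneg k)
    (Real.rpow_le_one_of_one_le_of_nonpos (by linarith) (by norm_num)))

lemma IsAmplitude.meas_slice (h : IsAmplitude H M) (y : ℝ) : Measurable (fun k => H k y) := by
  have := h.meas.comp (measurable_prodMk_right (y := y) (α := R3))
  exact this

lemma IsAmplitude.integrable_slice (h : IsAmplitude H M) {y : ℝ} (hy : 0 ≤ y) :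
    Integrable (fun k => H k y) :=
  h.integrableM.mono' (h.meas_slice y).aestronglyMeasurable
    (Eventually.of_forall fun k => h.norm_le k hy)

lemma isAmplitude_solW (G : 𝓢(R4, ℂ)) : ∃ C : ℝ, IsAmplitude (solW G) (fun k => C * weightW k) := by
  obtain ⟨C, hC, h⟩ := exists_solW_bound_sqrt G
  refine ⟨C, measurable_solW G, fun k y => ?_, h, fun k => mul_nonneg hC (weightW_nonneg k),
    measurable_weightW.const_mul C, fun σ h1 h2 => ?_⟩
  · rw [refl3_apply, solW_odd, vec3_eta]
  · refine ((integrable_weightW_rpow h1 h2).const_mul (C ^ σ)).congr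
      (Eventually.of_forall fun k => ?_)
    simp only [Real.mul_rpow hC (weightW_nonneg k)]

lemma isAmplitude_solV (G : 𝓢(R4, ℂ)) : ∃ C : ℝ, IsAmplitude (solV G) (fun k => C * weightV' k) := by
  obtain ⟨C, hC, h⟩ := exists_solV_bound_sqrt G
  refine ⟨C, measurable_solV G, fun k y => ?_, h, fun k => mul_nonneg hC (weightV'_nonneg k),
    measurable_weightV'.const_mul C, fun σ h1 _ => ?_⟩
  · rw [refl3_apply, solV_odd, vec3_eta]
  · refine ((integrable_weightV'_rpow h1).const_mul (C ^ σ)).congr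
      (Eventually.of_forall fun k => ?_)
    simp only [Real.mul_rpow hC (weightV'_nonneg k)]

/-- Since the amplitude is odd in the third frequency, the oscillatory integral is already odd in
`y₁`, and it vanishes for `y₁ = 0`. The extension therefore agrees with the integral for every `y₁`
once `y > 0`. -/
lemma extO1_fld (h : IsAmplitude H M) (s : R3) (y : ℝ) :
    extO1 (fld H) (insEquiv (3 : Fin 4) (s, y)) = if y ≤ 0 then 0 else c3 * osc (fun k => H k y) s := by
  have hx : insEquiv (3 : Fin 4) (s, y) = !₂[s 0, s 1, s 2, y] := insEquiv_three s y
  have e1 : fld H !₂[s 0, s 1, s 2, y] = c3 * osc (fun k => H k y) s := by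
    unfold fld
    simp only [Matrix.cons_val]
    rw [vec3_eta]
  have hodd := osc_refl3 (h := fun k => H k y) (fun k => h.odd k y) s
  have e2 : fld H (reflY1 !₂[s 0, s 1, s 2, y]) = -(c3 * osc (fun k => H k y) s) := by
    unfold fld reflY1
    simp only [Matrix.cons_val]
    rw [← refl3_apply, hodd, mul_neg]
  rw [hx]
  unfold extO1
  have h3 : (!₂[s 0, s 1, s 2, y] : R4) 3 = y := by simp
  have h2 : (!₂[s 0, s 1, s 2, y] : R4) 2 = s 2 := by simp
  rw [h3, h2, e1, e2]
  split_ifs with a b c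
  · rfl
  · rfl
  · rw [neg_neg]
  · have hs : refl3 s = s := by
      rw [refl3_apply]
      have : s 2 = 0 := le_antisymm (not_lt.1 b) (not_lt.1 c)
      conv_rhs => rw [← vec3_eta s]
      rw [this, neg_zero]
    rw [hs] at hodd
    have : osc (fun k => H k y) s = 0 := self_eq_neg.1 hodd
    rw [this, mul_zero]

lemma measurable_extO1 {f : R4 → ℂ} (hf : Measurable f) : Measurable (extO1 f) := by
  have m1 : MeasurableSet {x : R4 | x 3 ≤ 0} := measurableSet_le (by fun_prop) measurable_const
  have m2 : MeasurableSet {x : R4 | 0 < x 2} := measurableSet_coord_pos 2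
  have m3 : MeasurableSet {x : R4 | x 2 < 0} := measurableSet_lt (by fun_prop) measurable_const
  exact Measurable.ite m1 measurable_const (Measurable.ite m2 hf
    (Measurable.ite m3 (hf.comp measurable_reflY1).neg measurable_const))

lemma IsAmplitude.measurable_fld (h : IsAmplitude H M) : Measurable (fld H) := by
  unfold fld osc
  have : StronglyMeasurable (fun q : R4 × R3 =>
      H q.2 (q.1 3) * Complex.exp (Complex.I *
        ((inner ℝ (!₂[q.1 0, q.1 1, q.1 2] : R3) q.2 : ℝ) : ℂ))) := by
    refine Measurable.stronglyMeasurable (Measurable.mul ?_ (by fun_prop))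
    have h1 : Measurable (fun q : R4 × R3 => (q.2, q.1 3)) := by fun_prop
    have := h.meas.comp h1
    exact this
  exact ((this.integral_prod_right (ν := (volume : Measure R3))).measurable).const_mul c3

lemma IsAmplitude.norm_extO1_fld_le (h : IsAmplitude H M) (x : R4) :
    ‖extO1 (fld H) x‖ ≤ ‖c3‖ * ∫ k, M k := by
  have hM : 0 ≤ ∫ k, M k := integral_nonneg h.nonneg
  obtain ⟨⟨s, y⟩, rfl⟩ := (insEquiv (3 : Fin 4)).surjective x
  rw [extO1_fld h]
  split_ifs with hy
  · rw [norm_zero]; positivity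
  · rw [norm_mul]
    refine mul_le_mul_of_nonneg_left ((norm_osc_le _ _).trans ?_) (norm_nonneg _)
    exact integral_mono (h.integrable_slice (not_le.1 hy).le).norm h.integrableM
      fun k => h.norm_le k (not_le.1 hy).le

/-- The pairing of the field with a Schwartz function, in terms of the amplitude. -/
lemma IsAmplitude.integral_mul (h : IsAmplitude H M) (Φ : 𝓢(R4, ℂ)) :
    Integrable (fun x => extO1 (fld H) x * Φ x) ∧
    ∫ x, extO1 (fld H) x * Φ x = c3 * ∫ k, ∫ y in Set.Ioi (0 : ℝ), H k y * til Φ k y := by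
  have hint : Integrable (fun x => extO1 (fld H) x * Φ x) :=
    Φ.integrable.bdd_mul (c := ‖c3‖ * ∫ k, M k)
      (measurable_extO1 h.measurable_fld).aestronglyMeasurable
      (Eventually.of_forall h.norm_extO1_fld_le)
  refine ⟨hint, ?_⟩
  have e1 : ∀ y, ∫ s, extO1 (fld H) (insEquiv (3 : Fin 4) (s, y)) * Φ (insEquiv (3 : Fin 4) (s, y))
      = if y ≤ 0 then 0 else c3 * ∫ k, H k y * til Φ k y := by
    intro y
    simp only [extO1_fld h]
    split_ifs with hy
    · simp
    · simp only [mul_assoc]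
      rw [integral_const_mul, integral_osc_mul (h.integrable_slice (not_le.1 hy).le)
        (_root_.integrable_slice Φ y)]
      rfl
  rw [integral_eq_integral_integral_insEquiv_swap (3 : Fin 4) hint]
  simp only [e1]
  have e2 : ∫ y, (if y ≤ 0 then 0 else c3 * ∫ k, H k y * til Φ k y)
      = ∫ y in Set.Ioi (0 : ℝ), c3 * ∫ k, H k y * til Φ k y := by
    rw [← integral_indicator measurableSet_Ioi]
    congr 1
    ext y
    by_cases hy : y ≤ 0
    · simp [hy]
    · simp [hy, not_le.1 hy]
  rw [e2, integral_const_mul]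
  congr 1
  rw [integral_integral_swap]
  obtain ⟨C, hC, hb⟩ := exists_til_bound_aux Φ
  refine Integrable.mono' (g := fun p : ℝ × R3 => C * ((1 + |p.1|) ^ 2)⁻¹ * M p.2) ?_ ?_ ?_
  · exact ((integrableOn_inv_pow le_rfl).const_mul C).mul_prod h.integrableM
  · exact ((h.meas.comp measurable_swap).mul
      ((measurable_til Φ).comp measurable_swap)).aestronglyMeasurable
  · have : ∀ᵐ p : ℝ × R3 ∂((volume.restrict (Set.Ioi 0)).prod volume), 0 < p.1 :=
      Measure.quasiMeasurePreserving_fst.ae (ae_restrict_mem measurableSet_Ioi)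
    filter_upwards [this] with p hp
    simp only [Function.uncurry]
    rw [norm_mul, mul_comm]
    exact mul_le_mul (hb _ _) (h.norm_le _ hp.le) (norm_nonneg _) (by positivity)

/-- The weak Hausdorff-Young inequality on each slice, with a constant independent of the height,
followed by integration of `(1 + y)^{-p/2}`. Both steps use `p > 2`. -/
lemma IsAmplitude.memLp (h : IsAmplitude H M) {p : ℝ≥0∞} (hp : 2 < p) (hpt : p ≠ ⊤) :
    MemLp (extO1 (fld H)) p := by
  have hm := measurable_extO1 h.measurable_fld
  have hp0 : p ≠ 0 := (lt_trans (by norm_num) hp).ne'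
  set P := p.toReal with hP
  have hP2 : 2 < P := by
    have := (ENNReal.toReal_lt_toReal (by norm_num) hpt).2 hp
    simpa using this
  refine ⟨hm.aestronglyMeasurable, ?_⟩
  rw [eLpNorm_lt_top_iff_lintegral_rpow_enorm_lt_top hp0 hpt]
  have hσ1 : 1 ≤ P / (P - 1) := by rw [le_div_iff₀ (by linarith)]; linarith
  have hσ2 : P / (P - 1) < 2 := by rw [div_lt_iff₀ (by linarith)]; linarith
  obtain ⟨C, hC, hb⟩ := lintegral_osc_rpow_le hP2 h.nonneg h.measM h.integrableM (h.integ _ hσ1 hσ2)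
  rw [lintegral_eq_lintegral_lintegral_insEquiv (3 : Fin 4) (by fun_prop)]
  have e1 : ∀ y, ∫⁻ s, ‖extO1 (fld H) (insEquiv (3 : Fin 4) (s, y))‖ₑ ^ P
      ≤ ‖c3‖ₑ ^ P * C * ENNReal.ofReal ((1 + |y|) ^ (-(1 / 2 * P))) := by
    intro y
    simp only [extO1_fld h]
    split_ifs with hy
    · rw [enorm_zero, ENNReal.zero_rpow_of_pos (by linarith)]
      simp
    · have hy : 0 < y := not_le.1 hy
      -- Dividing by the decay factor brings every slice under the same majorant `M`.
      set a : ℝ := (1 + y) ^ (-(1 / 2) : ℝ) with ha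
      have ha0 : 0 < a := by positivity
      have h1 : ∀ s, osc (fun k => H k y) s = (a : ℂ) * osc (fun k => (a⁻¹ : ℂ) * H k y) s := by
        intro s
        unfold osc
        rw [← integral_const_mul]
        congr 1
        ext k
        have : (a : ℂ) ≠ 0 := by exact_mod_cast ha0.ne'
        field_simp
      have h2 := hb (fun k => (a⁻¹ : ℂ) * H k y) ((h.meas_slice y).const_mul _) (fun k => by
        rw [norm_mul, norm_inv, Complex.norm_real, Real.norm_of_nonneg ha0.le, ← div_eq_inv_mul,
          div_le_iff₀ ha0]
        exact h.bound k y hy.le)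
      have h3 : ∀ s, ‖c3 * osc (fun k => H k y) s‖ₑ ^ P
          = ‖c3‖ₑ ^ P * ENNReal.ofReal ((1 + |y|) ^ (-(1 / 2 * P))) *
            ‖osc (fun k => (a⁻¹ : ℂ) * H k y) s‖ₑ ^ P := by
        intro s
        rw [h1, enorm_mul, enorm_mul, ENNReal.mul_rpow_of_nonneg _ _ (by linarith),
          ENNReal.mul_rpow_of_nonneg _ _ (by linarith), mul_assoc]
        congr 3
        rw [← ofReal_norm, Complex.norm_real, Real.norm_of_nonneg ha0.le,
          ENNReal.ofReal_rpow_of_pos ha0, ha, ← Real.rpow_mul (by positivity), abs_of_pos hy, neg_mul]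
      simp only [h3]
      rw [lintegral_const_mul' _ _ (by finiteness)]
      calc _ ≤ ‖c3‖ₑ ^ P * ENNReal.ofReal ((1 + |y|) ^ (-(1 / 2 * P))) * C := by gcongr
        _ = _ := by ring
  refine (lintegral_mono e1).trans_lt ?_
  rw [lintegral_const_mul' _ _ (by finiteness)]
  refine ENNReal.mul_lt_top (by finiteness) ?_
  have hi : Integrable (fun y : ℝ => (1 + |y|) ^ (-(1 / 2 * P))) := by
    have := integrable_pw (a := 0) (b := 1 / 2 * P) one_pos (by linarith)
    refine this.congr (Eventually.of_forall fun t => ?_)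
    simp [pw]
  exact hi.lintegral_lt_top

end Field

/-! ### The explicit formula on the Fourier side -/

section FourierFormula

variable {g : R4 → ℂ} (G : 𝓢(R4, ℂ)) {k : R3}

lemma integrableOn_src_mul (k : R3) {e : ℝ → ℂ} (hem : Measurable e)
    (he : ∀ s, 0 < s → ‖e s‖ ≤ 1) : IntegrableOn (fun s => src G k s * e s) (Set.Ioi 0) := by
  obtain ⟨C, hC, h⟩ := exists_src_bound G
  refine Integrable.mono' ((integrableOn_inv_pow (n := 3) (by norm_num)).const_mul
    (C * srcWeight k)) ((measurable_src_left G k).mul hem).aestronglyMeasurable ?_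
  filter_upwards [ae_restrict_mem measurableSet_Ioi] with s hs
  rw [norm_mul, mul_assoc]
  exact (mul_le_of_le_one_right (norm_nonneg _) (he s hs)).trans (h k s)

lemma norm_exp_neg_I_mul (y η : ℝ) : ‖Complex.exp (-Complex.I * ((y : ℂ) * η))‖ = 1 := by
  have := norm_exp_I_mul_ofReal (-(y * η))
  rwa [Complex.ofReal_neg, mul_neg, ← neg_mul, Complex.ofReal_mul] at this

lemma integral_solW_mul_exp (hk : k 2 ≠ 0) (η : ℝ) :
    ∫ y in Set.Ioi (0 : ℝ), solW G k y * Complex.exp (-Complex.I * ((y : ℂ) * η))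
      = ∫ s in Set.Ioi (0 : ℝ), src G k s * ∫ y in Set.Ioi (0 : ℝ),
        (greenK ‖k‖ (k 1) y s : ℂ) * Complex.exp (-Complex.I * ((y : ℂ) * η)) :=
  integral_solW_mul G hk (b := fun y => Complex.exp (-Complex.I * ((y : ℂ) * η))) (A := 1)
    (by fun_prop) (fun y => (norm_exp_neg_I_mul y η).le)

/-- Insert the transform of the kernel and integrate against the source: the two exponentials in `s`
rebuild the transform of the datum at `η` and at `-i‖k‖`. Off the null set `k 2 = 0` one has `|k 1|
< ‖k‖`, so no denominator vanishes. -/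
lemma solnHat_eq (hg : Set.EqOn g G (closure cornerDomain)) (hk : k 2 ≠ 0) (η : ℝ) :
    solnHat g (insEquiv (3 : Fin 4) (k, η))
      = ∫ y in Set.Ioi (0 : ℝ), solW G k y * Complex.exp (-Complex.I * ((y : ℂ) * η)) := by
  have hz := norm_pos_of_ne hk
  have hκ : k 1 ≠ ‖k‖ := fun h => by
    have := abs_lt_norm hk
    rw [h, abs_of_pos hz] at this
    exact lt_irrefl _ this
  rw [integral_solW_mul_exp G hk]
  set D : ℂ := ((‖k‖ ^ 2 + η ^ 2 : ℝ) : ℂ) with hD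
  have e1 : ∫ s in Set.Ioi (0 : ℝ), src G k s * ∫ y in Set.Ioi (0 : ℝ),
        (greenK ‖k‖ (k 1) y s : ℂ) * Complex.exp (-Complex.I * ((y : ℂ) * η))
      = ∫ s in Set.Ioi (0 : ℝ),
        (-D⁻¹ * (src G k s * Complex.exp (-Complex.I * ((s : ℂ) * η)))
        + (Complex.I * η - (k 1 : ℂ)) / ((‖k‖ : ℂ) - (k 1 : ℂ)) * D⁻¹ *
          (src G k s * Complex.exp (-Complex.I * ((s : ℂ) * (-Complex.I * (‖k‖ : ℂ)))))) := by
    refine setIntegral_congr_fun measurableSet_Ioi fun s hs => ?_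
    have hexp : Complex.exp (-Complex.I * ((s : ℂ) * (-Complex.I * (‖k‖ : ℂ))))
        = ((Real.exp (-‖k‖ * s) : ℝ) : ℂ) := by
      push_cast
      congr 1
      linear_combination (s * ‖k‖ : ℂ) * Complex.I_sq
    simp only [hexp]
    rw [integral_greenK_mul_exp hz hκ (le_of_lt hs)]
    ring
  have i1 := (integrableOn_src_mul G k (e := fun s => Complex.exp (-Complex.I * ((s : ℂ) * η)))
    (by fun_prop) (fun s _ => (norm_exp_neg_I_mul s η).le)).const_mul (-D⁻¹)
  have i2 := (integrableOn_src_mul G k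
    (e := fun s => Complex.exp (-Complex.I * ((s : ℂ) * (-Complex.I * (‖k‖ : ℂ)))))
    (by fun_prop) (fun s hs => by
      rw [Complex.norm_exp, Real.exp_le_one_iff]
      simp
      positivity)).const_mul
      ((Complex.I * η - (k 1 : ℂ)) / ((‖k‖ : ℂ) - (k 1 : ℂ)) * D⁻¹)
  rw [e1, integral_add i1 i2, integral_const_mul, integral_const_mul,
    ← fourierC_eq hg k (η := (η : ℂ)) (by simp),
    ← fourierC_eq hg k (η := -Complex.I * (‖k‖ : ℂ)) (by simp)]
  have hζ : zetaRoot (insEquiv (3 : Fin 4) (k, η)) = ‖k‖ := by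
    unfold zetaRoot
    rw [insEquiv_three]
    simp only [Matrix.cons_val]
    rw [← norm_sq_R3, Real.sqrt_sq (norm_nonneg _)]
  unfold solnHat
  rw [hζ, insEquiv_three]
  simp only [Matrix.cons_val]
  rw [← norm_sq_R3, ← hD]
  ring

/-- The bound of `solW` by `(1 + y)⁻¹` cannot be integrated over the height. Integrating the kernel
in `y` first gives `2‖k‖ / (k 0 ^ 2 + k 2 ^ 2)` times `2 / ‖k‖`, uniformly in the source height and
in `η`. -/
lemma exists_bound_integral_solW_mul_exp : ∃ C : ℝ, 0 ≤ C ∧ ∀ (k : R3) (η : ℝ), k 2 ≠ 0 →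
    ‖∫ y in Set.Ioi (0 : ℝ), solW G k y * Complex.exp (-Complex.I * ((y : ℂ) * η))‖
      ≤ C * weightW k := by
  obtain ⟨C, hC, h⟩ := exists_src_bound G
  have hJ := decayConst_nonneg
  refine ⟨4 * C * decayConst, by positivity, fun k η hk => ?_⟩
  have hz := norm_pos_of_ne hk
  have hρ : 0 < k 0 ^ 2 + k 2 ^ 2 := by positivity
  have hB := srcWeight_nonneg k
  rw [integral_solW_mul_exp G hk]
  have h1 : ∀ s, 0 < s → ‖∫ y in Set.Ioi (0 : ℝ),
      (greenK ‖k‖ (k 1) y s : ℂ) * Complex.exp (-Complex.I * ((y : ℂ) * η))‖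
      ≤ 4 / (k 0 ^ 2 + k 2 ^ 2) := by
    intro s hs
    have a1 : ‖∫ y in Set.Ioi (0 : ℝ),
        (greenK ‖k‖ (k 1) y s : ℂ) * Complex.exp (-Complex.I * ((y : ℂ) * η))‖
        ≤ ∫ y in Set.Ioi (0 : ℝ), 2 * ‖k‖ / (‖k‖ ^ 2 - k 1 ^ 2) * expK ‖k‖ y s := by
      refine norm_integral_le_of_norm_le ((integrable_expK hz s).const_mul _).integrableOn ?_
      filter_upwards [ae_restrict_mem measurableSet_Ioi] with y hy
      rw [norm_mul, norm_exp_neg_I_mul, mul_one]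
      exact norm_greenK_le hk hy hs
    rw [integral_const_mul, norm_sq_sub] at a1
    refine a1.trans ?_
    have a2 : ∫ y in Set.Ioi (0 : ℝ), expK ‖k‖ y s ≤ 2 / ‖k‖ := by
      rw [← integral_expK hz s]
      exact setIntegral_le_integral (integrable_expK hz s)
        (Eventually.of_forall fun y => (expK_pos _ _ _).le)
    calc _ ≤ 2 * ‖k‖ / (k 0 ^ 2 + k 2 ^ 2) * (2 / ‖k‖) := by gcongr
      _ = _ := by field_simp; norm_num
  have h2 : ‖∫ s in Set.Ioi (0 : ℝ), src G k s * ∫ y in Set.Ioi (0 : ℝ),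
      (greenK ‖k‖ (k 1) y s : ℂ) * Complex.exp (-Complex.I * ((y : ℂ) * η))‖
      ≤ ∫ s in Set.Ioi (0 : ℝ), C * srcWeight k * (4 / (k 0 ^ 2 + k 2 ^ 2)) *
        ((1 + |s|) ^ 2)⁻¹ := by
    refine norm_integral_le_of_norm_le ((integrableOn_inv_pow le_rfl).const_mul _) ?_
    filter_upwards [ae_restrict_mem measurableSet_Ioi] with s hs
    rw [norm_mul]
    have h32 : ((1 + |s|) ^ 3)⁻¹ ≤ ((1 + |s|) ^ 2)⁻¹ := by
      have : 1 ≤ 1 + |s| := by linarith [abs_nonneg s]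
      gcongr
      norm_num
    calc _ ≤ (C * (srcWeight k * ((1 + |s|) ^ 3)⁻¹)) * (4 / (k 0 ^ 2 + k 2 ^ 2)) :=
          mul_le_mul (h k s) (h1 s hs) (norm_nonneg _) (by positivity)
      _ ≤ (C * (srcWeight k * ((1 + |s|) ^ 2)⁻¹)) * (4 / (k 0 ^ 2 + k 2 ^ 2)) := by gcongr
      _ = _ := by ring
  rw [integral_const_mul] at h2
  refine h2.trans ?_
  have h3 : srcWeight k ≤ |k 2| * weightV k :=
    (le_mul_of_one_le_right hB (by linarith [norm_nonneg k])).trans (srcWeight_mul_le k)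
  have h4 := setIntegral_inv_sq_le
  have hV := weightV_nonneg k
  calc _ ≤ C * (|k 2| * weightV k) * (4 / (k 0 ^ 2 + k 2 ^ 2)) * decayConst := by gcongr
    _ = _ := by rw [weightW_eq]; ring

lemma measurable_integral_solW_mul_exp : Measurable (fun p : R3 × ℝ =>
    ∫ y in Set.Ioi (0 : ℝ), solW G p.1 y * Complex.exp (-Complex.I * ((y : ℂ) * p.2))) := by
  have : StronglyMeasurable (fun q : (R3 × ℝ) × ℝ =>
      solW G q.1.1 q.2 * Complex.exp (-Complex.I * ((q.2 : ℂ) * q.1.2))) := by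
    refine Measurable.stronglyMeasurable (Measurable.mul ?_ (by fun_prop))
    have := (measurable_solW G).comp
      (show Measurable (fun q : (R3 × ℝ) × ℝ => (q.1.1, q.2)) by fun_prop)
    exact this
  exact (this.integral_prod_right (ν := (volume : Measure ℝ).restrict (Set.Ioi 0))).measurable

lemma invFourier_eq (Φ : 𝓢(R4, ℂ)) (k : R4) :
    invFourier Φ k = ((2 * Real.pi : ℝ) : ℂ)⁻¹ ^ 4 * osc Φ k := by
  unfold invFourier osc
  simp only [real_inner_comm]

lemma integrable_solnHat_mul (hg : Set.EqOn g G (closure cornerDomain)) (Φ : 𝓢(R4, ℂ)) :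
    Integrable (fun k => solnHat g k * invFourier Φ k) := by
  rw [← integrable_insEquiv_iff (3 : Fin 4)]
  have hae : ∀ᵐ p : R3 × ℝ ∂(volume.prod volume), p.1 2 ≠ 0 :=
    Measure.quasiMeasurePreserving_fst.ae (ae_coord_ne_zero (n := 3) 2)
  obtain ⟨C, hC, hb⟩ := exists_bound_integral_solW_mul_exp G
  obtain ⟨C', hC', hb'⟩ := exists_osc_bound Φ
  have e : (fun p : R3 × ℝ => (∫ y in Set.Ioi (0 : ℝ), solW G p.1 y *
      Complex.exp (-Complex.I * ((y : ℂ) * p.2))) * invFourier Φ (insEquiv (3 : Fin 4) p))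
      =ᵐ[volume.prod volume] fun p => solnHat g (insEquiv (3 : Fin 4) p) *
        invFourier Φ (insEquiv (3 : Fin 4) p) := by
    filter_upwards [hae] with p hp
    rw [← solnHat_eq G hg hp]
  refine Integrable.congr ?_ e
  have hW := (integrable_weightW_rpow (σ := 1) le_rfl (by norm_num))
  simp only [Real.rpow_one] at hW
  set c : ℂ := ((2 * Real.pi : ℝ) : ℂ)⁻¹ ^ 4
  refine Integrable.mono' ((hW.const_mul C).mul_prod
    ((integrable_inv_one_add_abs_pow (n := 2) le_rfl).const_mul (‖c‖ * C'))) ?_ ?_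
  · refine ((measurable_integral_solW_mul_exp G).mul ?_).aestronglyMeasurable
    have h1 : Continuous (invFourier Φ) := by
      have : invFourier Φ = fun k => c * osc Φ k := funext (invFourier_eq Φ)
      rw [this]
      exact (continuous_osc Φ.integrable).const_mul c
    exact h1.measurable.comp (insEquiv 3).measurable
  · filter_upwards [hae] with p hp
    rw [norm_mul, invFourier_eq, norm_mul]
    have h1 := hb p.1 p.2 hp
    have h2 := hb' (insEquiv (3 : Fin 4) (p.1, p.2))
    rw [insEquiv_same] at h2
    calc _ ≤ C * weightW p.1 * (‖c‖ * (C' * ((1 + |p.2|) ^ 2)⁻¹)) := by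
          have := weightW_nonneg p.1
          gcongr
      _ = _ := by ring

/-- The multiplication formula for the Fourier transform, applied to `solW` cut off to the half
line. -/
lemma integral_solW_fourier (hk : k 2 ≠ 0) {q : ℝ → ℂ} (hq : Integrable q) :
    ∫ η : ℝ, (∫ y in Set.Ioi (0 : ℝ), solW G k y * Complex.exp (-Complex.I * ((y : ℂ) * η))) * q η
      = ∫ y in Set.Ioi (0 : ℝ), solW G k y * osc q (-y) := by
  set w : ℝ → ℂ := (Set.Ioi (0 : ℝ)).indicator (solW G k) with hw
  have hwi : Integrable w := (integrableOn_solW G hk).integrable_indicator measurableSet_Ioi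
  have e1 : ∀ η : ℝ, ∫ y in Set.Ioi (0 : ℝ), solW G k y * Complex.exp (-Complex.I * ((y : ℂ) * η))
      = osc w (-η) := by
    intro η
    unfold osc
    rw [← integral_indicator measurableSet_Ioi]
    congr 1
    ext y
    by_cases hy : y ∈ Set.Ioi (0 : ℝ)
    · rw [Set.indicator_of_mem hy, hw, Set.indicator_of_mem hy]
      congr 2
      simp
    · rw [Set.indicator_of_notMem hy, hw, Set.indicator_of_notMem hy, zero_mul]
  simp only [e1]
  rw [← integral_neg_eq_self]
  simp only [neg_neg]
  rw [integral_osc_mul hwi hq.comp_neg, ← integral_indicator measurableSet_Ioi]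
  congr 1
  ext y
  rw [osc_comp_neg]
  by_cases hy : y ∈ Set.Ioi (0 : ℝ)
  · rw [Set.indicator_of_mem hy, hw, Set.indicator_of_mem hy]
  · rw [Set.indicator_of_notMem hy, hw, Set.indicator_of_notMem hy, zero_mul]

theorem isInverseFourier_fld (hg : Set.EqOn g G (closure cornerDomain)) :
    IsInverseFourier (solnHat g) (extO1 (fld (solW G))) := by
  intro Φ
  obtain ⟨C, hA⟩ := isAmplitude_solW G
  obtain ⟨h1, h2⟩ := hA.integral_mul Φ
  have h3 := integrable_solnHat_mul G hg Φ
  refine ⟨h1, h3, ?_⟩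
  rw [h2, integral_eq_integral_integral_insEquiv (3 : Fin 4) h3, ← integral_const_mul]
  refine integral_congr_ae ?_
  filter_upwards [ae_coord_ne_zero (n := 3) 2] with k hk
  have e1 : ∀ η, solnHat g (insEquiv (3 : Fin 4) (k, η)) * invFourier Φ (insEquiv (3 : Fin 4) (k, η))
      = ((2 * Real.pi : ℝ) : ℂ)⁻¹ ^ 4 * ((∫ y in Set.Ioi (0 : ℝ), solW G k y *
        Complex.exp (-Complex.I * ((y : ℂ) * η))) * osc Φ (insEquiv (3 : Fin 4) (k, η))) := by
    intro η
    rw [solnHat_eq G hg hk, invFourier_eq]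
    ring
  simp only [e1]
  -- Inversion in the last variable returns one factor `2π`, which turns `(2π)⁻⁴` into `c3`.
  rw [integral_const_mul, integral_solW_fourier G hk (integrable_osc_last Φ k)]
  simp only [osc_osc_last]
  rw [← integral_const_mul, ← integral_const_mul]
  congr 1
  ext y
  have : ((2 * Real.pi : ℝ) : ℂ) ≠ 0 := by
    exact_mod_cast (by positivity : (2 * Real.pi : ℝ) ≠ 0)
  unfold c3
  field_simp

end FourierFormula

/-! ### The equations in the sense of distributions -/

section WeakEquations

/-- The `j`-th partial derivative of a Schwartz function. -/
noncomputable abbrev sd (j : Fin 4) (Φ : 𝓢(R4, ℂ)) : 𝓢(R4, ℂ) :=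
  LineDeriv.lineDerivOp (EuclideanSpace.single j (1 : ℝ)) Φ

lemma sd_apply (j : Fin 4) (Φ : 𝓢(R4, ℂ)) (x : R4) : sd j Φ x = pd j Φ x :=
  SchwartzMap.lineDerivOp_apply_eq_fderiv _ _ _

lemma coe_sd (j : Fin 4) (Φ : 𝓢(R4, ℂ)) : (sd j Φ : R4 → ℂ) = pd j Φ := funext (sd_apply j Φ)

/-- The Laplacian of a Schwartz function, as a Schwartz function. -/
noncomputable def slap (Φ : 𝓢(R4, ℂ)) : 𝓢(R4, ℂ) :=
  sd 0 (sd 0 Φ) + sd 1 (sd 1 Φ) + sd 2 (sd 2 Φ) + sd 3 (sd 3 Φ)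

/-- The operator `∂/∂z̄₂` on Schwartz functions. -/
noncomputable def sdbar (Φ : 𝓢(R4, ℂ)) : 𝓢(R4, ℂ) :=
  (1 / 2 : ℂ) • (sd 1 Φ + Complex.I • sd 3 Φ)

lemma slap_apply (Φ : 𝓢(R4, ℂ)) (x : R4) : slap Φ x = lap Φ x := by
  unfold slap lap
  simp only [add_apply, sd_apply, coe_sd, Fin.sum_univ_four]

lemma sdbar_apply (Φ : 𝓢(R4, ℂ)) (x : R4) : sdbar Φ x = dbar2 Φ x := by
  unfold sdbar
  rw [dbar2_eq]
  simp only [add_apply, smul_apply, sd_apply, smul_eq_mul]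

lemma til_add (Φ Ψ : 𝓢(R4, ℂ)) (k : R3) (y : ℝ) :
    til (Φ + Ψ : 𝓢(R4, ℂ)) k y = til Φ k y + til Ψ k y :=
  osc_add (integrable_slice Φ y) (integrable_slice Ψ y) k

lemma til_smul (c : ℂ) (Φ : 𝓢(R4, ℂ)) (k : R3) (y : ℝ) :
    til (c • Φ : 𝓢(R4, ℂ)) k y = c * til Φ k y := by
  unfold til osc
  rw [← integral_const_mul]
  congr 1
  ext s
  simp only [smul_apply, smul_eq_mul, mul_assoc]

lemma til_slap (Φ : 𝓢(R4, ℂ)) (k : R3) (y : ℝ) :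
    til (slap Φ) k y = til (sd 3 (sd 3 Φ)) k y - (‖k‖ : ℂ) ^ 2 * til Φ k y := by
  have h0 := til_lineDeriv (sd 0 Φ) 0 k y
  have h0' := til_lineDeriv Φ 0 k y
  have h1 := til_lineDeriv (sd 1 Φ) 1 k y
  have h1' := til_lineDeriv Φ 1 k y
  have h2 := til_lineDeriv (sd 2 Φ) 2 k y
  have h2' := til_lineDeriv Φ 2 k y
  simp only [Fin.castSucc_zero, Fin.castSucc_one, Fin.reduceCastSucc] at h0 h0' h1 h1' h2 h2'
  unfold slap
  rw [til_add, til_add, til_add, h0, h0', h1, h1', h2, h2']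
  have hn : (‖k‖ : ℂ) ^ 2 = (k 0 : ℂ) ^ 2 + (k 1 : ℂ) ^ 2 + (k 2 : ℂ) ^ 2 := by
    exact_mod_cast norm_sq_R3 k
  rw [hn]
  linear_combination ((k 0 : ℂ) ^ 2 + (k 1 : ℂ) ^ 2 + (k 2 : ℂ) ^ 2) * til Φ k y * Complex.I_sq

lemma til_sdbar (Φ : 𝓢(R4, ℂ)) (k : R3) (y : ℝ) :
    til (sdbar Φ) k y
      = 1 / 2 * (-(Complex.I * (k 1 : ℂ)) * til Φ k y + Complex.I * til (sd 3 Φ) k y) := by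
  have h1 := til_lineDeriv Φ 1 k y
  simp only [Fin.castSucc_one] at h1
  unfold sdbar
  rw [til_smul, til_add, til_smul, h1]

lemma til_eq_zero {φ : R4 → ℂ} (hφ : Function.support φ ⊆ cornerDomain) (k : R3) {y : ℝ}
    (hy : y ≤ 0) : til φ k y = 0 := by
  have : (fun s : R3 => φ (insEquiv (3 : Fin 4) (s, y))) = fun _ => 0 := by
    ext s
    by_contra h
    have := (hφ (Function.mem_support.2 h)).2
    rw [insEquiv_same] at this
    linarith
  unfold til
  rw [this]
  simp [osc]

variable (G : 𝓢(R4, ℂ))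

/-- After the interchange the inner integral is the Green identity for the function `til Φ k`. It
and its first derivative vanish at height `0` because the support of `Φ` lies in the open corner. -/
lemma integral_solW_til_slap (Φ : 𝓢(R4, ℂ)) (hΦ : tsupport Φ ⊆ cornerDomain) {k : R3}
    (hk : k 2 ≠ 0) :
    ∫ y in Set.Ioi (0 : ℝ), solW G k y * til (slap Φ) k y
      = ∫ s in Set.Ioi (0 : ℝ), src G k s * til Φ k s := by
  obtain ⟨C, -, hC⟩ := exists_til_bound_const (slap Φ)
  rw [integral_solW_mul G hk (continuous_til _ k).measurable (hC k)]
  refine setIntegral_congr_fun measurableSet_Ioi fun s hs => ?_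
  simp only
  congr 1
  simp only [til_slap]
  obtain ⟨A, -, hA⟩ := exists_til_bound_const Φ
  obtain ⟨A', -, hA'⟩ := exists_til_bound_const (sd 3 Φ)
  obtain ⟨A'', -, hA''⟩ := exists_til_bound_const (sd 3 (sd 3 Φ))
  have hΦ' : tsupport (sd 3 Φ) ⊆ cornerDomain := by
    rw [coe_sd]
    exact (tsupport_pd_subset _ _).trans hΦ
  exact integral_greenK_mul_poisson (norm_pos_of_ne hk) (le_of_lt hs)
    (fun y => hasDerivAt_til Φ k y) (fun y => hasDerivAt_til (sd 3 Φ) k y) (continuous_til _ k)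
    (A := max A (max A' A''))
    (fun y => (hA k y).trans (le_max_left _ _))
    (fun y => (hA' k y).trans ((le_max_left _ _).trans (le_max_right _ _)))
    (fun y => (hA'' k y).trans ((le_max_right _ _).trans (le_max_right _ _)))
    (til_eq_zero (subset_closure.trans hΦ) k le_rfl)
    (til_eq_zero (subset_closure.trans hΦ') k le_rfl)

/-- The interchange is made for both kernels, which reduces the claim to the transposition identity
`integral_greenK_mul_dbar` at each source height. -/
lemma integral_solW_til_sdbar (Φ : 𝓢(R4, ℂ)) (hΦ : tsupport Φ ⊆ cornerDomain) {k : R3}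
    (hk : k 2 ≠ 0) :
    ∫ y in Set.Ioi (0 : ℝ), solW G k y * til (sdbar Φ) k y
      = -∫ y in Set.Ioi (0 : ℝ), solV G k y * til Φ k y := by
  obtain ⟨C, -, hC⟩ := exists_til_bound_const (sdbar Φ)
  obtain ⟨A, -, hA⟩ := exists_til_bound_const Φ
  obtain ⟨A', -, hA'⟩ := exists_til_bound_const (sd 3 Φ)
  rw [integral_solW_mul G hk (continuous_til _ k).measurable (hC k),
    integral_solV_mul G hk (continuous_til _ k).measurable (hA k), ← integral_neg]
  refine setIntegral_congr_fun measurableSet_Ioi fun s hs => ?_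
  simp only
  rw [← mul_neg]
  congr 1
  simp only [til_sdbar]
  have hκ : k 1 ≠ ‖k‖ := fun h => by
    have := abs_lt_norm hk
    rw [h, abs_of_pos (norm_pos_of_ne hk)] at this
    exact lt_irrefl _ this
  exact integral_greenK_mul_dbar (norm_pos_of_ne hk) hκ (le_of_lt hs)
    (fun y => hasDerivAt_til Φ k y) (continuous_til _ k) (A := max A A')
    (fun y => (hA k y).trans (le_max_left _ _)) (fun y => (hA' k y).trans (le_max_right _ _))
    (til_eq_zero (subset_closure.trans hΦ) k le_rfl)

/-- The source is recovered from its partial transform. -/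
lemma integral_src_mul_til (Φ : 𝓢(R4, ℂ)) :
    c3 * ∫ k, ∫ s in Set.Ioi (0 : ℝ), src G k s * til Φ k s
      = ∫ s in Set.Ioi (0 : ℝ), ∫ x : R3,
        oddExt G (insEquiv (3 : Fin 4) (x, s)) * Φ (insEquiv (3 : Fin 4) (x, s)) := by
  rw [integral_integral_swap, ← integral_const_mul]
  · congr 1
    ext s
    have h := integral_osc_neg_mul_osc (integrable_oddExt_slice G s) (continuous_slice Φ s)
      (integrable_slice Φ s) (integrable_til Φ s)
    have hd : Module.finrank ℝ R3 = 3 := by simp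
    rw [hd] at h
    have h' : ∫ k, src G k s * til Φ k s = ((2 * Real.pi : ℝ) : ℂ) ^ 3 *
      ∫ x : R3, oddExt G (insEquiv (3 : Fin 4) (x, s)) * Φ (insEquiv (3 : Fin 4) (x, s)) := h
    rw [h', ← mul_assoc]
    have hπ : ((2 * Real.pi : ℝ) : ℂ) ≠ 0 := by
      exact_mod_cast (by positivity : (2 * Real.pi : ℝ) ≠ 0)
    have : c3 * ((2 * Real.pi : ℝ) : ℂ) ^ 3 = 1 := by
      unfold c3
      rw [inv_pow, inv_mul_cancel₀ (pow_ne_zero _ hπ)]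
    rw [this, one_mul]
  · obtain ⟨C, hC, hb⟩ := exists_src_bound G
    obtain ⟨C', hC', hb'⟩ := exists_til_bound Φ
    refine Integrable.mono' (g := fun p : R3 × ℝ => (∏ j, ((1 + |p.1 j|) ^ 2)⁻¹) *
      (C * C' * ((1 + |p.2|) ^ 2)⁻¹)) ?_ ?_ ?_
    · exact (integrable_decay le_rfl).mul_prod ((integrableOn_inv_pow le_rfl).const_mul _)
    · exact ((measurable_src G).mul (measurable_til Φ)).aestronglyMeasurable
    · refine Eventually.of_forall fun p => ?_
      simp only [Function.uncurry]
      rw [norm_mul]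
      have h1 : ‖src G p.1 p.2‖ ≤ C := by
        refine (hb p.1 p.2).trans (mul_le_of_le_one_right hC ?_)
        have a : ∀ (t : ℝ) (n : ℕ), ((1 + |t|) ^ n)⁻¹ ≤ 1 := fun t n =>
          inv_le_one_of_one_le₀ (one_le_pow₀ (by linarith [abs_nonneg t]))
        have b : |p.1 2| / (1 + |p.1 2|) ^ 2 ≤ 1 := by
          rw [div_le_one (by positivity)]
          nlinarith [abs_nonneg (p.1 2)]
        unfold srcWeight
        refine mul_le_one₀ (mul_le_one₀ (a _ _) (by positivity)
          (mul_le_one₀ (a _ _) (by positivity) b)) (by positivity) (a _ _)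
      calc _ ≤ C * (C' * ((∏ j, ((1 + |p.1 j|) ^ 2)⁻¹) * ((1 + |p.2|) ^ 2)⁻¹)) :=
            mul_le_mul h1 (hb' _ _) (norm_nonneg _) hC
        _ = _ := by ring

lemma exists_schwartz_of_test {φ : R4 → ℂ} (h : IsTestFunction φ) :
    ∃ Φ : 𝓢(R4, ℂ), (Φ : R4 → ℂ) = φ :=
  ⟨h.2.1.toSchwartzMap h.1, rfl⟩

theorem isWeakPoisson_fld {g : R4 → ℂ} (hg : Set.EqOn g G (closure cornerDomain)) :
    IsWeakPoisson (fld (solW G)) g := by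
  intro φ hφ
  obtain ⟨Φ, rfl⟩ := exists_schwartz_of_test hφ
  obtain ⟨C, hA⟩ := isAmplitude_solW G
  have hsupp : Function.support Φ ⊆ cornerDomain := subset_closure.trans hφ.2.2
  have hlap : tsupport (lap Φ) ⊆ cornerDomain := (IsTestOn.laplace hφ).2.2
  have e1 : ∫ x in cornerDomain, fld (solW G) x * lap Φ x
      = ∫ x, extO1 (fld (solW G)) x * slap Φ x := by
    rw [← integral_extO1_mul _ hlap]
    simp only [slap_apply]
  rw [laplacian_eq_lap hφ.1, e1, (hA.integral_mul (slap Φ)).2]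
  have e2 : ∫ k, ∫ y in Set.Ioi (0 : ℝ), solW G k y * til (slap Φ) k y
      = ∫ k, ∫ s in Set.Ioi (0 : ℝ), src G k s * til Φ k s := by
    refine integral_congr_ae ?_
    filter_upwards [ae_coord_ne_zero (n := 3) 2] with k hk
    exact integral_solW_til_slap G Φ hφ.2.2 hk
  rw [e2, integral_src_mul_til]
  have hout : ∀ x, x ∉ cornerDomain → Φ x = 0 := fun x hx => by
    by_contra h
    exact hx (hsupp (Function.mem_support.2 h))
  have hint : Integrable (fun x => oddExt G x * Φ x) := by
    obtain ⟨D, hD, hb⟩ := exists_oddExt_bound G 0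
    refine Φ.integrable.bdd_mul (c := D)
      (measurable_oddExt G.continuous.measurable).aestronglyMeasurable
      (Eventually.of_forall fun x => ?_)
    simpa using hb x
  have e3 : ∫ s in Set.Ioi (0 : ℝ), ∫ x : R3,
        oddExt G (insEquiv (3 : Fin 4) (x, s)) * Φ (insEquiv (3 : Fin 4) (x, s))
      = ∫ x, oddExt G x * Φ x := by
    rw [integral_eq_integral_integral_insEquiv_swap (3 : Fin 4) hint]
    refine setIntegral_eq_integral_of_forall_compl_eq_zero fun s hs => ?_
    have : ∀ x : R3, Φ (insEquiv (3 : Fin 4) (x, s)) = 0 := fun x => by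
      refine hout _ fun h => hs ?_
      have := h.2
      rwa [insEquiv_same] at this
    simp [this]
  rw [e3, ← setIntegral_eq_integral_of_forall_compl_eq_zero (s := cornerDomain)
    (fun x hx => by rw [hout x hx, mul_zero])]
  refine setIntegral_congr_fun isOpen_cornerDomain.measurableSet fun x hx => ?_
  rw [hg (subset_closure hx), oddExt, if_pos hx.1]

theorem isWeakDbar2_fld : IsWeakDbar2 (fld (solW G)) (fld (solV G)) := by
  intro φ hφ
  obtain ⟨Φ, rfl⟩ := exists_schwartz_of_test hφ
  obtain ⟨C, hA⟩ := isAmplitude_solW G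
  obtain ⟨C', hA'⟩ := isAmplitude_solV G
  have hdbar : tsupport (dbar2 Φ) ⊆ cornerDomain := (IsTestOn.dbar hφ).2.2
  have e1 : ∫ x in cornerDomain, fld (solW G) x * dbar2 Φ x
      = ∫ x, extO1 (fld (solW G)) x * sdbar Φ x := by
    rw [← integral_extO1_mul _ hdbar]
    simp only [sdbar_apply]
  rw [e1, (hA.integral_mul (sdbar Φ)).2, ← integral_extO1_mul _ hφ.2.2, (hA'.integral_mul Φ).2,
    ← mul_neg, ← integral_neg]
  congr 1
  refine integral_congr_ae ?_
  filter_upwards [ae_coord_ne_zero (n := 3) 2] with k hk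
  exact integral_solW_til_sdbar G Φ hφ.2.2 hk

end WeakEquations

/-! ### Boundary traces -/

/-- With `‖F‖ ≤ B` one has `‖F‖ ^ Q ≤ B ^ (Q - 2) ‖F‖²`. Only `L²` convergence of slices is then
needed, where Plancherel is available. -/
lemma tendsto_eLpNorm_of_sq {α : Type*} [MeasurableSpace α] {μ : Measure α} {l : Filter ℝ}
    {F : ℝ → α → ℂ} {B : ℝ} (hB : ∀ t s, ‖F t s‖ ≤ B)
    (h : Tendsto (fun t => ∫⁻ s, ‖F t s‖ₑ ^ (2 : ℝ) ∂μ) l (𝓝 0)) {q : ℝ≥0∞} (hq : 2 < q)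
    (hqt : q ≠ ⊤) : Tendsto (fun t => eLpNorm (F t) q μ) l (𝓝 0) := by
  have hq0 : q ≠ 0 := (lt_trans (by norm_num) hq).ne'
  set Q := q.toReal with hQ
  have hQ2 : 2 < Q := by
    have := (ENNReal.toReal_lt_toReal (by norm_num) hqt).2 hq
    simpa using this
  have hle : ∀ t, ∫⁻ s, ‖F t s‖ₑ ^ Q ∂μ
      ≤ ENNReal.ofReal B ^ (Q - 2) * ∫⁻ s, ‖F t s‖ₑ ^ (2 : ℝ) ∂μ := by
    intro t
    rw [← lintegral_const_mul' _ _ (ENNReal.rpow_ne_top_of_nonneg (by linarith)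
      ENNReal.ofReal_ne_top)]
    refine lintegral_mono fun s => ?_
    have e : ‖F t s‖ₑ ^ Q = ‖F t s‖ₑ ^ (Q - 2) * ‖F t s‖ₑ ^ (2 : ℝ) := by
      rw [← ENNReal.rpow_add_of_nonneg _ _ (by linarith) (by norm_num)]
      congr 1
      ring
    rw [e]
    have hb : ‖F t s‖ₑ ≤ ENNReal.ofReal B := by
      rw [← ofReal_norm]
      exact ENNReal.ofReal_le_ofReal (hB t s)
    have := ENNReal.rpow_le_rpow hb (by linarith : 0 ≤ Q - 2)
    gcongr
  have h1 : Tendsto (fun t => ENNReal.ofReal B ^ (Q - 2) * ∫⁻ s, ‖F t s‖ₑ ^ (2 : ℝ) ∂μ) l (𝓝 0) := by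
    have := ENNReal.Tendsto.const_mul (a := ENNReal.ofReal B ^ (Q - 2)) h
      (Or.inr (ENNReal.rpow_ne_top_of_nonneg (by linarith) ENNReal.ofReal_ne_top))
    rwa [mul_zero] at this
  have h2 := tendsto_of_tendsto_of_tendsto_of_le_of_le tendsto_const_nhds h1
    (fun t => zero_le) hle
  have h3 := h2.ennrpow_const (1 / Q)
  rw [ENNReal.zero_rpow_of_pos (by positivity)] at h3
  refine h3.congr fun t => ?_
  rw [eLpNorm_eq_lintegral_rpow_enorm_toReal hq0 hqt]

/-- An essential limit ignores the single slice `t = 0`. -/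
lemma nhds_inf_ae_le : (𝓝 (0 : ℝ) ⊓ ae volume) ≤ 𝓝[≠] 0 := by
  refine le_inf inf_le_left (inf_le_right.trans ?_)
  rw [le_principal_iff]
  exact compl_mem_ae_iff.2 (measure_singleton 0)

lemma tendsto_abs_nhdsNE : Tendsto (fun t : ℝ => |t|) (𝓝[≠] 0) (𝓝[>] 0) := by
  refine tendsto_nhdsWithin_iff.2 ⟨?_, ?_⟩
  · have : Tendsto (fun t : ℝ => |t|) (𝓝 0) (𝓝 |0|) := continuous_abs.tendsto 0
    rw [abs_zero] at this
    exact this.mono_left nhdsWithin_le_nhds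
  · filter_upwards [self_mem_nhdsWithin] with t ht
    exact abs_pos.2 ht

lemma enorm_rpow_two_le {a : ℂ} {b : ℝ} (h : ‖a‖ ≤ b) : ‖a‖ₑ ^ (2 : ℝ) ≤ ENNReal.ofReal (b ^ 2) := by
  have hb : 0 ≤ b := (norm_nonneg _).trans h
  rw [← ofReal_norm, ENNReal.ofReal_rpow_of_nonneg (norm_nonneg _) (by norm_num)]
  refine ENNReal.ofReal_le_ofReal ?_
  rw [Real.rpow_ofNat]
  gcongr

lemma memLp_two_of_sq {α : Type*} [MeasurableSpace α] {μ : Measure α} {f : α → ℂ} {b : α → ℝ}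
    (hf : AEStronglyMeasurable f μ) (h : ∀ᵐ x ∂μ, ‖f x‖ ≤ b x) (hb : Integrable (fun x => b x ^ 2) μ) :
    MemLp f 2 μ := by
  rw [memLp_two_iff_integrable_sq_norm hf]
  refine hb.mono' (hf.norm.pow 2) ?_
  filter_upwards [h] with x hx
  rw [Real.norm_of_nonneg (by positivity)]
  gcongr

section SecondTrace

variable (G : 𝓢(R4, ℂ))

lemma tendsto_lintegral_solV_sq :
    Tendsto (fun y => ∫⁻ k, ‖solV G k y‖ₑ ^ (2 : ℝ)) (𝓝[>] 0) (𝓝 0) := by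
  obtain ⟨C, hA⟩ := isAmplitude_solV G
  have hi : Integrable (fun k : R3 => (C * weightV' k) ^ 2) := by
    have := (integrable_weightV'_rpow (σ := 2) (by norm_num)).const_mul (C ^ 2)
    refine this.congr (Eventually.of_forall fun k => ?_)
    simp only [Real.rpow_ofNat]
    ring
  have h := tendsto_lintegral_filter_of_dominated_convergence (l := 𝓝[>] (0 : ℝ))
    (μ := (volume : Measure R3)) (F := fun y k => ‖solV G k y‖ₑ ^ (2 : ℝ)) (f := fun _ => 0)
    (fun k => ENNReal.ofReal ((C * weightV' k) ^ 2))
    (Eventually.of_forall fun y => (hA.meas_slice y).enorm.pow_const _) ?_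
    hi.lintegral_lt_top.ne ?_
  · simpa using h
  · filter_upwards [self_mem_nhdsWithin] with y hy
    exact Eventually.of_forall fun k => enorm_rpow_two_le (hA.norm_le k (le_of_lt hy))
  · refine Eventually.of_forall fun k => ?_
    have h1 := ((tendsto_solV G k).enorm).ennrpow_const (2 : ℝ)
    simpa using h1

lemma extO12_insEquiv_abs (f : R4 → ℂ) {t : ℝ} (ht : t ≠ 0) (s : R3) :
    ‖extO12 f (insEquiv (3 : Fin 4) (s, t))‖ₑ = ‖extO1 f (insEquiv (3 : Fin 4) (s, |t|))‖ₑ := by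
  rcases lt_or_gt_of_ne ht with h | h
  · have e : insEquiv (3 : Fin 4) (s, t) = coordRefl 3 (insEquiv (3 : Fin 4) (s, -t)) := by
      rw [coordRefl_three, insEquiv_three, insEquiv_three]
      simp [reflY2]
    rw [e, extO12_coordRefl, enorm_neg, extO12_of_pos _ (by rw [insEquiv_same]; linarith),
      abs_of_neg h]
  · rw [extO12_of_pos _ (by rwa [insEquiv_same]), abs_of_pos h]

theorem vanishesAtY2_fld {r : ℝ≥0∞} (hr : 2 < r) (hrt : r ≠ ⊤) :
    VanishesAtY2 (extO12 (fld (solV G))) r := by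
  obtain ⟨C, hA⟩ := isAmplitude_solV G
  have hi : Integrable (fun k : R3 => (C * weightV' k) ^ 2) := by
    have := (integrable_weightV'_rpow (σ := 2) (by norm_num)).const_mul (C ^ 2)
    refine this.congr (Eventually.of_forall fun k => ?_)
    simp only [Real.rpow_ofNat]
    ring
  unfold VanishesAtY2
  simp only [← insEquiv_three]
  refine tendsto_eLpNorm_of_sq (B := 2 * (‖c3‖ * ∫ k, C * weightV' k)) (fun t s => ?_) ?_ hr hrt
  · unfold extO12
    refine (norm_sub_le _ _).trans ?_
    linarith [hA.norm_extO1_fld_le (insEquiv (3 : Fin 4) (s, t)),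
      hA.norm_extO1_fld_le (reflY2 (insEquiv (3 : Fin 4) (s, t)))]
  · refine Tendsto.mono_left ?_ nhds_inf_ae_le
    -- Oddness in `y₂` reduces negative heights to `|t|`; Plancherel in the three remaining
    -- variables then returns the amplitude.
    have e : ∀ᶠ t : ℝ in 𝓝[≠] 0, ‖c3‖ₑ ^ (2 : ℝ) * (plancherelConst R3 *
        ∫⁻ k, ‖solV G k |t|‖ₑ ^ (2 : ℝ))
        = ∫⁻ s, ‖extO12 (fld (solV G)) (insEquiv (3 : Fin 4) (s, t))‖ₑ ^ (2 : ℝ) := by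
      filter_upwards [self_mem_nhdsWithin] with t ht
      have ht' : 0 < |t| := abs_pos.2 ht
      simp only [extO12_insEquiv_abs _ ht, extO1_fld hA, not_le.2 ht', if_false, enorm_mul,
        ENNReal.mul_rpow_of_nonneg _ _ (zero_le_two (α := ℝ))]
      rw [lintegral_const_mul' _ _ (by finiteness), lintegral_osc_sq (hA.integrable_slice ht'.le)
        (memLp_two_of_sq (hA.meas_slice _).aestronglyMeasurable
          (Eventually.of_forall fun k => hA.norm_le k ht'.le) hi)]
    refine Tendsto.congr' e ?_
    have h1 := (tendsto_lintegral_solV_sq G).comp tendsto_abs_nhdsNE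
    have h2 := ENNReal.Tendsto.const_mul (a := plancherelConst R3) h1
      (Or.inr (plancherelConst_ne_top R3))
    have h3 := ENNReal.Tendsto.const_mul (a := ‖c3‖ₑ ^ (2 : ℝ)) h2 (Or.inr (by finiteness))
    simpa using h3

end SecondTrace

section FirstTrace

variable (G : 𝓢(R4, ℂ))

/-- The amplitude of the solution on the slice `y₁ = t`. -/
noncomputable def traceAmp (t : ℝ) (p : ℝ × EuclideanSpace ℝ (Fin 2)) : ℂ :=
  osc (fun κ : ℝ => solW G (insEquiv (2 : Fin 3) (p.2, κ)) p.1) t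

/-- The uneven split `ε = 1 / 4` makes `|κ|^{-3/4}` integrable, as needed for the integral over `κ`,
and `|a 0|^{-1/4}` square integrable, as needed for Plancherel. The even split would fail the second
requirement. -/
lemma exists_solW_bound_prod : ∃ C : ℝ, 0 ≤ C ∧ ∀ (a : EuclideanSpace ℝ (Fin 2)) (κ y : ℝ),
    a 0 ≠ 0 → κ ≠ 0 → 0 ≤ y → ‖solW G (insEquiv (2 : Fin 3) (a, κ)) y‖
      ≤ C * (1 + y)⁻¹ * (pw (1 / 4) 2 (a 0) * pw 0 2 (a 1)) * pw (1 - 1 / 4) 1 κ := by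
  obtain ⟨C, hC, h⟩ := exists_solW_bound G
  refine ⟨C, hC, fun a κ y ha hκ hy => (h _ y hy).trans ?_⟩
  have e0 : insEquiv (2 : Fin 3) (a, κ) 0 = a 0 := by rw [insEquiv_two_R3]; simp
  have e1 : insEquiv (2 : Fin 3) (a, κ) 1 = a 1 := by rw [insEquiv_two_R3]; simp
  have e2 : insEquiv (2 : Fin 3) (a, κ) 2 = κ := by rw [insEquiv_two_R3]; simp
  have h1 := weightW_le (k := insEquiv (2 : Fin 3) (a, κ)) (ε := 1 / 4) (by norm_num) (by norm_num)
    (by rwa [e0]) (by rwa [e2])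
  rw [e0, e1, e2] at h1
  calc C * weightW (insEquiv (2 : Fin 3) (a, κ)) * (1 + y)⁻¹
      ≤ C * (pw (1 / 4) 2 (a 0) * pw 0 2 (a 1) * pw (1 - 1 / 4) 1 κ) * (1 + y)⁻¹ := by gcongr
    _ = _ := by ring

lemma measurable_solW_ins :
    Measurable (fun q : (ℝ × EuclideanSpace ℝ (Fin 2)) × ℝ =>
      solW G (insEquiv (2 : Fin 3) (q.1.2, q.2)) q.1.1) := by
  have h1 : Measurable (fun q : (ℝ × EuclideanSpace ℝ (Fin 2)) × ℝ =>
      (insEquiv (2 : Fin 3) (q.1.2, q.2), q.1.1)) :=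
    ((insEquiv 2).measurable.comp (by fun_prop)).prodMk (by fun_prop)
  have := (measurable_solW G).comp h1
  exact this

lemma measurable_traceAmp (t : ℝ) : Measurable (traceAmp G t) := by
  unfold traceAmp osc
  have : StronglyMeasurable (fun q : (ℝ × EuclideanSpace ℝ (Fin 2)) × ℝ =>
      solW G (insEquiv (2 : Fin 3) (q.1.2, q.2)) q.1.1 *
        Complex.exp (Complex.I * ((inner ℝ t q.2 : ℝ) : ℂ))) :=
    Measurable.stronglyMeasurable ((measurable_solW_ins G).mul (by fun_prop))
  exact (this.integral_prod_right (ν := (volume : Measure ℝ))).measurable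

lemma measurable_solW_line (a : EuclideanSpace ℝ (Fin 2)) (y : ℝ) :
    Measurable (fun κ : ℝ => solW G (insEquiv (2 : Fin 3) (a, κ)) y) := by
  have := (measurable_solW_ins G).comp (measurable_prodMk_left (x := (y, a)))
  exact this

lemma integrable_solW_line {a : EuclideanSpace ℝ (Fin 2)} (ha : a 0 ≠ 0) {y : ℝ} (hy : 0 ≤ y) :
    Integrable (fun κ : ℝ => solW G (insEquiv (2 : Fin 3) (a, κ)) y) := by
  obtain ⟨C, -, h⟩ := exists_solW_bound_prod G
  refine Integrable.mono' ((integrable_pw (a := 1 - 1 / 4) (b := 1) (by norm_num)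
    (by norm_num)).const_mul (C * (1 + y)⁻¹ * (pw (1 / 4) 2 (a 0) * pw 0 2 (a 1))))
    (measurable_solW_line G a y).aestronglyMeasurable ?_
  have : ∀ᵐ κ : ℝ, κ ≠ 0 := compl_mem_ae_iff.2 (measure_singleton 0)
  filter_upwards [this] with κ hκ
  exact h a κ y ha hκ hy

lemma exists_traceAmp_bound : ∃ C : ℝ, 0 ≤ C ∧ ∀ (t y : ℝ) (a : EuclideanSpace ℝ (Fin 2)),
    a 0 ≠ 0 → 0 ≤ y →
      ‖traceAmp G t (y, a)‖ ≤ C * (1 + y)⁻¹ * (pw (1 / 4) 2 (a 0) * pw 0 2 (a 1)) := by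
  obtain ⟨C, hC, h⟩ := exists_solW_bound_prod G
  refine ⟨C * ∫ κ, pw (1 - 1 / 4) 1 κ,
    mul_nonneg hC (integral_nonneg fun κ => pw_nonneg _ _ _), fun t y a ha hy => ?_⟩
  refine (norm_osc_le _ _).trans ?_
  have hi := integrable_pw (a := 1 - 1 / 4) (b := 1) (by norm_num) (by norm_num)
  have hκ : ∀ᵐ κ : ℝ, κ ≠ 0 := compl_mem_ae_iff.2 (measure_singleton 0)
  have := integral_mono_ae (integrable_solW_line G ha hy).norm
    (hi.const_mul (C * (1 + y)⁻¹ * (pw (1 / 4) 2 (a 0) * pw 0 2 (a 1)))) (by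
      filter_upwards [hκ] with κ hκ
      exact h a κ y ha hκ hy)
  rw [integral_const_mul] at this
  linarith

/-- At `t = 0` the trace is the plain integral of a function odd in `κ`, hence zero. Continuity of
the oscillatory integral does the rest. -/
lemma tendsto_traceAmp {a : EuclideanSpace ℝ (Fin 2)} (ha : a 0 ≠ 0) {y : ℝ} (hy : 0 ≤ y) :
    Tendsto (fun t => traceAmp G t (y, a)) (𝓝 0) (𝓝 0) := by
  have hc : Continuous (fun t => traceAmp G t (y, a)) := continuous_osc (integrable_solW_line G ha hy)
  have h0 : traceAmp G 0 (y, a) = 0 := by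
    have e : traceAmp G 0 (y, a) = ∫ κ : ℝ, solW G (insEquiv (2 : Fin 3) (a, κ)) y := by
      simp [traceAmp, osc]
    have hodd : ∀ κ : ℝ, solW G (insEquiv (2 : Fin 3) (a, -κ)) y
        = -solW G (insEquiv (2 : Fin 3) (a, κ)) y := by
      intro κ
      rw [insEquiv_two_R3, insEquiv_two_R3, solW_odd]
    have h2 : ∫ κ : ℝ, solW G (insEquiv (2 : Fin 3) (a, κ)) y
        = -∫ κ : ℝ, solW G (insEquiv (2 : Fin 3) (a, κ)) y := by
      conv_lhs => rw [← integral_neg_eq_self]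
      simp only [hodd, integral_neg]
    rw [e]
    exact self_eq_neg.1 h2
  have := hc.tendsto 0
  rwa [h0] at this

lemma integrable_planeWeight {σ : ℝ} (h1 : 1 ≤ σ) (h2 : σ < 4) :
    Integrable (fun a : EuclideanSpace ℝ (Fin 2) => (pw (1 / 4) 2 (a 0) * pw 0 2 (a 1)) ^ σ) := by
  have h := integrable_prod_coord (n := 2) (f := ![pw (1 / 4 * σ) (2 * σ), pw (0 * σ) (2 * σ)]) (by
      intro j
      fin_cases j
      · exact integrable_pw (by linarith) (by linarith)
      · exact integrable_pw (by linarith) (by linarith))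
  refine h.congr (Eventually.of_forall fun a => ?_)
  simp only [Fin.prod_univ_two]
  rw [Real.mul_rpow (pw_nonneg _ _ _) (pw_nonneg _ _ _), pw_rpow, pw_rpow]
  rfl

lemma tendsto_lintegral_traceAmp_sq :
    Tendsto (fun t => ∫⁻ p, ‖traceAmp G t p‖ₑ ^ (2 : ℝ)
      ∂((volume.restrict (Set.Ioi (0 : ℝ))).prod volume)) (𝓝 0) (𝓝 0) := by
  obtain ⟨C, hC, hb⟩ := exists_traceAmp_bound G
  have hi : Integrable (fun p : ℝ × EuclideanSpace ℝ (Fin 2) =>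
      (C ^ 2 * ((1 + |p.1|) ^ 2)⁻¹) * ((pw (1 / 4) 2 (p.2 0) * pw 0 2 (p.2 1)) ^ (2 : ℝ)))
      ((volume.restrict (Set.Ioi (0 : ℝ))).prod volume) :=
    ((integrableOn_inv_pow le_rfl).const_mul (C ^ 2)).mul_prod
      (integrable_planeWeight (by norm_num) (by norm_num))
  have hae : ∀ᵐ p : ℝ × EuclideanSpace ℝ (Fin 2)
      ∂((volume.restrict (Set.Ioi (0 : ℝ))).prod volume), 0 < p.1 ∧ p.2 0 ≠ 0 :=
    (Measure.quasiMeasurePreserving_fst.ae (ae_restrict_mem measurableSet_Ioi)).and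
      (Measure.quasiMeasurePreserving_snd.ae (ae_coord_ne_zero (n := 2) 0))
  have h := tendsto_lintegral_filter_of_dominated_convergence (l := 𝓝 (0 : ℝ))
    (μ := (volume.restrict (Set.Ioi (0 : ℝ))).prod (volume : Measure (EuclideanSpace ℝ (Fin 2))))
    (F := fun t p => ‖traceAmp G t p‖ₑ ^ (2 : ℝ)) (f := fun _ => 0)
    (fun p => ENNReal.ofReal ((C ^ 2 * ((1 + |p.1|) ^ 2)⁻¹) *
      ((pw (1 / 4) 2 (p.2 0) * pw 0 2 (p.2 1)) ^ (2 : ℝ))))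
    (Eventually.of_forall fun t => (measurable_traceAmp G t).enorm.pow_const _) ?_
    hi.lintegral_lt_top.ne ?_
  · simpa using h
  · refine Eventually.of_forall fun t => ?_
    filter_upwards [hae] with p hp
    refine (enorm_rpow_two_le (hb t p.1 p.2 hp.2 hp.1.le)).trans (le_of_eq ?_)
    rw [Real.rpow_ofNat, abs_of_pos hp.1, mul_pow, mul_pow C, inv_pow]
  · filter_upwards [hae] with p hp
    have h1 := ((tendsto_traceAmp G hp.2 hp.1.le).enorm).ennrpow_const (2 : ℝ)
    simpa using h1

lemma osc_solW_eq {y : ℝ} (hy : 0 ≤ y) (a : EuclideanSpace ℝ (Fin 2)) (t : ℝ) :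
    osc (fun k => solW G k y) (insEquiv (2 : Fin 3) (a, t))
      = osc (fun b => traceAmp G t (y, b)) a := by
  obtain ⟨C, hA⟩ := isAmplitude_solW G
  have hint : Integrable (fun k => solW G k y * Complex.exp (Complex.I *
      ((inner ℝ (insEquiv (2 : Fin 3) (a, t)) k : ℝ) : ℂ))) := by
    refine (hA.integrable_slice hy).mul_bdd (c := 1) (by fun_prop) (Eventually.of_forall fun s => ?_)
    rw [norm_exp_I_mul_ofReal]
  rw [osc, integral_eq_integral_integral_insEquiv (2 : Fin 3) hint, osc]
  congr 1
  ext b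
  rw [traceAmp, osc, ← integral_mul_const]
  congr 1
  ext κ
  rw [mul_assoc, ← Complex.exp_add, ← mul_add, ← Complex.ofReal_add]
  congr 4
  rw [inner_R3, insEquiv_two_R3, insEquiv_two_R3]
  simp [PiLp.inner_apply, Fin.sum_univ_two, mul_comm]
  ring

theorem vanishesAtY1_fld {q : ℝ≥0∞} (hq : 2 < q) (hqt : q ≠ ⊤) :
    VanishesAtY1 (extO1 (fld (solW G))) q := by
  obtain ⟨C, hA⟩ := isAmplitude_solW G
  obtain ⟨C', hC', hb⟩ := exists_traceAmp_bound G
  have hm := measurable_extO1 hA.measurable_fld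
  unfold VanishesAtY1
  simp only [← insEquiv_two]
  refine tendsto_eLpNorm_of_sq (fun t s => hA.norm_extO1_fld_le _) ?_ hq hqt
  refine Tendsto.mono_left ?_ (inf_le_left : (𝓝 (0 : ℝ) ⊓ ae volume) ≤ 𝓝 0)
  set E2 := EuclideanSpace ℝ (Fin 2)
  -- On the slice `y₁ = t` the frequency `κ` is integrated out, and Plancherel is applied in `(x₁,
  -- x₂)` at each height `y₂`.
  have e : ∀ t : ℝ, ‖c3‖ₑ ^ (2 : ℝ) * (plancherelConst E2 *
      ∫⁻ p, ‖traceAmp G t p‖ₑ ^ (2 : ℝ) ∂((volume.restrict (Set.Ioi (0 : ℝ))).prod volume))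
      = ∫⁻ s, ‖extO1 (fld (solW G)) (insEquiv (2 : Fin 4) (s, t))‖ₑ ^ (2 : ℝ) := by
    intro t
    have hms : Measurable (fun s : R3 => ‖extO1 (fld (solW G)) (insEquiv (2 : Fin 4) (s, t))‖ₑ ^ (2 : ℝ)) := by
      have h1 := (hm.comp (insEquiv (2 : Fin 4)).measurable).comp
        (measurable_prodMk_right (y := t) (α := R3))
      exact (h1.enorm.pow_const _)
    rw [lintegral_eq_lintegral_lintegral_insEquiv (2 : Fin 3) hms.aemeasurable,
      lintegral_prod _ ((measurable_traceAmp G t).enorm.pow_const _).aemeasurable,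
      ← lintegral_const_mul' _ _ (plancherelConst_ne_top E2),
      ← lintegral_const_mul' _ _ (by finiteness), ← lintegral_indicator measurableSet_Ioi]
    congr 1
    ext y
    have hpt : ∀ a : E2, insEquiv (2 : Fin 4) (insEquiv (2 : Fin 3) (a, y), t)
        = insEquiv (3 : Fin 4) (insEquiv (2 : Fin 3) (a, t), y) := by
      intro a
      rw [insEquiv_two, insEquiv_three, insEquiv_two_R3, insEquiv_two_R3]
      simp
    simp only [hpt, extO1_fld hA]
    by_cases hy : y ≤ 0
    · simp [hy]
    · have hy' : 0 < y := not_le.1 hy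
      have hae : ∀ᵐ a : E2, ‖traceAmp G t (y, a)‖
          ≤ C' * (1 + y)⁻¹ * (pw (1 / 4) 2 (a 0) * pw 0 2 (a 1)) := by
        filter_upwards [ae_coord_ne_zero (n := 2) 0] with a ha
        exact hb t y a ha hy'.le
      have hmt : Measurable (fun a : E2 => traceAmp G t (y, a)) := by
        have := (measurable_traceAmp G t).comp (measurable_prodMk_left (x := y) (β := E2))
        exact this
      have hw1 := integrable_planeWeight (σ := 1) le_rfl (by norm_num)
      simp only [Real.rpow_one] at hw1
      have hi1 : Integrable (fun a : E2 => traceAmp G t (y, a)) :=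
        (hw1.const_mul _).mono' hmt.aestronglyMeasurable hae
      have hi2 : MemLp (fun a : E2 => traceAmp G t (y, a)) 2 := by
        refine memLp_two_of_sq hmt.aestronglyMeasurable hae ?_
        refine ((integrable_planeWeight (σ := 2) (by norm_num) (by norm_num)).const_mul
          ((C' * (1 + y)⁻¹) ^ 2)).congr (Eventually.of_forall fun a => ?_)
        simp only [Real.rpow_ofNat]
        ring
      rw [Set.indicator_of_mem (Set.mem_Ioi.2 hy')]
      simp only [hy, if_false, enorm_mul, ENNReal.mul_rpow_of_nonneg _ _ (zero_le_two (α := ℝ)),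
        osc_solW_eq G hy'.le]
      rw [lintegral_const_mul' _ _ (by finiteness), lintegral_osc_sq hi1 hi2]
  refine Tendsto.congr e ?_
  have h2 := ENNReal.Tendsto.const_mul (a := plancherelConst E2) (tendsto_lintegral_traceAmp_sq G)
    (Or.inr (plancherelConst_ne_top E2))
  have h3 := ENNReal.Tendsto.const_mul (a := ‖c3‖ₑ ^ (2 : ℝ)) h2 (Or.inr (by finiteness))
  simpa using h3

end FirstTrace

/-! ### The proposition -/

theorem isMixedSolution_fld {g : R4 → ℂ} (G : 𝓢(R4, ℂ))
    (hg : Set.EqOn g G (closure cornerDomain)) {p q r : ℝ≥0∞} (hp : 2 < p) (hpt : p ≠ ⊤)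
    (hq : 2 < q) (hqt : q ≠ ⊤) (hr : 2 < r) (hrt : r ≠ ⊤) :
    IsMixedSolution g p q r (fld (solW G)) := by
  obtain ⟨C, hA⟩ := isAmplitude_solW G
  obtain ⟨C', hA'⟩ := isAmplitude_solV G
  exact ⟨hA.memLp hp hpt, isWeakPoisson_fld G hg, vanishesAtY1_fld G hq hqt, fld (solV G),
    isWeakDbar2_fld G, hA'.memLp hp hpt, vanishesAtY2_fld G hr hrt⟩

theorem mainTheorem5 (g : R4 → ℂ) (hg : IsSchwartzOnClosure g) :
    ∃ u : R4 → ℂ,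
      IsInverseFourier (solnHat g) (extO1 u) ∧
      (∀ p q r : ℝ≥0∞, 2 < p → p < ⊤ → 2 < q → q < 4 → 2 < r → r < ⊤ →
        IsMixedSolution g p q r u) ∧
      (∀ p q r : ℝ≥0∞, 2 < p → p < ⊤ → 2 < q → q < 4 → 2 < r → r < ⊤ →
        ∀ w : R4 → ℂ, IsMixedSolution g p q r w → extO1 w =ᵐ[volume] extO1 u) := by
  obtain ⟨G, hG⟩ := hg
  have hone : ∀ {a : ℝ≥0∞}, 2 < a → 1 ≤ a := fun h => le_of_lt (lt_trans (by norm_num) h)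
  have hsol : ∀ p q r : ℝ≥0∞, 2 < p → p < ⊤ → 2 < q → q < 4 → 2 < r → r < ⊤ →
      IsMixedSolution g p q r (fld (solW G)) := fun p q r hp hpt hq hq4 hr hrt =>
    isMixedSolution_fld G hG hp hpt.ne hq (hq4.trans (by norm_num)).ne hr hrt.ne
  refine ⟨fld (solW G), isInverseFourier_fld G hG, hsol, ?_⟩
  intro p q r hp hpt hq hq4 hr hrt w hw
  exact ae_eq_of_isMixedSolution (hone hp) hpt.ne (hone hq) (hone hr) hw
    (hsol p q r hp hpt hq hq4 hr hrt)
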